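/- Let $-1\le a_1<a_2<a_3<a_4\le 1$ and $\Gamma=[-1,a_1]\cup[a_2,a_3]\cup[a_4,1]$. A genus-one soliton condensate of the defocusing NLS equation (on the background with spectral band $[-1,1]$) with spectral support $\Gamma$ is given by a density of states $u$ and a density of fluxes $v$, real functions on $\Gamma$, each in $L^p(\Gamma)$ for some $p>1$, that solve the nonlinear dispersion relations with zero spectral scaling function, $$\int_\Gamma \ln\left|\frac{R_0(z)R_0(w)+wz-1}{z-w}\right|u(w)\,dw=\sqrt{1-z^2},\qquad \int_\Gamma \ln\left|\frac{R_0(z)R_0(w)+wz-1}{z-w}\right|v(w)\,dw=2z\sqrt{1-z^2},\qquad z\in\Gamma,$$ where $R_0(z)R_0(w)=-\sqrt{1-z^2}\sqrt{1-w^2}$ for $z,w\in[-1,1]$. Its averages are defined by $$\langle|\psi|^2\rangle=1-2\int_\Gamma u(\zeta)\sqrt{1-\zeta^2}\,d\zeta,\qquad \langle|\psi|^4\rangle=1-\frac{16}{3}\int_\Gamma\Big(\zeta^2+\frac12\Big)u(\zeta)\sqrt{1-\zeta^2}\,d\zeta+2\int_\Gamma\zeta\, v(\zeta)\sqrt{1-\zeta^2}\,d\zeta,$$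 and its kurtosis is $\kappa=\langle|\psi|^4\rangle/\langle|\psi|^2\rangle^2$. Theorem. Such $u,v$ exist, and for all such $u,v$: (i) $\kappa$ is the kurtosis of the genus-one finite-gap solution with the same branch points: for every $t\in\mathbb R$, $$\kappa=\frac{\frac1T\int_0^T\rho(x,t)^2\,dx}{\big(\frac1T\int_0^T\rho(x,t)\,dx\big)^2},\qquad \rho(x,t)=|\psi(x,t)|^2=\tfrac14(a_1-a_2-a_3+a_4)^2+(a_2-a_1)(a_4-a_3)\,\mathrm{sn}^2(\Lambda(x,t),m),$$ where $\Lambda(x,t)=\sqrt{(a_4-a_2)(a_3-a_1)}\,\big(x-t\sum_{j=1}^4a_j\big)$, $m=\frac{(a_4-a_3)(a_2-a_1)}{(a_4-a_2)(a_3-a_1)}$, $T=2K(m)/\sqrt{(a_4-a_2)(a_3-a_1)}$, and $\mathrm{sn}$ and the complete elliptic integral $K$ are taken with parameter $m=k^2$; (ii) $1\le\kappa\le\frac32$. -/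

import Mathlib

open MeasureTheory
open scoped ENNReal

noncomputable section

namespace DefNLS

/-! ### Soliton gases of the defocusing NLS equation and their condensates -/

/-- The kernel `log |(R₀(z) R₀(w) + w z - 1) / (z - w)|` of the nonlinear dispersion relations, for
`z, w ∈ [-1, 1]`. Here `R₀(z) = √(z² - 1)` is taken on one shore of its branch cut `[-1, 1]`, so that
`R₀(z) R₀(w) = -√(1 - z²) √(1 - w²)` and `|R₀(z)| = √(1 - z²)`. -/
def ndrKernel (z w : ℝ) : ℝ :=
  Real.log |(-(√(1 - z ^ 2) * √(1 - w ^ 2)) + w * z - 1) / (z - w)|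

/-- A soliton gas of the defocusing NLS equation on the background with spectral band `[-1, 1]`:
the density of states `u` and the density of fluxes `v` on the spectral support `Γ ⊆ [-1, 1]`
solve the two nonlinear dispersion relations with spectral scaling function `σ`. -/
structure IsSolitonGas (Γ : Set ℝ) (σ u v : ℝ → ℝ) : Prop where
  memLp_u : ∃ p : ℝ≥0∞, 1 < p ∧ MemLp u p (volume.restrict Γ)
  memLp_v : ∃ p : ℝ≥0∞, 1 < p ∧ MemLp v p (volume.restrict Γ)
  first_ndr : ∀ z ∈ Γ, (∫ w in Γ, ndrKernel z w * u w) + σ z * u z = √(1 - z ^ 2)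
  second_ndr : ∀ z ∈ Γ, (∫ w in Γ, ndrKernel z w * v w) + σ z * v z = 2 * z * √(1 - z ^ 2)

/-- A soliton condensate is a soliton gas whose spectral scaling function vanishes identically. -/
def IsCondensate (Γ : Set ℝ) (u v : ℝ → ℝ) : Prop :=
  IsSolitonGas Γ (fun _ => 0) u v

/-- The spectral support of a genus one condensate: `[-1, 1]` without the two bands `(a₁, a₂)` and
`(a₃, a₄)`. -/
def genusOneSupport (a₁ a₂ a₃ a₄ : ℝ) : Set ℝ :=
  Set.Icc (-1) a₁ ∪ Set.Icc a₂ a₃ ∪ Set.Icc a₄ 1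

/-! ### Averaged densities and fluxes

`I₁`, `I₃` and `J₂` are the coefficients of `-z⁻²`, `-z⁻⁴` and `-z⁻³` in the expansions at infinity
of the limiting quasimomentum and quasienergy differentials of the gas. They are the ensemble
averages `I₁ = -⟨|ψ|²⟩ / 2`, `I₃ = -3 ⟨|ψ|⁴ + |ψₓ|²⟩ / 8` and `J₂ = -⟨|ψ|⁴ + 2 |ψₓ|²⟩ / 2`. -/

def coeffI₁ (Γ : Set ℝ) (u : ℝ → ℝ) : ℝ :=
  -(1 / 2) + ∫ ζ in Γ, u ζ * √(1 - ζ ^ 2)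

def coeffI₃ (Γ : Set ℝ) (u : ℝ → ℝ) : ℝ :=
  -(3 / 8) + ∫ ζ in Γ, (ζ ^ 2 + 1 / 2) * u ζ * √(1 - ζ ^ 2)

def coeffJ₂ (Γ : Set ℝ) (v : ℝ → ℝ) : ℝ :=
  -(1 / 2) + ∫ ζ in Γ, ζ * v ζ * √(1 - ζ ^ 2)

/-- The ensemble average `⟨|ψ|²⟩`. -/
def meanSq (Γ : Set ℝ) (u : ℝ → ℝ) : ℝ := -2 * coeffI₁ Γ u

/-- The ensemble average `⟨|ψ|⁴⟩ = 2 ⟨|ψ|⁴ + |ψₓ|²⟩ - ⟨|ψ|⁴ + 2 |ψₓ|²⟩`. -/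
def meanFourth (Γ : Set ℝ) (u v : ℝ → ℝ) : ℝ :=
  2 * (-(8 / 3) * coeffI₃ Γ u) - (-2 * coeffJ₂ Γ v)

/-- The kurtosis `κ = ⟨|ψ|⁴⟩ / ⟨|ψ|²⟩²` of the gas. -/
def kurtosis (Γ : Set ℝ) (u v : ℝ → ℝ) : ℝ :=
  meanFourth Γ u v / meanSq Γ u ^ 2

/-! ### The genus one finite gap solution -/

/-- The incomplete elliptic integral of the first kind, with parameter `m`. -/
def ellipticF (m φ : ℝ) : ℝ :=
  ∫ θ in (0 : ℝ)..φ, 1 / √(1 - m * Real.sin θ ^ 2)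

/-- The complete elliptic integral of the first kind, with parameter `m`. -/
def ellipticK (m : ℝ) : ℝ := ellipticF m (Real.pi / 2)

/-- The Jacobi amplitude, inverse to `ellipticF m`, which is a bijection of `ℝ` for `m < 1`. -/
def jacobiAm (m y : ℝ) : ℝ := Function.invFun (ellipticF m) y

/-- The Jacobi elliptic function `sn(y, m)`, with parameter `m`. -/
def jacobiSn (m y : ℝ) : ℝ := Real.sin (jacobiAm m y)

/-- The elliptic parameter of the genus one Riemann surface with branch points `a₁, …, a₄`. -/
def ellipticParam (a₁ a₂ a₃ a₄ : ℝ) : ℝ :=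
  ((a₃ - a₄) * (-a₂ + a₁)) / ((a₂ - a₄) * (-a₃ + a₁))

/-- The squared modulus `|ψ(x, t)|²` of the genus one finite gap solution of the defocusing NLS
equation with branch points `a₁, …, a₄`. -/
def finiteGapSqModulus (a₁ a₂ a₃ a₄ x t : ℝ) : ℝ :=
  (1 / 4) * (a₁ - a₂ - a₃ + a₄) ^ 2 +
    (a₂ - a₁) * (a₄ - a₃) *
      jacobiSn (ellipticParam a₁ a₂ a₃ a₄)
        (√((a₄ - a₂) * (a₃ - a₁)) * (x - t * (a₁ + a₂ + a₃ + a₄))) ^ 2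

/-- The spatial period of `|ψ|`. -/
def finiteGapPeriod (a₁ a₂ a₃ a₄ : ℝ) : ℝ :=
  2 * ellipticK (ellipticParam a₁ a₂ a₃ a₄) / √((a₄ - a₂) * (a₃ - a₁))

/-- The kurtosis of the genus one finite gap solution at time `t`, with averages over one spatial
period. -/
def finiteGapKurtosis (a₁ a₂ a₃ a₄ t : ℝ) : ℝ :=
  ((1 / finiteGapPeriod a₁ a₂ a₃ a₄) *
      ∫ x in (0 : ℝ)..finiteGapPeriod a₁ a₂ a₃ a₄, finiteGapSqModulus a₁ a₂ a₃ a₄ x t ^ 2) /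
    ((1 / finiteGapPeriod a₁ a₂ a₃ a₄) *
      ∫ x in (0 : ℝ)..finiteGapPeriod a₁ a₂ a₃ a₄, finiteGapSqModulus a₁ a₂ a₃ a₄ x t) ^ 2

end DefNLS

end

namespace DefNLS

/-! ### Taylor expansions of order six in the unit disc -/

/-! The Joukowski map w = (ζ + ζ⁻¹)/2 carries the unit disc to the complement of [-1, 1], with w =
cos β at ζ = exp(iβ). For z = cos α the kernel of the dispersion relations is the boundary value of
Re `logKernel α`, while the imaginary part takes one constant value on each side of β = α. For a
real quartic P, the differential P dw / √∏(w - aⱼ) becomes the analytic function `spectralFun` on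
the disc. Apart from the factor i sin β exp(3iβ), its boundary value is real on Γ and imaginary on
the two bands. The imaginary part of the mean value property for `spectralFun` times `logKernel`
therefore equates a Taylor coefficient with ∫_Γ kernel · density plus, for each band, a constant
times the band integral of P / √|∏(w - aⱼ)|. If both band integrals vanish (`BandNull`), the density
is mapped by the kernel to a polynomial of degree at most two times √(1 - z²): see
`integral_mul_spectralDensity` and `integral_ndrKernel_mul_spectralDensity`.

Write R = ∏(w - aⱼ), with elementary symmetric functions eⱼ. One polynomial with null bands is w² -
e₁w/2 + c, where c is expressed through elliptic integrals (`bandNull_quadratic`). The others are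
exact, coming from the derivative of (α + βw)√(-R) (`bandNull_of_deriv`). Combinations of these give
explicit densities with right-hand sides √(1 - z²), 2z√(1 - z²) and (z² + 1/2)√(1 - z²); the first
two prove existence.

Uniqueness of u and v is not needed. The kernel is symmetric, so pairing any solution with an
explicit density and applying Fubini (`setIntegral_mul_comm_of_ndr`) turns each integral occurring
in the averages into an integral of an explicit density against sin β or sin 2β. These are again
Taylor coefficients of `spectralFun`.

Let x and y be the averages of sn² and sn⁴ over a period, ρ = (a₁ - a₂ - a₃ + a₄)²/4 and δ = (a₂ -
a₁)(a₄ - a₃). Both the condensate and the finite-gap solution have second moment ρ + δx and fourth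
moment ρ² + 2ρδx + δ²y. On the condensate side only x appears, through c, and the recurrence between
elliptic moments supplies y. The lower bound on the kurtosis is x² ≤ y. The upper bound reduces to y
≤ 3x²/2 (`ellipticMoment_two_le`), an inequality that becomes an equality as m → 0. -/

/-- `f = ∑_{k < 6} c k ζ ^ k + O(ζ ^ 6)` on the unit disc, with an analytic remainder. -/
def HasTaylorSix (f : ℂ → ℂ) (c : ℕ → ℂ) : Prop :=
  ∃ g : ℂ → ℂ, DifferentiableOn ℂ g (Metric.ball 0 1) ∧
    ∀ ζ ∈ Metric.ball (0 : ℂ) 1, f ζ = ∑ k ∈ Finset.range 6, c k * ζ ^ k + ζ ^ 6 * g ζ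

theorem exists_differentiableOn_of_order (f : ℂ → ℂ) (hf : DifferentiableOn ℂ f (Metric.ball 0 1))
    (n : ℕ) : ∃ c : ℕ → ℂ, ∃ g : ℂ → ℂ, DifferentiableOn ℂ g (Metric.ball 0 1) ∧
      ∀ ζ : ℂ, f ζ = ∑ k ∈ Finset.range n, c k * ζ ^ k + ζ ^ n * g ζ := by
  induction n with
  | zero => exact ⟨fun _ => 0, f, hf, fun ζ => by simp⟩
  | succ n ih =>
    obtain ⟨c, g, hg, h⟩ := ih
    refine ⟨fun k => if k = n then g 0 else c k, dslope g 0,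
      (Complex.differentiableOn_dslope (Metric.ball_mem_nhds 0 one_pos)).2 hg, fun ζ => ?_⟩
    have h1 : ζ * dslope g 0 ζ = g ζ - g 0 := by
      simpa using sub_smul_dslope g 0 ζ
    rw [Finset.sum_range_succ, h ζ]
    have h2 : ∑ x ∈ Finset.range n, (if x = n then g 0 else c x) * ζ ^ x =
        ∑ x ∈ Finset.range n, c x * ζ ^ x := by
      refine Finset.sum_congr rfl fun x hx => ?_
      rw [if_neg (Finset.mem_range.1 hx).ne]
    rw [h2, pow_succ, mul_assoc (ζ ^ n), h1]
    simp
    ring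

theorem exists_hasTaylorSix {f : ℂ → ℂ} (hf : DifferentiableOn ℂ f (Metric.ball 0 1)) :
    ∃ c, HasTaylorSix f c := by
  obtain ⟨c, g, hg, h⟩ := exists_differentiableOn_of_order f hf 6
  exact ⟨c, g, hg, fun ζ _ => h ζ⟩

theorem HasTaylorSix.mul {f₁ f₂ : ℂ → ℂ} {c d : ℕ → ℂ} (h₁ : HasTaylorSix f₁ c)
    (h₂ : HasTaylorSix f₂ d) : HasTaylorSix (fun ζ => f₁ ζ * f₂ ζ)
      (fun k => ∑ i ∈ Finset.range (k + 1), c i * d (k - i)) := by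
  obtain ⟨g₁, hg₁, h₁⟩ := h₁
  obtain ⟨g₂, hg₂, h₂⟩ := h₂
  refine ⟨fun ζ => (∑ k ∈ Finset.range 6, c k * ζ ^ k) * g₂ ζ +
    (∑ k ∈ Finset.range 6, d k * ζ ^ k) * g₁ ζ + ζ ^ 6 * (g₁ ζ * g₂ ζ) +
    ((c 1 * d 5 + c 2 * d 4 + c 3 * d 3 + c 4 * d 2 + c 5 * d 1) +
    (c 2 * d 5 + c 3 * d 4 + c 4 * d 3 + c 5 * d 2) * ζ +
    (c 3 * d 5 + c 4 * d 4 + c 5 * d 3) * ζ ^ 2 +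
    (c 4 * d 5 + c 5 * d 4) * ζ ^ 3 + c 5 * d 5 * ζ ^ 4), ?_, fun ζ hζ => ?_⟩
  · fun_prop
  · simp only [h₁ ζ hζ, h₂ ζ hζ, Finset.sum_range_succ, Finset.sum_range_zero]
    simp
    ring

theorem circleAverage_zpow {r : ℝ} (hr : 0 < r) (n : ℤ) :
    Real.circleAverage (fun z : ℂ => z ^ n) 0 r = if n = 0 then 1 else 0 := by
  rw [Real.circleAverage_eq_circleIntegral hr.ne']
  have h : ∮ z in C((0 : ℂ), r), (z - 0)⁻¹ • z ^ n = ∮ z in C((0 : ℂ), r), (z - 0) ^ (n - 1) := by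
    refine circleIntegral.integral_congr hr.le fun z hz => ?_
    have hz0 : z ≠ 0 := by
      rintro rfl
      simp at hz
      exact hr.ne hz
    simp only [sub_zero, smul_eq_mul]
    rw [zpow_sub_one₀ hz0, mul_comm]
  rw [h]
  split_ifs with hn
  · subst hn
    have := circleIntegral.integral_sub_center_inv (0 : ℂ) hr.ne'
    simp only [zero_sub, zpow_neg_one]
    rw [this, smul_eq_mul]
    exact inv_mul_cancel₀ (by simp [Real.pi_ne_zero])
  · rw [circleIntegral.integral_sub_zpow_of_ne (by omega)]
    simp

/-- Only the monomial of degree zero in f/z^k has a nonzero mean; the remainder still carries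
z^(6-k) with 6 - k > 0, so its mean vanishes too. Order six suffices because only coefficients up to
ζ⁵ are used later. -/
theorem HasTaylorSix.circleAverage {f : ℂ → ℂ} {c : ℕ → ℂ} (h : HasTaylorSix f c) {r : ℝ}
    (hr : 0 < r) (hr1 : r < 1) {k : ℕ} (hk : k < 6) :
    Real.circleAverage (fun z => f z / z ^ k) 0 r = c k := by
  obtain ⟨g, hg, h⟩ := h
  have hsub : Metric.closedBall (0 : ℂ) |r| ⊆ Metric.ball 0 1 :=
    Metric.closedBall_subset_ball (by rwa [abs_of_pos hr])
  have hsph : ∀ z ∈ Metric.sphere (0 : ℂ) |r|, z ≠ 0 := by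
    rintro z hz rfl
    simp [eq_comm, hr.ne'] at hz
  have hG : DifferentiableOn ℂ (fun z => z ^ (6 - k) * g z) (Metric.ball 0 1) := by fun_prop
  have h1 : Real.circleAverage (fun z => f z / z ^ k) 0 r =
      Real.circleAverage (fun z => (∑ j ∈ Finset.range 6, c j • z ^ ((j : ℤ) - k)) +
        z ^ (6 - k) * g z) 0 r := by
    refine Real.circleAverage_congr_sphere fun z hz => ?_
    have hz0 := hsph z hz
    rw [h z (hsub (Metric.sphere_subset_closedBall hz)), add_div, Finset.sum_div]
    congr 1
    · refine Finset.sum_congr rfl fun j _ => ?_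
      rw [zpow_sub₀ hz0]
      simp [mul_div_assoc]
    · rw [pow_sub₀ _ hz0 (by omega)]
      field_simp
  have hint : ∀ j ∈ Finset.range 6,
      CircleIntegrable (fun z : ℂ => c j • z ^ ((j : ℤ) - k)) 0 r := fun j _ => by
    refine ContinuousOn.circleIntegrable' fun z hz => ContinuousAt.continuousWithinAt ?_
    exact (continuousAt_zpow₀ z ((j : ℤ) - k) (Or.inl (hsph z hz))).const_smul (c j)
  rw [h1, Real.circleAverage_fun_add (CircleIntegrable.fun_sum _ hint)
    ((hG.continuousOn.mono (Metric.sphere_subset_closedBall.trans hsub)).circleIntegrable'),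
    Real.circleAverage_fun_sum hint, DiffContOnCl.circleAverage (hG.diffContOnCl_ball hsub)]
  have h2 : ∀ j ∈ Finset.range 6, Real.circleAverage (fun z : ℂ => c j • z ^ ((j : ℤ) - k)) 0 r =
      if j = k then c j else 0 := fun j _ => by
    rw [Real.circleAverage_fun_smul, circleAverage_zpow hr]
    simp [sub_eq_zero]
  rw [Finset.sum_congr rfl h2]
  simp [hk, Nat.sub_eq_zero_iff_le, not_le.2 hk]

theorem HasTaylorSix.unique {f : ℂ → ℂ} {c d : ℕ → ℂ} (h : HasTaylorSix f c)
    (h' : HasTaylorSix f d) {k : ℕ} (hk : k < 6) : c k = d k := by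
  rw [← h.circleAverage (r := 1 / 2) (by norm_num) (by norm_num) hk,
    h'.circleAverage (by norm_num) (by norm_num) hk]

/-- A function that is O(ζ^(n+1)) vanishes at the origin by continuity, so `dslope` divides out one
factor ζ and stays analytic on the whole disc. -/
theorem exists_differentiableOn_of_isBigO {f : ℂ → ℂ} (hf : DifferentiableOn ℂ f (Metric.ball 0 1))
    {n : ℕ} (h : f =O[nhdsWithin 0 {0}ᶜ] fun ζ => ζ ^ n) :
    ∃ g : ℂ → ℂ, DifferentiableOn ℂ g (Metric.ball 0 1) ∧ ∀ ζ, f ζ = ζ ^ n * g ζ := by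
  induction n generalizing f with
  | zero => exact ⟨f, hf, fun ζ => by simp⟩
  | succ n ih =>
    have hc : ContinuousAt f 0 := (hf.differentiableAt (Metric.ball_mem_nhds 0 one_pos)).continuousAt
    have hf0 : f 0 = 0 := by
      refine tendsto_nhds_unique (hc.tendsto.mono_left nhdsWithin_le_nhds)
        (h.trans_tendsto (g'' := fun ζ : ℂ => ζ ^ (n + 1)) ?_)
      have : Filter.Tendsto (fun ζ : ℂ => ζ ^ (n + 1)) (nhds 0) (nhds (0 ^ (n + 1))) :=
        (continuous_pow (n + 1)).tendsto 0
      simpa using this.mono_left nhdsWithin_le_nhds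
    have hd : ∀ ζ, ζ * dslope f 0 ζ = f ζ := fun ζ => by
      simpa [hf0] using sub_smul_dslope f 0 ζ
    obtain ⟨g, hg, hfg⟩ := ih ((Complex.differentiableOn_dslope
      (Metric.ball_mem_nhds 0 one_pos)).2 hf) (by
        have h1 := (Asymptotics.isBigO_refl (fun ζ : ℂ => ζ⁻¹) (nhdsWithin 0 {0}ᶜ)).mul h
        refine h1.congr' ?_ ?_
        all_goals
          filter_upwards [self_mem_nhdsWithin] with ζ hζ
          have hζ : ζ ≠ 0 := hζ
        · rw [← hd ζ, inv_mul_cancel_left₀ hζ]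
        · rw [pow_succ]
          field_simp)
    exact ⟨g, hg, fun ζ => by rw [← hd ζ, hfg ζ]; ring⟩

theorem HasTaylorSix.of_isBigO {f : ℂ → ℂ} {c : ℕ → ℂ}
    (hf : DifferentiableOn ℂ f (Metric.ball 0 1))
    (h : (fun ζ => f ζ - ∑ k ∈ Finset.range 6, c k * ζ ^ k) =O[nhdsWithin 0 {0}ᶜ]
      fun ζ => ζ ^ 6) :
    HasTaylorSix f c := by
  obtain ⟨g, hg, hfg⟩ := exists_differentiableOn_of_isBigO
    (hf.sub (f := f) (g := fun ζ => ∑ k ∈ Finset.range 6, c k * ζ ^ k) (by fun_prop)) h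
  exact ⟨g, hg, fun ζ _ => by rw [← hfg ζ]; simp⟩

end DefNLS

namespace DefNLS

/-! ### The building blocks of the spectral functions in the unit disc -/

/-- The branch of `(1 - 2 ζ cos θ + ζ²) ^ (-1/2)` on the unit disc with value `1` at the origin. -/
noncomputable def invSqrtFactor (θ : ℝ) (ζ : ℂ) : ℂ :=
  Complex.exp (-(Complex.log (1 - ζ * Complex.exp (θ * Complex.I)) +
    Complex.log (1 - ζ * Complex.exp (-(θ * Complex.I)))) / 2)

/-- The analytic function on the unit disc whose real part has the kernel of the nonlinear
dispersion relations as its boundary values. -/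
noncomputable def logKernel (α : ℝ) (ζ : ℂ) : ℂ :=
  Complex.log (1 - ζ * Complex.exp (α * Complex.I)) -
    Complex.log (1 - ζ * Complex.exp (-(α * Complex.I)))

theorem norm_exp_neg_ofReal_mul_I (x : ℝ) : ‖Complex.exp (-(x * Complex.I))‖ = 1 := by
  rw [show -((x : ℂ) * Complex.I) = ((-x : ℝ) : ℂ) * Complex.I by push_cast; ring,
    Complex.norm_exp_ofReal_mul_I]

theorem one_sub_mul_mem_slitPlane {ζ w : ℂ} (hζ : ‖ζ‖ < 1) (hw : ‖w‖ = 1) :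
    1 - ζ * w ∈ Complex.slitPlane := by
  rw [sub_eq_add_neg]
  exact Complex.mem_slitPlane_of_norm_lt_one (by simpa [hw] using hζ)

/-- The real part is 2 sin²(x/2) > 0. This is what extends the branches continuously to the unit
circle away from their singular points. -/
theorem one_sub_exp_mem_slitPlane {x : ℝ} (hx : Real.sin (x / 2) ≠ 0) :
    1 - Complex.exp (x * Complex.I) ∈ Complex.slitPlane := by
  refine Or.inl ?_
  have h : 0 < Real.sin (x / 2) ^ 2 := by positivity
  have h2 := Real.cos_sq_add_sin_sq (x / 2)
  have h3 := Real.cos_two_mul (x / 2)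
  rw [mul_div_cancel₀ _ two_ne_zero] at h3
  rw [Complex.sub_re, Complex.exp_ofReal_mul_I_re, Complex.one_re]
  nlinarith

theorem exp_mul_exp_neg (x y : ℝ) : Complex.exp (x * Complex.I) * Complex.exp (-(y * Complex.I)) =
    Complex.exp (((x - y : ℝ) : ℂ) * Complex.I) := by
  rw [← Complex.exp_add]; push_cast; ring_nf

theorem exp_mul_exp (x y : ℝ) : Complex.exp (x * Complex.I) * Complex.exp (y * Complex.I) =
    Complex.exp (((x + y : ℝ) : ℂ) * Complex.I) := by
  rw [← Complex.exp_add]; push_cast; ring_nf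

theorem differentiableOn_invSqrtFactor (θ : ℝ) :
    DifferentiableOn ℂ (invSqrtFactor θ) (Metric.ball 0 1) := by
  intro ζ hζ
  have hζ : ‖ζ‖ < 1 := by simpa using hζ
  have h1 := one_sub_mul_mem_slitPlane hζ (Complex.norm_exp_ofReal_mul_I θ)
  have h2 := one_sub_mul_mem_slitPlane hζ (norm_exp_neg_ofReal_mul_I θ)
  refine DifferentiableAt.differentiableWithinAt ?_
  unfold invSqrtFactor
  fun_prop (disch := assumption)

theorem differentiableOn_logKernel (α : ℝ) :
    DifferentiableOn ℂ (logKernel α) (Metric.ball 0 1) := by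
  intro ζ hζ
  have hζ : ‖ζ‖ < 1 := by simpa using hζ
  have h1 := one_sub_mul_mem_slitPlane hζ (Complex.norm_exp_ofReal_mul_I α)
  have h2 := one_sub_mul_mem_slitPlane hζ (norm_exp_neg_ofReal_mul_I α)
  refine DifferentiableAt.differentiableWithinAt ?_
  unfold logKernel
  fun_prop (disch := assumption)

theorem continuousAt_invSqrtFactor {θ β : ℝ} (h1 : Real.sin ((β + θ) / 2) ≠ 0)
    (h2 : Real.sin ((β - θ) / 2) ≠ 0) :
    ContinuousAt (invSqrtFactor θ) (Complex.exp (β * Complex.I)) := by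
  have h1 := one_sub_exp_mem_slitPlane h1
  have h2 := one_sub_exp_mem_slitPlane h2
  rw [← exp_mul_exp] at h1
  rw [← exp_mul_exp_neg] at h2
  unfold invSqrtFactor
  fun_prop (disch := assumption)

theorem continuousAt_logKernel {α β : ℝ} (h1 : Real.sin ((β + α) / 2) ≠ 0)
    (h2 : Real.sin ((β - α) / 2) ≠ 0) :
    ContinuousAt (logKernel α) (Complex.exp (β * Complex.I)) := by
  have h1 := one_sub_exp_mem_slitPlane h1
  have h2 := one_sub_exp_mem_slitPlane h2
  rw [← exp_mul_exp] at h1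
  rw [← exp_mul_exp_neg] at h2
  unfold logKernel
  fun_prop (disch := assumption)

theorem conj_exp_ofReal_mul_I (x : ℝ) :
    (starRingEnd ℂ) (Complex.exp (x * Complex.I)) = Complex.exp (-(x * Complex.I)) := by
  rw [← Complex.exp_conj]; simp

theorem conj_exp_neg_ofReal_mul_I (x : ℝ) :
    (starRingEnd ℂ) (Complex.exp (-(x * Complex.I))) = Complex.exp (x * Complex.I) := by
  rw [← Complex.exp_conj]; simp

theorem invSqrtFactor_conj (θ : ℝ) {ζ : ℂ} (hζ : ‖ζ‖ < 1) :
    invSqrtFactor θ ((starRingEnd ℂ) ζ) = (starRingEnd ℂ) (invSqrtFactor θ ζ) := by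
  have h1 := one_sub_mul_mem_slitPlane hζ (Complex.norm_exp_ofReal_mul_I θ)
  have h2 := one_sub_mul_mem_slitPlane hζ (norm_exp_neg_ofReal_mul_I θ)
  unfold invSqrtFactor
  rw [← Complex.exp_conj]
  simp only [map_div₀, map_neg, map_add, ← Complex.log_conj _ (Complex.slitPlane_arg_ne_pi h1),
    ← Complex.log_conj _ (Complex.slitPlane_arg_ne_pi h2)]
  simp only [map_sub, map_mul, map_one, conj_exp_ofReal_mul_I, conj_exp_neg_ofReal_mul_I,
    Complex.conj_ofNat]
  rw [add_comm]

/-- Conjugation exchanges the two logarithms, hence the minus sign. Since `invSqrtFactor` commutes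
with conjugation, the products considered later have imaginary parts that are even in β, and a full
circle reduces to β ∈ [0, π]. -/
theorem logKernel_conj (α : ℝ) {ζ : ℂ} (hζ : ‖ζ‖ < 1) :
    logKernel α ((starRingEnd ℂ) ζ) = -(starRingEnd ℂ) (logKernel α ζ) := by
  have h1 := one_sub_mul_mem_slitPlane hζ (Complex.norm_exp_ofReal_mul_I α)
  have h2 := one_sub_mul_mem_slitPlane hζ (norm_exp_neg_ofReal_mul_I α)
  unfold logKernel
  simp only [map_sub, ← Complex.log_conj _ (Complex.slitPlane_arg_ne_pi h1),
    ← Complex.log_conj _ (Complex.slitPlane_arg_ne_pi h2)]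
  simp only [map_mul, map_one, conj_exp_ofReal_mul_I, conj_exp_neg_ofReal_mul_I]
  ring

theorem one_sub_mul_exp_mul_one_sub_mul_exp_neg (θ : ℝ) (ζ : ℂ) :
    (1 - ζ * Complex.exp (θ * Complex.I)) * (1 - ζ * Complex.exp (-(θ * Complex.I))) =
      1 - 2 * Real.cos θ * ζ + ζ ^ 2 := by
  have h : Complex.exp (θ * Complex.I) * Complex.exp (-(θ * Complex.I)) = 1 := by
    rw [← Complex.exp_add]; simp
  have h2 : (2 : ℂ) * Real.cos θ = Complex.exp (θ * Complex.I) + Complex.exp (-(θ * Complex.I)) := by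
    rw [Complex.ofReal_cos, Complex.cos]; ring_nf
  rw [h2]
  linear_combination ζ ^ 2 * h

theorem invSqrtFactor_sq (θ : ℝ) {ζ : ℂ} (hζ : ‖ζ‖ < 1) :
    invSqrtFactor θ ζ ^ 2 * (1 - 2 * Real.cos θ * ζ + ζ ^ 2) = 1 := by
  have h1 := Complex.slitPlane_ne_zero
    (one_sub_mul_mem_slitPlane hζ (Complex.norm_exp_ofReal_mul_I θ))
  have h2 := Complex.slitPlane_ne_zero (one_sub_mul_mem_slitPlane hζ (norm_exp_neg_ofReal_mul_I θ))
  rw [← one_sub_mul_exp_mul_one_sub_mul_exp_neg, invSqrtFactor, ← Complex.exp_nat_mul]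
  rw [show ((2 : ℕ) : ℂ) * (-(Complex.log (1 - ζ * Complex.exp (θ * Complex.I)) +
    Complex.log (1 - ζ * Complex.exp (-(θ * Complex.I)))) / 2) =
    -(Complex.log (1 - ζ * Complex.exp (θ * Complex.I))) -
    Complex.log (1 - ζ * Complex.exp (-(θ * Complex.I))) by push_cast; ring]
  rw [Complex.exp_sub, Complex.exp_neg, Complex.exp_log h1, Complex.exp_log h2]
  field_simp

theorem invSqrtFactor_zero (θ : ℝ) : invSqrtFactor θ 0 = 1 := by simp [invSqrtFactor]

/-! #### Bounds -/

theorem norm_one_sub_mul_exp_sq (r x : ℝ) :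
    ‖1 - (r : ℂ) * Complex.exp (x * Complex.I)‖ ^ 2 = (1 - r) ^ 2 + 4 * r * Real.sin (x / 2) ^ 2 := by
  have h2 := Real.cos_sq_add_sin_sq (x / 2)
  have h3 := Real.cos_two_mul (x / 2)
  have h4 := Real.cos_sq_add_sin_sq x
  rw [mul_div_cancel₀ _ two_ne_zero] at h3
  rw [← Complex.normSq_eq_norm_sq, Complex.normSq_apply]
  simp [Complex.exp_ofReal_mul_I_re, Complex.exp_ofReal_mul_I_im]
  linear_combination r ^ 2 * h4 - 2 * r * h3 - 4 * r * h2

/-- The bound does not depend on r, so it gives integrable majorants for the limit r → 1. For r ≥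
1/4 the term 4r sin²(x/2) suffices; for smaller r the term (1 - r)² compensates. -/
theorem abs_sin_half_le_norm {r : ℝ} (h0 : 0 ≤ r) (x : ℝ) :
    |Real.sin (x / 2)| ≤ ‖1 - (r : ℂ) * Complex.exp (x * Complex.I)‖ := by
  refine abs_le_of_sq_le_sq' ?_ (norm_nonneg _) |> fun h => abs_le.2 h
  rw [norm_one_sub_mul_exp_sq]
  have h2 := Real.sin_sq_le_one (x / 2)
  have h3 := sq_nonneg (Real.sin (x / 2))
  by_cases hr : r ≤ 1 / 4
  · nlinarith
  · nlinarith

theorem norm_invSqrtFactor {θ : ℝ} {ζ : ℂ} (h1 : 1 - ζ * Complex.exp (θ * Complex.I) ≠ 0)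
    (h2 : 1 - ζ * Complex.exp (-(θ * Complex.I)) ≠ 0) : ‖invSqrtFactor θ ζ‖ =
      (√(‖1 - ζ * Complex.exp (θ * Complex.I)‖ * ‖1 - ζ * Complex.exp (-(θ * Complex.I))‖))⁻¹ := by
  rw [invSqrtFactor, Complex.norm_exp]
  have h1 := norm_pos_iff.2 h1
  have h2 := norm_pos_iff.2 h2
  have h : (-(Complex.log (1 - ζ * Complex.exp (θ * Complex.I)) +
    Complex.log (1 - ζ * Complex.exp (-(θ * Complex.I)))) / 2).re =
    -(Real.log √(‖1 - ζ * Complex.exp (θ * Complex.I)‖ *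
      ‖1 - ζ * Complex.exp (-(θ * Complex.I))‖)) := by
    rw [Real.log_sqrt (by positivity), Real.log_mul h1.ne' h2.ne', Complex.div_ofNat_re,
      Complex.neg_re, Complex.add_re, Complex.log_re, Complex.log_re]
    ring
  rw [h, Real.exp_neg, Real.exp_log (by positivity)]

theorem abs_sub_div_pi_le_abs_sin {β θ : ℝ} (h : |β - θ| ≤ Real.pi) :
    |β - θ| / Real.pi ≤ |Real.sin ((β - θ) / 2)| := by
  refine le_trans (le_of_eq ?_) (Real.mul_abs_le_abs_sin (x := (β - θ) / 2) ?_)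
  · rw [abs_div, abs_two]
    field_simp
  · rw [abs_div, abs_two]
    linarith

end DefNLS

/-! ### Majorants up to the unit circle, uniform in the radius -/

namespace DefNLS

/-- By the addition formula the sine is a combination of sin(β/2) and cos(β/2) with the positive
weights cos(θ/2) and sin(θ/2), and sin(β/2) + cos(β/2) ≥ 1. For interior θ the conjugate factor of
`invSqrtFactor` therefore never degenerates. -/
theorem exists_le_sin_half_add {θ : ℝ} (h0 : 0 < θ) (h1 : θ < Real.pi) :
    ∃ c > 0, ∀ β ∈ Set.Icc 0 Real.pi, c ≤ Real.sin ((β + θ) / 2) := by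
  have hs : 0 < Real.sin (θ / 2) := Real.sin_pos_of_pos_of_lt_pi (by linarith) (by linarith)
  have hc : 0 < Real.cos (θ / 2) := Real.cos_pos_of_mem_Ioo ⟨by linarith, by linarith⟩
  refine ⟨min (Real.sin (θ / 2)) (Real.cos (θ / 2)), lt_min hs hc, fun β hβ => ?_⟩
  have hs' : 0 ≤ Real.sin (β / 2) :=
    Real.sin_nonneg_of_nonneg_of_le_pi (by linarith [hβ.1]) (by linarith [hβ.2, Real.pi_pos])
  have hc' : 0 ≤ Real.cos (β / 2) :=
    Real.cos_nonneg_of_mem_Icc ⟨by linarith [hβ.1, Real.pi_pos], by linarith [hβ.2]⟩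
  have h1 := Real.sin_sq_add_cos_sq (β / 2)
  have h2 : 1 ≤ Real.sin (β / 2) + Real.cos (β / 2) := by nlinarith
  rw [add_div, Real.sin_add]
  have h3 := min_le_left (Real.sin (θ / 2)) (Real.cos (θ / 2))
  have h4 := min_le_right (Real.sin (θ / 2)) (Real.cos (θ / 2))
  have h5 := lt_min hs hc
  nlinarith

theorem abs_sub_le_pi {β θ : ℝ} (hβ : β ∈ Set.Icc 0 Real.pi) (hθ : θ ∈ Set.Icc 0 Real.pi) :
    |β - θ| ≤ Real.pi :=
  abs_le.2 ⟨by linarith [hβ.1, hθ.2], by linarith [hβ.2, hθ.1]⟩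

theorem abs_sub_div_pi_le_norm {r β θ : ℝ} (hr : 0 ≤ r) (hβ : β ∈ Set.Icc 0 Real.pi)
    (hθ : θ ∈ Set.Icc 0 Real.pi) :
    |β - θ| / Real.pi ≤
      ‖1 - (r : ℂ) * Complex.exp (β * Complex.I) * Complex.exp (-(θ * Complex.I))‖ := by
  rw [mul_assoc, exp_mul_exp_neg]
  exact (abs_sub_div_pi_le_abs_sin (abs_sub_le_pi hβ hθ)).trans (abs_sin_half_le_norm hr _)

/-- The conjugate point is no closer: sin²((β+θ)/2) - sin²((β-θ)/2) = sin β sin θ ≥ 0 on [0, π]. -/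
theorem abs_sub_div_pi_le_norm' {r β θ : ℝ} (hr : 0 ≤ r) (hβ : β ∈ Set.Icc 0 Real.pi)
    (hθ : θ ∈ Set.Icc 0 Real.pi) :
    |β - θ| / Real.pi ≤
      ‖1 - (r : ℂ) * Complex.exp (β * Complex.I) * Complex.exp (θ * Complex.I)‖ := by
  rw [mul_assoc, exp_mul_exp]
  refine ((abs_sub_div_pi_le_abs_sin (abs_sub_le_pi hβ hθ)).trans ?_).trans
    (abs_sin_half_le_norm hr _)
  refine sq_le_sq.1 ?_
  have hs : ∀ x ∈ Set.Icc 0 Real.pi, 0 ≤ Real.sin (x / 2) ∧ 0 ≤ Real.cos (x / 2) := fun x hx =>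
    ⟨Real.sin_nonneg_of_nonneg_of_le_pi (by linarith [hx.1]) (by linarith [hx.2, Real.pi_pos]),
      Real.cos_nonneg_of_mem_Icc ⟨by linarith [hx.1, Real.pi_pos], by linarith [hx.2]⟩⟩
  rw [add_div, sub_div, Real.sin_add, Real.sin_sub]
  nlinarith [mul_nonneg (mul_nonneg (hs β hβ).1 (hs β hβ).2) (mul_nonneg (hs θ hθ).1 (hs θ hθ).2)]

theorem exists_norm_invSqrtFactor_le {θ : ℝ} (h0 : 0 < θ) (h1 : θ < Real.pi) :
    ∃ C : ℝ, 0 ≤ C ∧ ∀ r ∈ Set.Ico (0 : ℝ) 1, ∀ β ∈ Set.Icc 0 Real.pi, β ≠ θ →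
      ‖invSqrtFactor θ (r * Complex.exp (β * Complex.I))‖ ≤ C * |β - θ| ^ (-(1 / 2) : ℝ) := by
  obtain ⟨c, hc, hcs⟩ := exists_le_sin_half_add h0 h1
  refine ⟨(√(c / Real.pi))⁻¹, by positivity, fun r hr β hβ hne => ?_⟩
  have hπ := Real.pi_pos
  have hpos : 0 < |β - θ| := abs_pos.2 (sub_ne_zero.2 hne)
  have hB := abs_sub_div_pi_le_norm hr.1 hβ ⟨h0.le, h1.le⟩
  have hA : c ≤ ‖1 - (r : ℂ) * Complex.exp (β * Complex.I) * Complex.exp (θ * Complex.I)‖ := by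
    rw [mul_assoc, exp_mul_exp]
    exact ((hcs β hβ).trans (le_abs_self _)).trans (abs_sin_half_le_norm hr.1 _)
  have hB0 : 0 < |β - θ| / Real.pi := by positivity
  rw [norm_invSqrtFactor (norm_pos_iff.1 (hc.trans_le hA)) (norm_pos_iff.1 (hB0.trans_le hB)),
    Real.rpow_neg hpos.le, ← Real.sqrt_eq_rpow, ← mul_inv, ← Real.sqrt_mul (by positivity)]
  refine inv_anti₀ (by positivity) (Real.sqrt_le_sqrt ?_)
  calc c / Real.pi * |β - θ| = c * (|β - θ| / Real.pi) := by ring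
    _ ≤ _ := by gcongr

theorem norm_mul_exp_lt_one {r : ℝ} (hr : r ∈ Set.Ico (0 : ℝ) 1) (β : ℝ) :
    ‖(r : ℂ) * Complex.exp (β * Complex.I)‖ < 1 := by
  rw [norm_mul, Complex.norm_exp_ofReal_mul_I, mul_one, Complex.norm_real, Real.norm_of_nonneg hr.1]
  exact hr.2

/-- Covers the degenerate case a₁ = -1, that is θ = π. There both factors under the root coincide
and `invSqrtFactor` is exactly 1/(1 + ζ), which the zero of ζ² - 1 at ζ = -1 cancels. -/
theorem exists_norm_one_add_mul_invSqrtFactor_le {θ : ℝ} (h0 : 0 < θ) (h1 : θ ≤ Real.pi) :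
    ∃ C : ℝ, 0 ≤ C ∧ ∀ r ∈ Set.Ico (0 : ℝ) 1, ∀ β ∈ Set.Icc 0 Real.pi, β ≠ θ →
      ‖(1 + r * Complex.exp (β * Complex.I)) *
        invSqrtFactor θ (r * Complex.exp (β * Complex.I))‖ ≤
        C * (1 + |β - θ| ^ (-(1 / 2) : ℝ)) := by
  rcases h1.lt_or_eq with h1 | rfl
  · obtain ⟨C, hC, h⟩ := exists_norm_invSqrtFactor_le h0 h1
    refine ⟨2 * C, by positivity, fun r hr β hβ hne => ?_⟩
    rw [norm_mul]
    have h2 : ‖1 + (r : ℂ) * Complex.exp (β * Complex.I)‖ ≤ 2 := by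
      refine (norm_add_le _ _).trans ?_
      have := norm_mul_exp_lt_one hr β
      rw [norm_one]; linarith
    calc _ ≤ 2 * (C * |β - θ| ^ (-(1 / 2) : ℝ)) := by
          gcongr
          exact h r hr β hβ hne
      _ ≤ _ := by nlinarith
  · refine ⟨1, by norm_num, fun r hr β hβ hne => ?_⟩
    have hz := norm_mul_exp_lt_one hr β
    set ζ := (r : ℂ) * Complex.exp (β * Complex.I)
    have hs := one_sub_mul_mem_slitPlane hz (Complex.norm_exp_ofReal_mul_I Real.pi)
    have h2 : (1 + ζ) * invSqrtFactor Real.pi ζ = 1 := by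
      rw [Complex.exp_pi_mul_I, mul_neg_one, sub_neg_eq_add] at hs
      rw [invSqrtFactor, Complex.exp_neg, Complex.exp_pi_mul_I, mul_neg_one, sub_neg_eq_add,
        inv_neg, inv_one, mul_neg_one, sub_neg_eq_add, ← two_mul, neg_div,
        mul_div_cancel_left₀ _ two_ne_zero, Complex.exp_neg,
        Complex.exp_log (Complex.slitPlane_ne_zero hs)]
      exact mul_inv_cancel₀ (Complex.slitPlane_ne_zero hs)
    rw [h2, norm_one, one_mul]
    have : 0 ≤ |β - Real.pi| ^ (-(1 / 2) : ℝ) := by positivity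
    linarith

/-- The mirror case, where a₄ = 1 is allowed: the factor 1 - ζ of 1 - ζ² absorbs the pole at ζ = 1.
-/
theorem exists_norm_one_sub_mul_invSqrtFactor_le {θ : ℝ} (h0 : 0 ≤ θ) (h1 : θ < Real.pi) :
    ∃ C : ℝ, 0 ≤ C ∧ ∀ r ∈ Set.Ico (0 : ℝ) 1, ∀ β ∈ Set.Icc 0 Real.pi, β ≠ θ →
      ‖(1 - r * Complex.exp (β * Complex.I)) *
        invSqrtFactor θ (r * Complex.exp (β * Complex.I))‖ ≤
        C * (1 + |β - θ| ^ (-(1 / 2) : ℝ)) := by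
  rcases h0.lt_or_eq with h0 | rfl
  · obtain ⟨C, hC, h⟩ := exists_norm_invSqrtFactor_le h0 h1
    refine ⟨2 * C, by positivity, fun r hr β hβ hne => ?_⟩
    rw [norm_mul]
    have h2 : ‖1 - (r : ℂ) * Complex.exp (β * Complex.I)‖ ≤ 2 := by
      refine (norm_sub_le _ _).trans ?_
      have := norm_mul_exp_lt_one hr β
      rw [norm_one]; linarith
    calc _ ≤ 2 * (C * |β - θ| ^ (-(1 / 2) : ℝ)) := by
          gcongr
          exact h r hr β hβ hne
      _ ≤ _ := by nlinarith
  · refine ⟨1, by norm_num, fun r hr β hβ hne => ?_⟩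
    have hz := norm_mul_exp_lt_one hr β
    set ζ := (r : ℂ) * Complex.exp (β * Complex.I)
    have hs := one_sub_mul_mem_slitPlane hz (norm_one (α := ℂ))
    have h2 : (1 - ζ) * invSqrtFactor 0 ζ = 1 := by
      rw [mul_one] at hs
      rw [invSqrtFactor]
      simp only [Complex.ofReal_zero, zero_mul, neg_zero, Complex.exp_zero, mul_one]
      rw [← two_mul, neg_div, mul_div_cancel_left₀ _ two_ne_zero, Complex.exp_neg,
        Complex.exp_log (Complex.slitPlane_ne_zero hs)]
      exact mul_inv_cancel₀ (Complex.slitPlane_ne_zero hs)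
    rw [h2, norm_one, one_mul]
    have : 0 ≤ |β - 0| ^ (-(1 / 2) : ℝ) := by positivity
    linarith

/-- The exponent 1/8 is small enough that the logarithmic singularity may sit on top of an inverse
square root: 1/2 + 1/8 < 1. -/
theorem abs_log_le_of_le {x y : ℝ} (hy : 0 < y) (h : y ≤ x) (hx : x ≤ 2) :
    |Real.log x| ≤ 1 + 8 * y ^ (-(1 / 8) : ℝ) := by
  have h1 : Real.log (1 / y) ≤ (1 / y) ^ (1 / 8 : ℝ) / (1 / 8) :=
    Real.log_le_rpow_div (by positivity) (by norm_num)
  rw [one_div y, Real.log_inv, Real.inv_rpow hy.le, ← Real.rpow_neg hy.le] at h1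
  have h2 := Real.log_le_log hy h
  have h3 := Real.log_le_log (hy.trans_le h) hx
  have h4 : 0 ≤ y ^ (-(1 / 8) : ℝ) := by positivity
  have h5 := Real.log_two_lt_d9
  rw [abs_le]
  constructor <;> linarith

theorem exists_norm_logKernel_le {α : ℝ} (hα : α ∈ Set.Icc 0 Real.pi) :
    ∃ C : ℝ, 0 ≤ C ∧ ∀ r ∈ Set.Ico (0 : ℝ) 1, ∀ β ∈ Set.Icc 0 Real.pi, β ≠ α →
      ‖logKernel α (r * Complex.exp (β * Complex.I))‖ ≤
        C * (1 + |β - α| ^ (-(1 / 8) : ℝ)) := by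
  have hπ := Real.pi_pos
  refine ⟨2 + 2 * Real.pi + 16 * Real.pi ^ (1 / 8 : ℝ), by positivity, fun r hr β hβ hne => ?_⟩
  have hpos : 0 < |β - α| := abs_pos.2 (sub_ne_zero.2 hne)
  have hA := abs_sub_div_pi_le_norm' hr.1 hβ hα
  have hB := abs_sub_div_pi_le_norm hr.1 hβ hα
  have hz := norm_mul_exp_lt_one hr β
  set ζ := (r : ℂ) * Complex.exp (β * Complex.I)
  have h2 : ∀ w : ℂ, ‖w‖ = 1 → ‖1 - ζ * w‖ ≤ 2 := fun w hw => by
    refine (norm_sub_le _ _).trans ?_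
    rw [norm_one, norm_mul, hw]; linarith
  have hl : ∀ w : ℂ, ‖w‖ = 1 → |β - α| / Real.pi ≤ ‖1 - ζ * w‖ →
      ‖Complex.log (1 - ζ * w)‖ ≤
        1 + 8 * (Real.pi ^ (1 / 8 : ℝ) * |β - α| ^ (-(1 / 8) : ℝ)) + Real.pi := fun w hw h => by
    refine (Complex.norm_le_abs_re_add_abs_im _).trans (add_le_add ?_ ?_)
    · rw [Complex.log_re]
      refine (abs_log_le_of_le (by positivity) h (h2 w hw)).trans (le_of_eq ?_)
      rw [Real.div_rpow hpos.le hπ.le, Real.rpow_neg hπ.le]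
      field_simp
    · rw [Complex.log_im]
      exact Complex.abs_arg_le_pi _
  have h3 := hl _ (Complex.norm_exp_ofReal_mul_I α) hA
  have h4 := hl _ (norm_exp_neg_ofReal_mul_I α) hB
  refine (norm_sub_le _ _).trans ?_
  have h5 : 0 ≤ |β - α| ^ (-(1 / 8) : ℝ) := by positivity
  have h6 : 0 ≤ Real.pi ^ (1 / 8 : ℝ) := by positivity
  nlinarith [mul_nonneg hπ.le h5]

end DefNLS

namespace DefNLS

/-! ### Integrability of products of power singularities -/

theorem integrableOn_abs_sub_rpow {s : ℝ} (hs : -1 < s) (t a b : ℝ) :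
    IntegrableOn (fun x => |x - t| ^ s) (Set.Icc a b) := by
  have h0 : ∀ R : ℝ, 0 ≤ R → IntervalIntegrable (fun x : ℝ => |x| ^ s) volume 0 R := fun R hR => by
    refine (intervalIntegral.intervalIntegrable_rpow' hs).congr fun x hx => ?_
    rw [Set.uIoc_of_le hR] at hx
    simp only [abs_of_pos hx.1]
  have h1 : ∀ c : ℝ, IntervalIntegrable (fun x : ℝ => |x| ^ s) volume 0 c := fun c => by
    rcases le_total 0 c with hc | hc
    · exact h0 c hc
    · have := (h0 (-c) (by linarith)).comp_sub_left 0
      simpa using this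
  have h2 : IntervalIntegrable (fun x => |x - t| ^ s) volume a b := by
    have := ((h1 (a - t)).symm.trans (h1 (b - t))).comp_sub_right t
    simpa using this
  rcases le_total a b with hab | hab
  · exact (intervalIntegrable_iff_integrableOn_Icc_of_le hab).1 h2
  · rcases hab.eq_or_lt with rfl | hab
    · simp
    · simp [Set.Icc_eq_empty (not_le.2 hab)]

/-- A weight with an inverse square root singularity at `t`. -/
noncomputable def rootWeight (t x : ℝ) : ℝ := 1 + |x - t| ^ (-(1 / 2) : ℝ)

theorem one_le_rootWeight (t x : ℝ) : 1 ≤ rootWeight t x := by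
  have : 0 ≤ |x - t| ^ (-(1 / 2) : ℝ) := by positivity
  unfold rootWeight; linarith

theorem rootWeight_pos (t x : ℝ) : 0 < rootWeight t x := one_pos.trans_le (one_le_rootWeight t x)

/-- Every x is at distance at least |t₁ - t₂|/2 from one of the two points, so one of the weights is
bounded there. Iterating turns the product of four weights into a sum, with one singularity at a
time. -/
theorem exists_rootWeight_mul_le {t₁ t₂ : ℝ} (h : t₁ ≠ t₂) : ∃ M : ℝ, 0 ≤ M ∧
    ∀ x, rootWeight t₁ x * rootWeight t₂ x ≤ M * (rootWeight t₁ x + rootWeight t₂ x) := by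
  have hd : 0 < |t₁ - t₂| / 2 := by
    have := abs_pos.2 (sub_ne_zero.2 h)
    positivity
  have hb : ∀ t x, |t₁ - t₂| / 2 ≤ |x - t| →
      rootWeight t x ≤ 1 + (|t₁ - t₂| / 2) ^ (-(1 / 2) : ℝ) := fun t x hx => by
    unfold rootWeight
    gcongr 1 + ?_
    exact Real.rpow_le_rpow_of_nonpos hd hx (by norm_num)
  refine ⟨1 + (|t₁ - t₂| / 2) ^ (-(1 / 2) : ℝ), by positivity, fun x => ?_⟩
  have hp₁ := rootWeight_pos t₁ x
  have hp₂ := rootWeight_pos t₂ x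
  have hM : 0 ≤ 1 + (|t₁ - t₂| / 2) ^ (-(1 / 2) : ℝ) := by positivity
  by_cases h1 : |t₁ - t₂| / 2 ≤ |x - t₁|
  · nlinarith [hb _ _ h1]
  · have h2 : |t₁ - t₂| / 2 ≤ |x - t₂| := by
      have := abs_sub_le t₁ x t₂
      rw [abs_sub_comm t₁ x] at this
      linarith
    nlinarith [hb _ _ h2]

theorem exists_rootWeight_prod_le {t₁ t₂ t₃ t₄ : ℝ} (h₁₂ : t₁ ≠ t₂) (h₁₃ : t₁ ≠ t₃) (h₁₄ : t₁ ≠ t₄)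
    (h₂₃ : t₂ ≠ t₃) (h₂₄ : t₂ ≠ t₄) (h₃₄ : t₃ ≠ t₄) : ∃ M : ℝ, 0 ≤ M ∧
    ∀ x, rootWeight t₁ x * rootWeight t₂ x * rootWeight t₃ x * rootWeight t₄ x ≤
      M * (rootWeight t₁ x + rootWeight t₂ x + rootWeight t₃ x + rootWeight t₄ x) := by
  obtain ⟨A, hA, hA'⟩ := exists_rootWeight_mul_le h₁₂
  obtain ⟨B, hB, hB'⟩ := exists_rootWeight_mul_le h₁₃
  obtain ⟨C, hC, hC'⟩ := exists_rootWeight_mul_le h₁₄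
  obtain ⟨D, hD, hD'⟩ := exists_rootWeight_mul_le h₂₃
  obtain ⟨E, hE, hE'⟩ := exists_rootWeight_mul_le h₂₄
  obtain ⟨F, hF, hF'⟩ := exists_rootWeight_mul_le h₃₄
  set M := A + B + C + D + E + F with hM
  have hM0 : 0 ≤ M := by positivity
  have key : ∀ N u v : ℝ, 0 ≤ u → 0 ≤ v → N ≤ M → u * v ≤ N * (u + v) → u * v ≤ M * (u + v) :=
    fun N u v hu hv hN h => h.trans (by gcongr)
  refine ⟨4 * M ^ 3, by positivity, fun x => ?_⟩
  have p₁ := (rootWeight_pos t₁ x).le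
  have p₂ := (rootWeight_pos t₂ x).le
  have p₃ := (rootWeight_pos t₃ x).le
  have p₄ := (rootWeight_pos t₄ x).le
  have k₁₂ := key A _ _ p₁ p₂ (by linarith) (hA' x)
  have k₁₃ := key B _ _ p₁ p₃ (by linarith) (hB' x)
  have k₁₄ := key C _ _ p₁ p₄ (by linarith) (hC' x)
  have k₂₃ := key D _ _ p₂ p₃ (by linarith) (hD' x)
  have k₂₄ := key E _ _ p₂ p₄ (by linarith) (hE' x)
  have k₃₄ := key F _ _ p₃ p₄ (by linarith) (hF' x)
  generalize rootWeight t₁ x = w₁ at *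
  generalize rootWeight t₂ x = w₂ at *
  generalize rootWeight t₃ x = w₃ at *
  generalize rootWeight t₄ x = w₄ at *
  have three : ∀ a b c : ℝ, 0 ≤ a → 0 ≤ b → 0 ≤ c → a * b ≤ M * (a + b) → a * c ≤ M * (a + c) →
      b * c ≤ M * (b + c) → a * b * c ≤ M * (M * (a + c) + M * (b + c)) :=
    fun a b c ha hb hc hab hac hbc => by
      calc a * b * c ≤ M * (a + b) * c := by gcongr
        _ = M * (a * c + b * c) := by ring
        _ ≤ _ := by gcongr
  calc w₁ * w₂ * w₃ * w₄ ≤ M * (M * (w₁ + w₃) + M * (w₂ + w₃)) * w₄ :=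
        mul_le_mul_of_nonneg_right (three _ _ _ p₁ p₂ p₃ k₁₂ k₁₃ k₂₃) p₄
    _ = M * M * (w₁ * w₄ + w₂ * w₄ + 2 * (w₃ * w₄)) := by ring
    _ ≤ M * M * (M * (w₁ + w₄) + M * (w₂ + w₄) + 2 * (M * (w₃ + w₄))) := by gcongr
    _ = M ^ 3 * (w₁ + w₂ + 2 * w₃ + 4 * w₄) := by ring
    _ ≤ M ^ 3 * (4 * (w₁ + w₂ + w₃ + w₄)) := by
        gcongr
        linarith
    _ = _ := by ring

theorem measurable_rootWeight (t : ℝ) : Measurable (rootWeight t) := by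
  unfold rootWeight
  fun_prop

theorem integrableOn_rootWeight_mul (t α a b : ℝ) :
    IntegrableOn (fun x => rootWeight t x * (1 + |x - α| ^ (-(1 / 8) : ℝ))) (Set.Icc a b) := by
  have hc : IntegrableOn (fun _ : ℝ => (1 : ℝ)) (Set.Icc a b) := integrableOn_const (by simp)
  refine Integrable.mono' (((hc.add (integrableOn_abs_sub_rpow (s := -(1 / 2)) (by norm_num) t a b)).add
    (integrableOn_abs_sub_rpow (s := -(1 / 8)) (by norm_num) α a b)).add
    ((integrableOn_abs_sub_rpow (s := -(5 / 8)) (by norm_num) t a b).add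
    (integrableOn_abs_sub_rpow (s := -(5 / 8)) (by norm_num) α a b))) ?_ ?_
  · have := measurable_rootWeight t
    exact Measurable.aestronglyMeasurable (by fun_prop)
  · refine Filter.Eventually.of_forall fun x => ?_
    have h1 : 0 ≤ |x - t| ^ (-(1 / 2) : ℝ) := by positivity
    have h2 : 0 ≤ |x - α| ^ (-(1 / 8) : ℝ) := by positivity
    -- The exponents 5/4 and 5 send both |x - t|^(-1/2) and |x - α|^(-1/8) to the power -5/8,
    -- integrable even when α = t.
    have h3 := Real.young_inequality_of_nonneg h1 h2 (p := 5 / 4) (q := 5)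
      ((Real.holderConjugate_iff).2 ⟨by norm_num, by norm_num⟩)
    rw [← Real.rpow_mul (abs_nonneg _), ← Real.rpow_mul (abs_nonneg _)] at h3
    norm_num at h3
    have h4 : 0 ≤ |x - t| ^ (-(5 / 8) : ℝ) := by positivity
    have h5 : 0 ≤ |x - α| ^ (-(5 / 8) : ℝ) := by positivity
    rw [Real.norm_of_nonneg (mul_nonneg (rootWeight_pos t x).le (by positivity)), rootWeight]
    simp only [Pi.add_apply]
    norm_num at *
    nlinarith

theorem integrableOn_rootWeight_prod_mul {t₁ t₂ t₃ t₄ : ℝ} (h₁₂ : t₁ ≠ t₂) (h₁₃ : t₁ ≠ t₃)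
    (h₁₄ : t₁ ≠ t₄) (h₂₃ : t₂ ≠ t₃) (h₂₄ : t₂ ≠ t₄) (h₃₄ : t₃ ≠ t₄) (α a b : ℝ) :
    IntegrableOn (fun x => rootWeight t₁ x * rootWeight t₂ x * rootWeight t₃ x * rootWeight t₄ x *
      (1 + |x - α| ^ (-(1 / 8) : ℝ))) (Set.Icc a b) := by
  obtain ⟨M, hM, h⟩ := exists_rootWeight_prod_le h₁₂ h₁₃ h₁₄ h₂₃ h₂₄ h₃₄
  have m₁ := measurable_rootWeight t₁
  have m₂ := measurable_rootWeight t₂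
  have m₃ := measurable_rootWeight t₃
  have m₄ := measurable_rootWeight t₄
  refine Integrable.mono' (((((integrableOn_rootWeight_mul t₁ α a b).add
    (integrableOn_rootWeight_mul t₂ α a b)).add (integrableOn_rootWeight_mul t₃ α a b)).add
    (integrableOn_rootWeight_mul t₄ α a b)).const_mul M)
    (Measurable.aestronglyMeasurable (by fun_prop)) (Filter.Eventually.of_forall fun x => ?_)
  have h1 : 0 ≤ 1 + |x - α| ^ (-(1 / 8) : ℝ) := by positivity
  have p₁ := rootWeight_pos t₁ x
  have p₂ := rootWeight_pos t₂ x
  have p₃ := rootWeight_pos t₃ x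
  have p₄ := rootWeight_pos t₄ x
  rw [Real.norm_of_nonneg (by positivity)]
  refine (mul_le_mul_of_nonneg_right (h x) h1).trans (le_of_eq ?_)
  simp only [Pi.add_apply]
  ring

end DefNLS

namespace DefNLS

/-! ### Boundary form of the mean value property -/

/-- The relation F(ζ̄) = -conj F(ζ) makes Im F symmetric about the real axis, so the upper half
circle contributes half of the mean value. -/
theorem integral_im_half_circle {F : ℂ → ℂ} {r : ℝ} {c : ℂ} (hr : 0 < r)
    (hF : ContinuousOn F (Metric.sphere 0 r))
    (hconj : ∀ ζ ∈ Metric.sphere (0 : ℂ) r, F ((starRingEnd ℂ) ζ) = -(starRingEnd ℂ) (F ζ))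
    (hc : Real.circleAverage F 0 r = c) :
    ∫ β in (0 : ℝ)..Real.pi, (F (r * Complex.exp (β * Complex.I))).im = Real.pi * c.im := by
  have hmem : ∀ β : ℝ, (r : ℂ) * Complex.exp (β * Complex.I) ∈ Metric.sphere (0 : ℂ) r := fun β => by
    simp [abs_of_pos hr]
  have hcont : Continuous fun β : ℝ => F (r * Complex.exp (β * Complex.I)) :=
    hF.comp_continuous (by fun_prop) hmem
  have him : Continuous fun β : ℝ => (F (r * Complex.exp (β * Complex.I))).im :=
    Complex.continuous_im.comp hcont
  have h1 : ∫ β in (0 : ℝ)..2 * Real.pi, (F (r * Complex.exp (β * Complex.I))).im =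
      2 * Real.pi * c.im := by
    have h2 := congrArg Complex.im hc
    rw [Real.circleAverage_def, Complex.smul_im, smul_eq_mul] at h2
    have h3 : (∫ β in (0 : ℝ)..2 * Real.pi, F (circleMap 0 r β)).im =
        ∫ β in (0 : ℝ)..2 * Real.pi, (F (r * Complex.exp (β * Complex.I))).im := by
      have := Complex.imCLM.intervalIntegral_comp_comm 
        (hcont.intervalIntegrable (μ := volume) 0 (2 * Real.pi))
      simp only [Complex.imCLM_apply] at this
      rw [this]
      simp [circleMap]
    rw [h3] at h2
    rw [← h2, mul_inv_cancel_left₀ (by positivity)]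
  have h4 : ∫ β in Real.pi..2 * Real.pi, (F (r * Complex.exp (β * Complex.I))).im =
      ∫ β in (0 : ℝ)..Real.pi, (F (r * Complex.exp (β * Complex.I))).im := by
    have := intervalIntegral.integral_comp_sub_left (a := 0) (b := Real.pi)
      (fun β : ℝ => (F (r * Complex.exp (β * Complex.I))).im) (2 * Real.pi)
    rw [show 2 * Real.pi - Real.pi = Real.pi by ring, sub_zero] at this
    rw [← this]
    refine intervalIntegral.integral_congr fun β _ => ?_
    have h5 : (r : ℂ) * Complex.exp (((2 * Real.pi - β : ℝ) : ℂ) * Complex.I) =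
        (starRingEnd ℂ) ((r : ℂ) * Complex.exp (β * Complex.I)) := by
      rw [map_mul, Complex.conj_ofReal, conj_exp_ofReal_mul_I]
      congr 1
      rw [Complex.exp_eq_exp_iff_exists_int]
      exact ⟨1, by push_cast; ring⟩
    simp only [h5, hconj _ (hmem β), Complex.neg_im, Complex.conj_im, neg_neg]
  have h6 := intervalIntegral.integral_add_adjacent_intervals
    (him.intervalIntegrable (μ := volume) 0 Real.pi)
    (him.intervalIntegrable (μ := volume) Real.pi (2 * Real.pi))
  rw [h4, h1] at h6
  linarith

/-- Dominated convergence as r → 1⁻: the circle averages do not depend on r, and countably many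
boundary singularities are harmless. The origin is removed from the domain because F will contain a
negative power of ζ; radii above 1/2 keep that power bounded. -/
theorem integral_im_half_circle_boundary {F : ℂ → ℂ} {c : ℂ} {s : Set ℝ} {bound : ℝ → ℝ}
    (hF : ContinuousOn F (Metric.ball 0 1 \ {0}))
    (hconj : ∀ ζ ∈ Metric.ball (0 : ℂ) 1, F ((starRingEnd ℂ) ζ) = -(starRingEnd ℂ) (F ζ))
    (hc : ∀ r ∈ Set.Ioo (0 : ℝ) 1, Real.circleAverage F 0 r = c) (hs : s.Countable)
    (hb : IntegrableOn bound (Set.Icc 0 Real.pi))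
    (hbound : ∀ r ∈ Set.Ioo (1 / 2 : ℝ) 1, ∀ β ∈ Set.Ioo 0 Real.pi, β ∉ s →
      ‖F (r * Complex.exp (β * Complex.I))‖ ≤ bound β)
    (hlim : ∀ β ∈ Set.Ioo 0 Real.pi, β ∉ s → ContinuousAt F (Complex.exp (β * Complex.I))) :
    ∫ β in (0 : ℝ)..Real.pi, (F (Complex.exp (β * Complex.I))).im = Real.pi * c.im := by
  have hmem : ∀ r ∈ Set.Ioo (1 / 2 : ℝ) 1, ∀ β : ℝ,
      (r : ℂ) * Complex.exp (β * Complex.I) ∈ Metric.sphere (0 : ℂ) r := fun r hr β => by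
    simp [abs_of_pos (show 0 < r by linarith [hr.1])]
  have hsub : ∀ r ∈ Set.Ioo (1 / 2 : ℝ) 1, Metric.sphere (0 : ℂ) r ⊆ Metric.ball 0 1 \ {0} := by
    intro r hr z hz
    have hz : ‖z‖ = r := by simpa using hz
    refine ⟨by simpa [hz] using hr.2, ?_⟩
    rintro rfl
    simp at hz
    linarith [hr.1]
  have hev : ∀ᶠ r : ℝ in nhdsWithin 1 (Set.Iio 1), r ∈ Set.Ioo (1 / 2 : ℝ) 1 :=
    Ioo_mem_nhdsLT (by norm_num)
  have hae : ∀ᵐ β : ℝ, β ∈ Set.uIoc 0 Real.pi → β ∈ Set.Ioo 0 Real.pi ∧ β ∉ s := by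
    have h1 : ∀ᵐ β : ℝ, β ∉ s := hs.ae_notMem volume
    have h2 : ∀ᵐ β : ℝ, β ≠ Real.pi := Measure.ae_ne volume Real.pi
    filter_upwards [h1, h2] with β h1 h2 h3
    rw [Set.uIoc_of_le Real.pi_pos.le] at h3
    exact ⟨⟨h3.1, lt_of_le_of_ne h3.2 h2⟩, h1⟩
  have key := intervalIntegral.tendsto_integral_filter_of_dominated_convergence (μ := volume)
    (a := 0) (b := Real.pi) (l := nhdsWithin (1 : ℝ) (Set.Iio 1))
    (F := fun r β => (F (r * Complex.exp (β * Complex.I))).im)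
    (f := fun β => (F (Complex.exp (β * Complex.I))).im) bound ?_ ?_ ?_ ?_
  · refine tendsto_nhds_unique key ?_
    refine (tendsto_const_nhds (x := Real.pi * c.im)).congr' ?_
    filter_upwards [hev] with r hr
    have hr0 : 0 < r := by linarith [hr.1]
    exact (integral_im_half_circle hr0 (hF.mono (hsub r hr))
      (fun ζ hζ => hconj ζ ((hsub r hr hζ).1)) (hc r ⟨hr0, hr.2⟩)).symm
  · filter_upwards [hev] with r hr
    exact (Complex.continuous_im.comp ((hF.mono (hsub r hr)).comp_continuous (by fun_prop)
      (hmem r hr))).aestronglyMeasurable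
  · filter_upwards [hev] with r hr
    filter_upwards [hae] with β hβ hβ'
    obtain ⟨h1, h2⟩ := hβ hβ'
    exact (Complex.abs_im_le_norm _).trans (hbound r hr β h1 h2)
  · rw [intervalIntegrable_iff_integrableOn_Icc_of_le Real.pi_pos.le]
    exact hb
  · filter_upwards [hae] with β hβ hβ'
    obtain ⟨h1, h2⟩ := hβ hβ'
    refine (Complex.continuous_im.tendsto _).comp ((hlim β h1 h2).tendsto.comp ?_)
    have : Filter.Tendsto (fun r : ℝ => (r : ℂ) * Complex.exp (β * Complex.I)) (nhds 1)
        (nhds ((1 : ℝ) * Complex.exp (β * Complex.I))) :=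
      Continuous.tendsto (by fun_prop) 1
    rw [Complex.ofReal_one, one_mul] at this
    exact this.mono_left nhdsWithin_le_nhds

/-! ### The spectral functions -/

/-- The real quartic polynomial with coefficients `p`. -/
def quartic (p : Fin 5 → ℝ) (w : ℝ) : ℝ :=
  p 0 + p 1 * w + p 2 * w ^ 2 + p 3 * w ^ 3 + p 4 * w ^ 4

/-- The polynomial `16 ζ⁴ P((ζ + ζ⁻¹) / 2)`, for the quartic `P` with coefficients `p`. -/
def quarticLift (p : Fin 5 → ℝ) (ζ : ℂ) : ℂ :=
  p 0 * (2 * ζ) ^ 4 + p 1 * (2 * ζ) ^ 3 * (1 + ζ ^ 2) + p 2 * (2 * ζ) ^ 2 * (1 + ζ ^ 2) ^ 2 +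
    p 3 * (2 * ζ) * (1 + ζ ^ 2) ^ 3 + p 4 * (1 + ζ ^ 2) ^ 4

/-- The differential `P dw / √((w - a₁) (w - a₂) (w - a₃) (w - a₄))`, `w = (ζ + ζ⁻¹) / 2`,
`aⱼ = cos θⱼ`, in the unit disc, up to powers of `ζ`. -/
noncomputable def spectralFun (p : Fin 5 → ℝ) (θ₁ θ₂ θ₃ θ₄ : ℝ) (ζ : ℂ) : ℂ :=
  quarticLift p ζ * (ζ ^ 2 - 1) / 8 *
    (invSqrtFactor θ₁ ζ * invSqrtFactor θ₂ ζ * invSqrtFactor θ₃ ζ * invSqrtFactor θ₄ ζ)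

theorem differentiable_quarticLift (p : Fin 5 → ℝ) : Differentiable ℂ (quarticLift p) := by
  unfold quarticLift; fun_prop

theorem differentiableOn_spectralFun (p : Fin 5 → ℝ) (θ₁ θ₂ θ₃ θ₄ : ℝ) :
    DifferentiableOn ℂ (spectralFun p θ₁ θ₂ θ₃ θ₄) (Metric.ball 0 1) := by
  have h := (differentiable_quarticLift p).differentiableOn (s := Metric.ball 0 1)
  have h₁ := differentiableOn_invSqrtFactor θ₁
  have h₂ := differentiableOn_invSqrtFactor θ₂
  have h₃ := differentiableOn_invSqrtFactor θ₃
  have h₄ := differentiableOn_invSqrtFactor θ₄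
  unfold spectralFun
  fun_prop

theorem spectralFun_conj (p : Fin 5 → ℝ) (θ₁ θ₂ θ₃ θ₄ : ℝ) {ζ : ℂ} (hζ : ‖ζ‖ < 1) :
    spectralFun p θ₁ θ₂ θ₃ θ₄ ((starRingEnd ℂ) ζ) =
      (starRingEnd ℂ) (spectralFun p θ₁ θ₂ θ₃ θ₄ ζ) := by
  simp only [spectralFun, invSqrtFactor_conj _ hζ, quarticLift, map_mul, map_div₀, map_sub, map_add,
    map_pow, map_one, Complex.conj_ofReal, Complex.conj_ofNat]

theorem exists_norm_spectralFun_le (p : Fin 5 → ℝ) {θ₁ θ₂ θ₃ θ₄ : ℝ} (h₁ : 0 < θ₁)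
    (h₁' : θ₁ ≤ Real.pi) (h₂ : θ₂ ∈ Set.Ioo 0 Real.pi) (h₃ : θ₃ ∈ Set.Ioo 0 Real.pi) (h₄ : 0 ≤ θ₄)
    (h₄' : θ₄ < Real.pi) :
    ∃ C : ℝ, 0 ≤ C ∧ ∀ r ∈ Set.Ico (0 : ℝ) 1, ∀ β ∈ Set.Icc 0 Real.pi, β ≠ θ₁ → β ≠ θ₂ → β ≠ θ₃ →
      β ≠ θ₄ → ‖spectralFun p θ₁ θ₂ θ₃ θ₄ (r * Complex.exp (β * Complex.I))‖ ≤
        C * (rootWeight θ₁ β * rootWeight θ₂ β * rootWeight θ₃ β * rootWeight θ₄ β) := by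
  obtain ⟨C₁, hC₁, b₁⟩ := exists_norm_one_add_mul_invSqrtFactor_le h₁ h₁'
  obtain ⟨C₂, hC₂, b₂⟩ := exists_norm_invSqrtFactor_le h₂.1 h₂.2
  obtain ⟨C₃, hC₃, b₃⟩ := exists_norm_invSqrtFactor_le h₃.1 h₃.2
  obtain ⟨C₄, hC₄, b₄⟩ := exists_norm_one_sub_mul_invSqrtFactor_le h₄ h₄'
  obtain ⟨C₀, hC₀⟩ := (isCompact_closedBall (0 : ℂ) 1).exists_bound_of_continuousOn
    (differentiable_quarticLift p).continuous.continuousOn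
  have hC₀' : 0 ≤ C₀ := (norm_nonneg _).trans (hC₀ 0 (by simp))
  refine ⟨C₀ * (C₁ * C₂ * C₃ * C₄), by positivity, fun r hr β hβ n₁ n₂ n₃ n₄ => ?_⟩
  have e₁ := b₁ r hr β hβ n₁
  have e₂ := b₂ r hr β hβ n₂
  have e₃ := b₃ r hr β hβ n₃
  have e₄ := b₄ r hr β hβ n₄
  have e₀ := hC₀ (r * Complex.exp (β * Complex.I)) (by
    simpa using (norm_mul_exp_lt_one hr β).le)
  have w₂ : C₂ * |β - θ₂| ^ (-(1 / 2) : ℝ) ≤ C₂ * rootWeight θ₂ β := by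
    unfold rootWeight; gcongr; linarith
  have w₃ : C₃ * |β - θ₃| ^ (-(1 / 2) : ℝ) ≤ C₃ * rootWeight θ₃ β := by
    unfold rootWeight; gcongr; linarith
  have q₁ := rootWeight_pos θ₁ β
  have q₂ := rootWeight_pos θ₂ β
  have q₃ := rootWeight_pos θ₃ β
  generalize (r : ℂ) * Complex.exp (β * Complex.I) = ζ at *
  -- The zeros of ζ² - 1 at -1 and 1 are assigned to the outer branch points θ₁ and θ₄, the only
  -- ones that may be endpoints of [0, π].
  have hsplit : spectralFun p θ₁ θ₂ θ₃ θ₄ ζ = -(1 / 8) * quarticLift p ζ *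
      (((1 + ζ) * invSqrtFactor θ₁ ζ) * invSqrtFactor θ₂ ζ * invSqrtFactor θ₃ ζ *
        ((1 - ζ) * invSqrtFactor θ₄ ζ)) := by
    unfold spectralFun; ring
  rw [hsplit, norm_mul, norm_mul, norm_mul _ ((1 - ζ) * _), norm_mul _ (invSqrtFactor θ₃ ζ),
    norm_mul _ (invSqrtFactor θ₂ ζ)]
  have h8 : ‖(-(1 / 8) : ℂ)‖ ≤ 1 := by norm_num
  calc _ ≤ 1 * C₀ * ((C₁ * rootWeight θ₁ β) * (C₂ * rootWeight θ₂ β) * (C₃ * rootWeight θ₃ β) *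
        (C₄ * rootWeight θ₄ β)) := by
        gcongr
        exacts [e₁, e₂.trans w₂, e₃.trans w₃, e₄]
    _ = _ := by ring

theorem sin_half_ne_zero {β θ : ℝ} (hβ : β ∈ Set.Ioo 0 Real.pi) (hθ : θ ∈ Set.Icc 0 Real.pi)
    (hne : β ≠ θ) : Real.sin ((β + θ) / 2) ≠ 0 ∧ Real.sin ((β - θ) / 2) ≠ 0 := by
  constructor
  · exact (Real.sin_pos_of_pos_of_lt_pi (by linarith [hβ.1, hθ.1]) (by linarith [hβ.2, hθ.2])).ne'
  · rcases hne.lt_or_gt with h | h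
    · exact (Real.sin_neg_of_neg_of_neg_pi_lt (by linarith) (by linarith [hβ.1, hθ.2])).ne
    · exact (Real.sin_pos_of_pos_of_lt_pi (by linarith) (by linarith [hβ.2, hθ.1])).ne'

theorem integral_im_spectralFun_mul {p : Fin 5 → ℝ} {θ₁ θ₂ θ₃ θ₄ α : ℝ} (h₄ : 0 ≤ θ₄) (h₃₄ : θ₄ < θ₃)
    (h₂₃ : θ₃ < θ₂) (h₁₂ : θ₂ < θ₁) (h₁ : θ₁ ≤ Real.pi) {G : ℂ → ℂ} {c : ℕ → ℂ} {C : ℝ} {k : ℕ}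
    (hG : DifferentiableOn ℂ G (Metric.ball 0 1))
    (hconj : ∀ ζ ∈ Metric.ball (0 : ℂ) 1, G ((starRingEnd ℂ) ζ) = -(starRingEnd ℂ) (G ζ))
    (hbound : ∀ r ∈ Set.Ico (0 : ℝ) 1, ∀ β ∈ Set.Icc 0 Real.pi, β ≠ α →
      ‖G (r * Complex.exp (β * Complex.I))‖ ≤ C * (1 + |β - α| ^ (-(1 / 8) : ℝ)))
    (hlim : ∀ β ∈ Set.Ioo 0 Real.pi, β ≠ α → ContinuousAt G (Complex.exp (β * Complex.I)))
    (hc : HasTaylorSix (fun ζ => spectralFun p θ₁ θ₂ θ₃ θ₄ ζ * G ζ) c) (hk : k < 6) :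
    ∫ β in (0 : ℝ)..Real.pi, (spectralFun p θ₁ θ₂ θ₃ θ₄ (Complex.exp (β * Complex.I)) *
      G (Complex.exp (β * Complex.I)) / Complex.exp (β * Complex.I) ^ k).im =
      Real.pi * (c k).im := by
  obtain ⟨B, hB, hSB⟩ := exists_norm_spectralFun_le p (by linarith : 0 < θ₁) h₁
    (⟨by linarith, by linarith⟩ : θ₂ ∈ Set.Ioo 0 Real.pi)
    (⟨by linarith, by linarith⟩ : θ₃ ∈ Set.Ioo 0 Real.pi) h₄ (by linarith)
  have hint := integrableOn_rootWeight_prod_mul h₁₂.ne' (h₂₃.trans h₁₂).ne'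
    ((h₃₄.trans h₂₃).trans h₁₂).ne' h₂₃.ne' (h₃₄.trans h₂₃).ne' h₃₄.ne' α 0 Real.pi
  refine integral_im_half_circle_boundary
    (F := fun ζ => spectralFun p θ₁ θ₂ θ₃ θ₄ ζ * G ζ / ζ ^ k) (s := {θ₁, θ₂, θ₃, θ₄, α}) ?_ ?_
    (fun r hr => hc.circleAverage hr.1 hr.2 hk) (by simp) (hint.const_mul (2 ^ k * (B * C))) ?_ ?_
  · refine ContinuousOn.div ?_ (by fun_prop) fun ζ hζ => pow_ne_zero _ hζ.2
    exact (((differentiableOn_spectralFun p θ₁ θ₂ θ₃ θ₄).mul hG).continuousOn).mono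
      Set.sdiff_subset
  · intro ζ hζ
    have hζ' : ‖ζ‖ < 1 := by simpa using hζ
    simp only [spectralFun_conj p θ₁ θ₂ θ₃ θ₄ hζ', hconj ζ hζ, map_mul, map_div₀, map_pow]
    ring
  · intro r hr β hβ hs
    simp only [Set.mem_insert_iff, Set.mem_singleton_iff, not_or] at hs
    obtain ⟨n₁, n₂, n₃, n₄, n₅⟩ := hs
    have hr' : r ∈ Set.Ico (0 : ℝ) 1 := ⟨by linarith [hr.1], hr.2⟩
    have hβ' := Set.Ioo_subset_Icc_self hβ
    have e₁ := hSB r hr' β hβ' n₁ n₂ n₃ n₄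
    have e₂ := hbound r hr' β hβ' n₅
    have hnorm : ‖(r : ℂ) * Complex.exp (β * Complex.I)‖ = r := by
      rw [norm_mul, Complex.norm_exp_ofReal_mul_I, mul_one, Complex.norm_real,
        Real.norm_of_nonneg hr'.1]
    have hr2 : (r ^ k)⁻¹ ≤ 2 ^ k := by
      rw [← inv_pow]
      refine pow_le_pow_left₀ (by simp [hr'.1]) ?_ k
      rw [inv_le_comm₀ (by linarith [hr.1]) two_pos]
      linarith [hr.1]
    rw [norm_div, norm_mul, norm_pow, hnorm, div_eq_inv_mul]
    have q₁ := rootWeight_pos θ₁ β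
    have q₂ := rootWeight_pos θ₂ β
    have q₃ := rootWeight_pos θ₃ β
    have q₄ := rootWeight_pos θ₄ β
    calc _ ≤ 2 ^ k * (B * (rootWeight θ₁ β * rootWeight θ₂ β * rootWeight θ₃ β * rootWeight θ₄ β) *
          (C * (1 + |β - α| ^ (-(1 / 8) : ℝ)))) := by gcongr
      _ = _ := by ring
  · intro β hβ hs
    simp only [Set.mem_insert_iff, Set.mem_singleton_iff, not_or] at hs
    obtain ⟨n₁, n₂, n₃, n₄, n₅⟩ := hs
    have s₁ := sin_half_ne_zero hβ (θ := θ₁) ⟨by linarith, by linarith⟩ n₁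
    have s₂ := sin_half_ne_zero hβ (θ := θ₂) ⟨by linarith, by linarith⟩ n₂
    have s₃ := sin_half_ne_zero hβ (θ := θ₃) ⟨by linarith, by linarith⟩ n₃
    have s₄ := sin_half_ne_zero hβ (θ := θ₄) ⟨by linarith, by linarith⟩ n₄
    have c₁ := continuousAt_invSqrtFactor s₁.1 s₁.2
    have c₂ := continuousAt_invSqrtFactor s₂.1 s₂.2
    have c₃ := continuousAt_invSqrtFactor s₃.1 s₃.2
    have c₄ := continuousAt_invSqrtFactor s₄.1 s₄.2
    have c₅ := hlim β hβ n₅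
    have c₀ := (differentiable_quarticLift p).continuous.continuousAt
      (x := Complex.exp (β * Complex.I))
    refine ContinuousAt.div (ContinuousAt.mul ?_ c₅) (by fun_prop)
      (pow_ne_zero _ (Complex.exp_ne_zero _))
    unfold spectralFun
    fun_prop

end DefNLS

namespace DefNLS

/-! ### Boundary values -/

/-- Polar form: 1 - exp(ix) = 2 sin(x/2) exp(i(x - π)/2), with the argument in (-π/2, π/2) for 0 < x
< 2π. -/
theorem log_one_sub_exp {x : ℝ} (h0 : 0 < x) (h1 : x < 2 * Real.pi) :
    Complex.log (1 - Complex.exp (x * Complex.I)) =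
      (Real.log (2 * Real.sin (x / 2)) : ℝ) + (((x - Real.pi) / 2 : ℝ) : ℂ) * Complex.I := by
  have hs : 0 < Real.sin (x / 2) := Real.sin_pos_of_pos_of_lt_pi (by linarith) (by linarith)
  have h : 1 - Complex.exp (x * Complex.I) = ((2 * Real.sin (x / 2) : ℝ) : ℂ) *
      Complex.exp ((((x - Real.pi) / 2 : ℝ) : ℂ) * Complex.I) := by
    have e1 : Complex.exp (x * Complex.I) =
        Complex.exp ((x / 2 : ℝ) * Complex.I) * Complex.exp ((x / 2 : ℝ) * Complex.I) := by
      rw [exp_mul_exp, add_halves]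
    have e2 : Complex.exp ((((x - Real.pi) / 2 : ℝ) : ℂ) * Complex.I) =
        Complex.exp ((x / 2 : ℝ) * Complex.I) * -Complex.I := by
      rw [show (((x - Real.pi) / 2 : ℝ) : ℂ) * Complex.I =
        ((x / 2 : ℝ) : ℂ) * Complex.I + -(Real.pi / 2 * Complex.I) by push_cast; ring,
        Complex.exp_add, Complex.exp_neg, Complex.exp_pi_div_two_mul_I, Complex.inv_I]
    have e3 : (2 : ℂ) * Real.sin (x / 2) = (Complex.exp (-((x / 2 : ℝ) * Complex.I)) -
        Complex.exp ((x / 2 : ℝ) * Complex.I)) * Complex.I := by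
      rw [Complex.ofReal_sin, Complex.sin]; ring_nf
    have e4 : Complex.exp ((x / 2 : ℝ) * Complex.I) * Complex.exp (-((x / 2 : ℝ) * Complex.I)) = 1 := by
      rw [← Complex.exp_add]; simp
    rw [e2, Complex.ofReal_mul, Complex.ofReal_ofNat, e3, e1]
    linear_combination (Complex.exp ((x / 2 : ℝ) * Complex.I) *
      Complex.exp (-((x / 2 : ℝ) * Complex.I)) - Complex.exp ((x / 2 : ℝ) * Complex.I) ^ 2) *
      Complex.I_sq - e4
  have him : ((((x - Real.pi) / 2 : ℝ) : ℂ) * Complex.I).im = (x - Real.pi) / 2 := by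
    generalize (x - Real.pi) / 2 = y
    simp
  rw [h, Complex.log_ofReal_mul (by positivity) (Complex.exp_ne_zero _), Complex.log_exp]
  · rw [him]; linarith
  · rw [him]; linarith

theorem log_one_sub_exp_neg {x : ℝ} (h0 : 0 < x) (h1 : x < 2 * Real.pi) :
    Complex.log (1 - Complex.exp (((-x : ℝ) : ℂ) * Complex.I)) =
      (Real.log (2 * Real.sin (x / 2)) : ℝ) - (((x - Real.pi) / 2 : ℝ) : ℂ) * Complex.I := by
  have hs : Real.sin (x / 2) ≠ 0 :=
    (Real.sin_pos_of_pos_of_lt_pi (by linarith) (by linarith)).ne'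
  have h := Complex.log_conj _ (Complex.slitPlane_arg_ne_pi (one_sub_exp_mem_slitPlane hs))
  rw [log_one_sub_exp h0 h1] at h
  simp only [map_sub, map_one, conj_exp_ofReal_mul_I, map_add, map_mul, Complex.conj_ofReal,
    Complex.conj_I] at h
  rw [Complex.ofReal_neg, neg_mul, h]
  ring

/-- The boundary value of the phase of `(w - a) ^ (-1/2)`. -/
noncomputable def branchPhase (a w : ℝ) : ℂ := if w < a then Complex.I else 1

theorem cos_sub_cos_eq (β θ : ℝ) :
    Real.cos θ - Real.cos β = 2 * Real.sin ((β + θ) / 2) * Real.sin ((β - θ) / 2) := by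
  rw [Real.cos_sub_cos, add_comm θ β, show (θ - β) / 2 = -((β - θ) / 2) by ring, Real.sin_neg]
  ring

theorem exp_neg_half_log {x : ℝ} (hx : 0 < x) :
    Complex.exp (-(Real.log x : ℂ) / 2) = ((√x)⁻¹ : ℝ) := by
  rw [show -(Real.log x : ℂ) / 2 = ((-Real.log √x : ℝ) : ℂ) by
    rw [Real.log_sqrt hx.le]; push_cast; ring, ← Complex.ofReal_exp, Real.exp_neg,
    Real.exp_log (by positivity)]

/-- The arguments of the two logarithms add to β when β < θ and to β - π when β > θ, apart from a
sign and up to the constant shift of the second branch; half of that jump is the phase i picked up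
when cos β passes below cos θ. -/
theorem invSqrtFactor_exp {β θ : ℝ} (hβ : β ∈ Set.Ioo 0 Real.pi) (hθ : θ ∈ Set.Icc 0 Real.pi)
    (hne : β ≠ θ) : invSqrtFactor θ (Complex.exp (β * Complex.I)) =
      ((√(2 * |Real.cos β - Real.cos θ|))⁻¹ : ℝ) * Complex.exp (-((β / 2 : ℝ) * Complex.I)) *
        branchPhase (Real.cos θ) (Real.cos β) := by
  have hA : 0 < Real.sin ((β + θ) / 2) :=
    Real.sin_pos_of_pos_of_lt_pi (by linarith [hβ.1, hθ.1]) (by linarith [hβ.2, hθ.2])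
  have h1 := log_one_sub_exp (x := β + θ) (by linarith [hβ.1, hθ.1]) (by linarith [hβ.2, hθ.2])
  have hcos := cos_sub_cos_eq β θ
  rw [invSqrtFactor, exp_mul_exp, exp_mul_exp_neg]
  rcases hne.lt_or_gt with h | h
  · have hB : 0 < Real.sin ((θ - β) / 2) :=
      Real.sin_pos_of_pos_of_lt_pi (by linarith) (by linarith [hβ.1, hθ.2])
    have h2 := log_one_sub_exp_neg (x := θ - β) (by linarith) (by linarith [hβ.1, hθ.2])
    rw [show (β - θ) / 2 = -((θ - β) / 2) by ring, Real.sin_neg] at hcos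
    have hlt : Real.cos θ < Real.cos β := by nlinarith [mul_pos hA hB]
    rw [neg_sub] at h2
    rw [h1, h2, branchPhase, if_neg (not_lt.2 hlt.le), mul_one, abs_of_pos (by linarith),
      show 2 * (Real.cos β - Real.cos θ) =
        2 * Real.sin ((β + θ) / 2) * (2 * Real.sin ((θ - β) / 2)) by linarith,
      ← exp_neg_half_log (by positivity), ← Complex.exp_add,
      Real.log_mul (x := 2 * Real.sin ((β + θ) / 2)) (by positivity) (by positivity)]
    congr 1
    push_cast
    ring
  · have hB : 0 < Real.sin ((β - θ) / 2) :=
      Real.sin_pos_of_pos_of_lt_pi (by linarith) (by linarith [hβ.2, hθ.1])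
    have h2 := log_one_sub_exp (x := β - θ) (by linarith) (by linarith [hβ.2, hθ.1])
    have hlt : Real.cos β < Real.cos θ := by nlinarith [mul_pos hA hB]
    have hph : branchPhase (Real.cos θ) (Real.cos β) = Complex.exp (Real.pi / 2 * Complex.I) := by
      rw [branchPhase, if_pos hlt, Complex.exp_pi_div_two_mul_I]
    rw [h1, h2, hph, abs_of_neg (by linarith),
      show 2 * -(Real.cos β - Real.cos θ) =
        2 * Real.sin ((β + θ) / 2) * (2 * Real.sin ((β - θ) / 2)) by linarith,
      ← exp_neg_half_log (by positivity), ← Complex.exp_add,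
      ← Complex.exp_add,
      Real.log_mul (x := 2 * Real.sin ((β + θ) / 2)) (by positivity) (by positivity)]
    congr 1
    push_cast
    ring

theorem ndrKernel_cos {α β : ℝ} (hα : α ∈ Set.Icc 0 Real.pi) (hβ : β ∈ Set.Icc 0 Real.pi)
    (hA : Real.sin ((β + α) / 2) ≠ 0) :
    ndrKernel (Real.cos α) (Real.cos β) =
      Real.log |Real.sin ((β + α) / 2) / Real.sin ((β - α) / 2)| := by
  have h1 : ∀ x ∈ Set.Icc 0 Real.pi, √(1 - Real.cos x ^ 2) = Real.sin x := fun x hx => by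
    rw [← Real.sin_sq, Real.sqrt_sq (Real.sin_nonneg_of_nonneg_of_le_pi hx.1 hx.2)]
  rw [ndrKernel, h1 α hα, h1 β hβ, cos_sub_cos_eq]
  have h2 : -(Real.sin α * Real.sin β) + Real.cos β * Real.cos α - 1 =
      -(2 * Real.sin ((β + α) / 2) ^ 2) := by
    have h3 := Real.cos_add β α
    have h4 := Real.cos_two_mul ((β + α) / 2)
    rw [mul_div_cancel₀ _ two_ne_zero] at h4
    have h5 := Real.sin_sq_add_cos_sq ((β + α) / 2)
    linarith
  rw [h2]
  congr 1
  rw [← abs_neg, ← neg_div, neg_neg]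
  congr 1
  field_simp

/-- The β-dependence of the two arguments cancels, so the imaginary part is piecewise constant with
one jump of π at β = α. Hence a band not containing z sees a constant, which multiplies its band
integral. -/
theorem logKernel_exp {α β : ℝ} (hα : α ∈ Set.Icc 0 Real.pi) (hβ : β ∈ Set.Ioo 0 Real.pi)
    (hne : β ≠ α) : logKernel α (Complex.exp (β * Complex.I)) =
      (ndrKernel (Real.cos α) (Real.cos β) : ℝ) +
        ((if α < β then α else α - Real.pi : ℝ) : ℂ) * Complex.I := by
  have hA : 0 < Real.sin ((β + α) / 2) :=
    Real.sin_pos_of_pos_of_lt_pi (by linarith [hβ.1, hα.1]) (by linarith [hβ.2, hα.2])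
  have h1 := log_one_sub_exp (x := β + α) (by linarith [hβ.1, hα.1]) (by linarith [hβ.2, hα.2])
  rw [ndrKernel_cos hα (Set.Ioo_subset_Icc_self hβ) hA.ne', Real.log_abs, logKernel, exp_mul_exp,
    exp_mul_exp_neg, h1, Real.log_mul two_ne_zero hA.ne']
  rcases hne.lt_or_gt with h | h
  · have hB : 0 < Real.sin ((α - β) / 2) :=
      Real.sin_pos_of_pos_of_lt_pi (by linarith) (by linarith [hβ.1, hα.2])
    have h2 := log_one_sub_exp_neg (x := α - β) (by linarith) (by linarith [hβ.1, hα.2])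
    rw [neg_sub] at h2
    rw [h2, if_neg (not_lt.2 h.le), show (β - α) / 2 = -((α - β) / 2) by ring, Real.sin_neg,
      div_neg, Real.log_neg_eq_log, Real.log_div hA.ne' hB.ne', Real.log_mul two_ne_zero hB.ne']
    push_cast
    ring
  · have hB : 0 < Real.sin ((β - α) / 2) :=
      Real.sin_pos_of_pos_of_lt_pi (by linarith) (by linarith [hβ.2, hα.1])
    have h2 := log_one_sub_exp (x := β - α) (by linarith) (by linarith [hβ.2, hα.1])
    rw [h2, if_pos h, Real.log_div hA.ne' hB.ne', Real.log_mul two_ne_zero hB.ne']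
    push_cast
    ring

theorem quarticLift_exp (p : Fin 5 → ℝ) (β : ℝ) : quarticLift p (Complex.exp (β * Complex.I)) =
    16 * Complex.exp (β * Complex.I) ^ 4 * quartic p (Real.cos β) := by
  have h : 1 + Complex.exp (β * Complex.I) ^ 2 =
      2 * Complex.exp (β * Complex.I) * Real.cos β := by
    have e : Complex.exp (β * Complex.I) * Complex.exp (-(β * Complex.I)) = 1 := by
      rw [← Complex.exp_add]; simp
    rw [Complex.ofReal_cos, Complex.cos, neg_mul]
    linear_combination -e
  rw [quarticLift, h, quartic]
  push_cast
  ring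

/-- `√|(w - a₁) (w - a₂) (w - a₃) (w - a₄)|`. -/
noncomputable def sqrtAbsProd (a₁ a₂ a₃ a₄ w : ℝ) : ℝ :=
  √(|w - a₁| * |w - a₂| * |w - a₃| * |w - a₄|)

theorem spectralFun_exp (p : Fin 5 → ℝ) {β θ₁ θ₂ θ₃ θ₄ : ℝ} (hβ : β ∈ Set.Ioo 0 Real.pi)
    (h₁ : θ₁ ∈ Set.Icc 0 Real.pi) (h₂ : θ₂ ∈ Set.Icc 0 Real.pi) (h₃ : θ₃ ∈ Set.Icc 0 Real.pi)
    (h₄ : θ₄ ∈ Set.Icc 0 Real.pi) (n₁ : β ≠ θ₁) (n₂ : β ≠ θ₂) (n₃ : β ≠ θ₃) (n₄ : β ≠ θ₄) :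
    spectralFun p θ₁ θ₂ θ₃ θ₄ (Complex.exp (β * Complex.I)) =
      Complex.exp (β * Complex.I) ^ 3 * (Complex.I * (Real.sin β : ℝ) *
        ((quartic p (Real.cos β) / sqrtAbsProd (Real.cos θ₁) (Real.cos θ₂) (Real.cos θ₃)
          (Real.cos θ₄) (Real.cos β) : ℝ) : ℂ) *
        (branchPhase (Real.cos θ₁) (Real.cos β) * branchPhase (Real.cos θ₂) (Real.cos β) *
          branchPhase (Real.cos θ₃) (Real.cos β) * branchPhase (Real.cos θ₄) (Real.cos β))) := by
  rw [spectralFun, invSqrtFactor_exp hβ h₁ n₁, invSqrtFactor_exp hβ h₂ n₂,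
    invSqrtFactor_exp hβ h₃ n₃, invSqrtFactor_exp hβ h₄ n₄, quarticLift_exp]
  have e : Complex.exp (β * Complex.I) * Complex.exp (-((β / 2 : ℝ) * Complex.I)) ^ 2 = 1 := by
    rw [← Complex.exp_nat_mul, ← Complex.exp_add]
    push_cast
    ring_nf
    simp
  have h : Complex.exp (β * Complex.I) ^ 2 - 1 =
      2 * Complex.I * Complex.exp (β * Complex.I) * Real.sin β := by
    have e : Complex.exp (β * Complex.I) * Complex.exp (-(β * Complex.I)) = 1 := by
      rw [← Complex.exp_add]; simp
    rw [Complex.ofReal_sin, Complex.sin, neg_mul]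
    linear_combination e + (Complex.exp (β * Complex.I) ^ 2 -
      Complex.exp (β * Complex.I) * Complex.exp (-(β * Complex.I))) * Complex.I_sq
  have hs : sqrtAbsProd (Real.cos θ₁) (Real.cos θ₂) (Real.cos θ₃) (Real.cos θ₄) (Real.cos β) =
      √(2 * |Real.cos β - Real.cos θ₁|) * √(2 * |Real.cos β - Real.cos θ₂|) *
      √(2 * |Real.cos β - Real.cos θ₃|) * √(2 * |Real.cos β - Real.cos θ₄|) / 4 := by
    rw [← Real.sqrt_mul (by positivity), ← Real.sqrt_mul (by positivity),
      ← Real.sqrt_mul (by positivity), sqrtAbsProd, eq_div_iff (by norm_num),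
      show (4 : ℝ) = √(4 ^ 2) by rw [Real.sqrt_sq (by norm_num)], ← Real.sqrt_mul (by positivity)]
    congr 1
    ring
  rw [hs, h]
  generalize Complex.exp (β * Complex.I) = ζ at *
  generalize Complex.exp (-((β / 2 : ℝ) * Complex.I)) = η at *
  -- Here η = ζ^(-1/2). The powers are ζ⁴ from the lifted quartic, ζ from ζ² - 1 and η⁴ from the
  -- four roots. The resulting ζ³ is why coefficient 3 is the one extracted for the kernel.
  have e2 : ζ ^ 5 * η ^ 4 = ζ ^ 3 := by
    linear_combination ζ ^ 3 * (ζ * η ^ 2 + 1) * e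
  push_cast
  rw [← e2]
  simp only [div_eq_mul_inv, mul_inv, inv_inv]
  ring

end DefNLS

namespace DefNLS

/-! ### Taylor coefficients of the spectral functions -/

theorem HasTaylorSix.congr {f g : ℂ → ℂ} {c : ℕ → ℂ} (h : HasTaylorSix f c)
    (hfg : ∀ ζ ∈ Metric.ball (0 : ℂ) 1, g ζ = f ζ) : HasTaylorSix g c := by
  obtain ⟨u, hu, h⟩ := h
  exact ⟨u, hu, fun ζ hζ => by rw [hfg ζ hζ, h ζ hζ]⟩

theorem HasTaylorSix.apply_zero {f : ℂ → ℂ} {c : ℕ → ℂ} (h : HasTaylorSix f c) : f 0 = c 0 := by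
  obtain ⟨u, hu, h⟩ := h
  simpa [Finset.sum_range_succ] using h 0 (by simp)

theorem isBigO_log_sub_logTaylor (w : ℂ) :
    (fun ζ : ℂ => Complex.log (1 - ζ * w) - Complex.logTaylor 6 (-(ζ * w))) =O[nhdsWithin 0 {0}ᶜ]
      fun ζ => ζ ^ 6 := by
  have h1 : Filter.Tendsto (fun ζ : ℂ => ‖-(ζ * w)‖) (nhdsWithin 0 {0}ᶜ) (nhds 0) := by
    have : Continuous fun ζ : ℂ => ‖-(ζ * w)‖ := by fun_prop
    simpa using (this.tendsto 0).mono_left nhdsWithin_le_nhds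
  refine Asymptotics.IsBigO.of_bound (‖w‖ ^ 6 * 2) ?_
  filter_upwards [h1.eventually (gt_mem_nhds (show (0 : ℝ) < 1 / 2 by norm_num))] with ζ hζ
  have h2 := Complex.norm_log_sub_logTaylor_le 5 (z := -(ζ * w)) (by linarith)
  rw [← sub_eq_add_neg] at h2
  refine h2.trans ?_
  have h3 : (1 - ‖-(ζ * w)‖)⁻¹ ≤ 2 := by
    rw [inv_le_comm₀ (by linarith) two_pos]
    linarith
  have h4 : ‖-(ζ * w)‖ ^ 6 = ‖w‖ ^ 6 * ‖ζ ^ 6‖ := by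
    rw [norm_neg, norm_mul, mul_pow, norm_pow, mul_comm]
  norm_num only
  rw [h4]
  have h5 : 0 ≤ ‖w‖ ^ 6 * ‖ζ ^ 6‖ := by positivity
  nlinarith

/-- Taylor series of the two logarithms. The formula is also correct at k = 0, where it evaluates to
0. -/
theorem hasTaylorSix_logKernel (α : ℝ) :
    HasTaylorSix (logKernel α) fun k => -(2 * Complex.I * (Real.sin (k * α) : ℝ)) / k := by
  refine HasTaylorSix.of_isBigO (differentiableOn_logKernel α) ?_
  have h := (isBigO_log_sub_logTaylor (Complex.exp (α * Complex.I))).sub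
    (isBigO_log_sub_logTaylor (Complex.exp (-(α * Complex.I))))
  refine h.congr_left fun ζ => ?_
  have hk : ∀ k : ℕ, 2 * Complex.I * (Real.sin (k * α) : ℝ) =
      Complex.exp (α * Complex.I) ^ k - Complex.exp (-(α * Complex.I)) ^ k := fun k => by
    rw [← Complex.exp_nat_mul, ← Complex.exp_nat_mul, Complex.ofReal_sin, Complex.sin]
    push_cast
    ring_nf
    simp
  simp only [hk, logKernel, Complex.logTaylor, Finset.sum_range_succ, Finset.sum_range_zero]
  push_cast
  ring

theorem hasTaylorSix_spectralNum (p : Fin 5 → ℝ) :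
    HasTaylorSix (fun ζ => quarticLift p ζ * (ζ ^ 2 - 1) / 8)
      fun k => ((([-p 4, -2 * p 3, -3 * p 4 - 4 * p 2, -4 * p 3 - 8 * p 1,
        -2 * p 4 - 4 * p 2 - 16 * p 0, 0] : List ℝ).getD k 0 / 8 : ℝ) : ℂ) := by
  refine ⟨fun ζ => ((16 * p 0 + 4 * p 2 + 2 * p 4) + (8 * p 1 + 4 * p 3) * ζ +
    (4 * p 2 + 3 * p 4) * ζ ^ 2 + 2 * p 3 * ζ ^ 3 + p 4 * ζ ^ 4) / 8, by fun_prop, fun ζ _ => ?_⟩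
  simp only [quarticLift, Finset.sum_range_succ, Finset.sum_range_zero, List.getD_cons_zero,
    List.getD_cons_succ]
  push_cast
  ring

theorem hasTaylorSix_branchProd (a₁ a₂ a₃ a₄ e₁ e₂ e₃ e₄ : ℝ) (h₁ : e₁ = a₁ + a₂ + a₃ + a₄)
    (h₂ : e₂ = a₁ * a₂ + a₁ * a₃ + a₁ * a₄ + a₂ * a₃ + a₂ * a₄ + a₃ * a₄)
    (h₃ : e₃ = a₁ * a₂ * a₃ + a₁ * a₂ * a₄ + a₁ * a₃ * a₄ + a₂ * a₃ * a₄)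
    (h₄ : e₄ = a₁ * a₂ * a₃ * a₄) :
    HasTaylorSix (fun ζ => (1 - 2 * a₁ * ζ + ζ ^ 2) * (1 - 2 * a₂ * ζ + ζ ^ 2) *
      (1 - 2 * a₃ * ζ + ζ ^ 2) * (1 - 2 * a₄ * ζ + ζ ^ 2))
      fun k => (([1, -2 * e₁, 4 + 4 * e₂, -6 * e₁ - 8 * e₃, 6 + 8 * e₂ + 16 * e₄,
        -6 * e₁ - 8 * e₃] : List ℝ).getD k 0 : ℝ) := by
  refine ⟨fun ζ => (4 + 4 * e₂) - 2 * e₁ * ζ + ζ ^ 2, by fun_prop, fun ζ _ => ?_⟩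
  simp only [Finset.sum_range_succ, Finset.sum_range_zero, List.getD_cons_zero,
    List.getD_cons_succ, h₁, h₂, h₃, h₄]
  push_cast
  ring

/-- If T is the product of the four roots and D the product of the four quadratics, then T² D = 1.
Together with T(0) = 1, comparison of coefficients determines those of T one after another, each new
one entering linearly with factor 2. -/
theorem exists_hasTaylorSix_invSqrtFactor_prod (θ₁ θ₂ θ₃ θ₄ e₁ e₂ e₃ e₄ : ℝ)
    (h₁ : e₁ = Real.cos θ₁ + Real.cos θ₂ + Real.cos θ₃ + Real.cos θ₄)
    (h₂ : e₂ = Real.cos θ₁ * Real.cos θ₂ + Real.cos θ₁ * Real.cos θ₃ + Real.cos θ₁ * Real.cos θ₄ +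
      Real.cos θ₂ * Real.cos θ₃ + Real.cos θ₂ * Real.cos θ₄ + Real.cos θ₃ * Real.cos θ₄)
    (h₃ : e₃ = Real.cos θ₁ * Real.cos θ₂ * Real.cos θ₃ + Real.cos θ₁ * Real.cos θ₂ * Real.cos θ₄ +
      Real.cos θ₁ * Real.cos θ₃ * Real.cos θ₄ + Real.cos θ₂ * Real.cos θ₃ * Real.cos θ₄)
    (h₄ : e₄ = Real.cos θ₁ * Real.cos θ₂ * Real.cos θ₃ * Real.cos θ₄) :
    ∃ t : ℕ → ℂ, HasTaylorSix (fun ζ => invSqrtFactor θ₁ ζ * invSqrtFactor θ₂ ζ *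
      invSqrtFactor θ₃ ζ * invSqrtFactor θ₄ ζ) t ∧ t 0 = 1 ∧ t 1 = e₁ ∧
      t 2 = -2 - 2 * e₂ + 3 / 2 * e₁ ^ 2 ∧
      t 3 = -3 * e₁ + 4 * e₃ - 6 * e₁ * e₂ + 5 / 2 * e₁ ^ 3 ∧
      t 4 = 3 + 8 * e₂ - 6 * e₁ ^ 2 - 8 * e₄ + 6 * e₂ ^ 2 + 12 * e₁ * e₃ - 15 * e₁ ^ 2 * e₂ +
        35 / 8 * e₁ ^ 4 := by
  have hd : DifferentiableOn ℂ (fun ζ => invSqrtFactor θ₁ ζ * invSqrtFactor θ₂ ζ *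
      invSqrtFactor θ₃ ζ * invSqrtFactor θ₄ ζ) (Metric.ball 0 1) := by
    have d₁ := differentiableOn_invSqrtFactor θ₁
    have d₂ := differentiableOn_invSqrtFactor θ₂
    have d₃ := differentiableOn_invSqrtFactor θ₃
    have d₄ := differentiableOn_invSqrtFactor θ₄
    fun_prop
  obtain ⟨t, ht⟩ := exists_hasTaylorSix hd
  have hD := hasTaylorSix_branchProd _ _ _ _ e₁ e₂ e₃ e₄ h₁ h₂ h₃ h₄
  have hone : HasTaylorSix (fun _ => 1) (fun k => if k = 0 then 1 else 0) :=
    ⟨fun _ => 0, by fun_prop, fun ζ _ => by simp⟩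
  have hprod := ((ht.mul ht).mul hD).congr (g := fun _ => 1) fun ζ hζ => by
    have hζ : ‖ζ‖ < 1 := by simpa using hζ
    have s₁ := invSqrtFactor_sq θ₁ hζ
    have s₂ := invSqrtFactor_sq θ₂ hζ
    have s₃ := invSqrtFactor_sq θ₃ hζ
    have s₄ := invSqrtFactor_sq θ₄ hζ
    have h : ∀ x y z w : ℂ, x = 1 → y = 1 → z = 1 → w = 1 → 1 = x * y * z * w := by
      rintro _ _ _ _ rfl rfl rfl rfl
      norm_num
    refine (h _ _ _ _ s₁ s₂ s₃ s₄).trans ?_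
    ring
  have t0 : t 0 = 1 := by rw [← ht.apply_zero]; simp [invSqrtFactor_zero]
  have k1 := hprod.unique hone (k := 1) (by norm_num)
  have k2 := hprod.unique hone (k := 2) (by norm_num)
  have k3 := hprod.unique hone (k := 3) (by norm_num)
  have k4 := hprod.unique hone (k := 4) (by norm_num)
  simp [Finset.sum_range_succ, t0] at k1 k2 k3 k4
  have t1 : t 1 = e₁ := by linear_combination k1 / 2
  rw [t1] at k2 k3 k4
  have t2 : t 2 = -2 - 2 * e₂ + 3 / 2 * e₁ ^ 2 := by linear_combination k2 / 2
  rw [t2] at k3 k4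
  have t3 : t 3 = -3 * e₁ + 4 * e₃ - 6 * e₁ * e₂ + 5 / 2 * e₁ ^ 3 := by
    linear_combination k3 / 2
  rw [t3] at k4
  exact ⟨t, ht, t0, t1, t2, t3, by linear_combination k4 / 2⟩

end DefNLS

namespace DefNLS

/-! ### Bounds for the kernel -/

theorem ndrKernel_comm (z w : ℝ) : ndrKernel z w = ndrKernel w z := by
  rw [ndrKernel, ndrKernel, ← abs_neg, ← div_neg, neg_sub, mul_comm √(1 - z ^ 2), mul_comm w z]

theorem measurable_ndrKernel : Measurable (fun q : ℝ × ℝ => ndrKernel q.1 q.2) := by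
  unfold ndrKernel
  have h : Measurable fun x : ℝ => |x| := measurable_norm
  fun_prop

/-- From (1 - wz)² - (z - w)² = (1 - z²)(1 - w²). The two bounds make the kernel nonnegative and at
most log(2/|z - w|). -/
theorem abs_sub_le_abs_ndrKernel_num {z w : ℝ} (hz : z ∈ Set.Icc (-1 : ℝ) 1)
    (hw : w ∈ Set.Icc (-1 : ℝ) 1) :
    |z - w| ≤ |-(√(1 - z ^ 2) * √(1 - w ^ 2)) + w * z - 1| ∧
      |-(√(1 - z ^ 2) * √(1 - w ^ 2)) + w * z - 1| ≤ 2 := by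
  have hz' : 0 ≤ 1 - z ^ 2 := by nlinarith [hz.1, hz.2]
  have hw' : 0 ≤ 1 - w ^ 2 := by nlinarith [hw.1, hw.2]
  have h1 := Real.sq_sqrt hz'
  have h2 := Real.sq_sqrt hw'
  have h3 := Real.sqrt_nonneg (1 - z ^ 2)
  have h4 := Real.sqrt_nonneg (1 - w ^ 2)
  have h5 : w * z ≤ 1 := by nlinarith
  rw [show -(√(1 - z ^ 2) * √(1 - w ^ 2)) + w * z - 1 =
    -(√(1 - z ^ 2) * √(1 - w ^ 2) + (1 - w * z)) by ring, abs_neg,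
    abs_of_nonneg (add_nonneg (mul_nonneg h3 h4) (by linarith))]
  constructor
  · have : |z - w| ≤ 1 - w * z := abs_le_of_sq_le_sq (by nlinarith [mul_nonneg hz' hw'])
      (by linarith)
    nlinarith [mul_nonneg h3 h4]
  · nlinarith [sq_nonneg (√(1 - z ^ 2) - √(1 - w ^ 2)), sq_nonneg (w + z)]

theorem ndrKernel_nonneg {z w : ℝ} (hz : z ∈ Set.Icc (-1 : ℝ) 1) (hw : w ∈ Set.Icc (-1 : ℝ) 1) :
    0 ≤ ndrKernel z w := by
  rcases eq_or_ne z w with rfl | hne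
  · simp [ndrKernel]
  · have h0 : 0 < |z - w| := abs_pos.2 (sub_ne_zero.2 hne)
    rw [ndrKernel, abs_div]
    exact Real.log_nonneg ((one_le_div h0).2 (abs_sub_le_abs_ndrKernel_num hz hw).1)

/-- The freedom in ε is needed: 1/8 for the explicit densities, and an exponent adapted to p for
arbitrary L^p solutions. -/
theorem ndrKernel_le {z w ε : ℝ} (hz : z ∈ Set.Icc (-1 : ℝ) 1) (hw : w ∈ Set.Icc (-1 : ℝ) 1)
    (hε : 0 < ε) : ndrKernel z w ≤ 2 ^ ε / ε * |w - z| ^ (-ε) := by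
  rcases eq_or_ne z w with rfl | hne
  · simp only [ndrKernel, sub_self, div_zero, abs_zero, Real.log_zero]
    positivity
  · have h0 : 0 < |z - w| := abs_pos.2 (sub_ne_zero.2 hne)
    rw [ndrKernel, abs_div]
    obtain ⟨h1, h2⟩ := abs_sub_le_abs_ndrKernel_num hz hw
    calc _ ≤ Real.log (2 / |z - w|) :=
          Real.log_le_log (div_pos (h0.trans_le h1) h0) (by gcongr)
      _ ≤ (2 / |z - w|) ^ ε / ε := Real.log_le_rpow_div (by positivity) hε
      _ = _ := by
        rw [Real.div_rpow two_pos.le h0.le, Real.rpow_neg (abs_nonneg _), abs_sub_comm w z]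
        ring

/-! ### The densities -/

/-- The spectral density `± P / (π √|(w - a₁) (w - a₂) (w - a₃) (w - a₄)|)`, for the quartic `P` with
coefficients `p`, with the sign of the square root on the genus one support. -/
noncomputable def spectralDensity (p : Fin 5 → ℝ) (a₁ a₂ a₃ a₄ w : ℝ) : ℝ :=
  (if a₂ ≤ w ∧ w ≤ a₃ then -1 else 1) * (quartic p w / sqrtAbsProd a₁ a₂ a₃ a₄ w) / Real.pi

theorem inv_sqrtAbsProd_le (a₁ a₂ a₃ a₄ w : ℝ) : (sqrtAbsProd a₁ a₂ a₃ a₄ w)⁻¹ ≤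
    rootWeight a₁ w * rootWeight a₂ w * rootWeight a₃ w * rootWeight a₄ w := by
  have h : ∀ a : ℝ, (√|w - a|)⁻¹ ≤ rootWeight a w := fun a => by
    rw [Real.sqrt_eq_rpow, ← Real.rpow_neg (abs_nonneg _), rootWeight]
    linarith
  rw [sqrtAbsProd, Real.sqrt_mul (by positivity), Real.sqrt_mul (by positivity),
    Real.sqrt_mul (by positivity), mul_inv, mul_inv, mul_inv]
  have q₁ := (rootWeight_pos a₁ w).le
  have q₂ := (rootWeight_pos a₂ w).le
  have q₃ := (rootWeight_pos a₃ w).le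
  gcongr
  all_goals exact h _

theorem continuous_quartic (p : Fin 5 → ℝ) : Continuous (quartic p) := by
  unfold quartic; fun_prop

theorem exists_abs_quartic_div_le (p : Fin 5 → ℝ) (a₁ a₂ a₃ a₄ : ℝ) :
    ∃ C : ℝ, 0 ≤ C ∧ ∀ w ∈ Set.Icc (-1 : ℝ) 1, |quartic p w / sqrtAbsProd a₁ a₂ a₃ a₄ w| ≤
      C * (rootWeight a₁ w * rootWeight a₂ w * rootWeight a₃ w * rootWeight a₄ w) := by
  obtain ⟨C, hC⟩ := (isCompact_Icc (a := (-1 : ℝ)) (b := 1)).exists_bound_of_continuousOn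
    (continuous_quartic p).continuousOn
  have hC0 : 0 ≤ C := (norm_nonneg _).trans (hC 0 (by simp))
  refine ⟨C, hC0, fun w hw => ?_⟩
  have hs : 0 ≤ sqrtAbsProd a₁ a₂ a₃ a₄ w := Real.sqrt_nonneg _
  rw [abs_div, abs_of_nonneg hs, div_eq_mul_inv]
  exact mul_le_mul (hC w hw) (inv_sqrtAbsProd_le a₁ a₂ a₃ a₄ w) (inv_nonneg.2 hs) hC0

theorem measurable_quartic_div (p : Fin 5 → ℝ) (a₁ a₂ a₃ a₄ : ℝ) :
    Measurable fun w => quartic p w / sqrtAbsProd a₁ a₂ a₃ a₄ w := by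
  have h := (continuous_quartic p).measurable
  have h2 : Measurable (sqrtAbsProd a₁ a₂ a₃ a₄) := by
    unfold sqrtAbsProd
    exact Continuous.measurable (by fun_prop)
  fun_prop

theorem measurable_spectralDensity (p : Fin 5 → ℝ) (a₁ a₂ a₃ a₄ : ℝ) :
    Measurable (spectralDensity p a₁ a₂ a₃ a₄) := by
  have h := measurable_quartic_div p a₁ a₂ a₃ a₄
  unfold spectralDensity
  refine ((Measurable.ite ?_ measurable_const measurable_const).mul h).div_const _
  exact measurableSet_Icc

theorem integrableOn_mul_quartic_div {p : Fin 5 → ℝ} {a₁ a₂ a₃ a₄ : ℝ} (h₁₂ : a₁ < a₂) (h₂₃ : a₂ < a₃)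
    (h₃₄ : a₃ < a₄) {g : ℝ → ℝ} (hg : Measurable g) {z C : ℝ}
    (hgC : ∀ w ∈ Set.Icc (-1 : ℝ) 1, |g w| ≤ C * (1 + |w - z| ^ (-(1 / 8) : ℝ))) :
    IntegrableOn (fun w => g w * (quartic p w / sqrtAbsProd a₁ a₂ a₃ a₄ w)) (Set.Icc (-1) 1) := by
  obtain ⟨B, hB, h⟩ := exists_abs_quartic_div_le p a₁ a₂ a₃ a₄
  have hint := integrableOn_rootWeight_prod_mul h₁₂.ne (h₁₂.trans h₂₃).ne
    ((h₁₂.trans h₂₃).trans h₃₄).ne h₂₃.ne (h₂₃.trans h₃₄).ne h₃₄.ne z (-1) 1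
  refine Integrable.mono' (hint.const_mul (C * B))
    (hg.mul (measurable_quartic_div p a₁ a₂ a₃ a₄)).aestronglyMeasurable ?_
  filter_upwards [ae_restrict_mem measurableSet_Icc] with w hw
  rw [Real.norm_eq_abs, abs_mul]
  calc _ ≤ C * (1 + |w - z| ^ (-(1 / 8) : ℝ)) *
      (B * (rootWeight a₁ w * rootWeight a₂ w * rootWeight a₃ w * rootWeight a₄ w)) :=
        mul_le_mul (hgC w hw) (h w hw) (abs_nonneg _) ((abs_nonneg _).trans (hgC w hw))
    _ = _ := by ring

theorem genusOneSupport_subset {a₁ a₂ a₃ a₄ : ℝ} (h₁ : -1 ≤ a₁) (h₁₂ : a₁ < a₂) (h₂₃ : a₂ < a₃)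
    (h₃₄ : a₃ < a₄) (h₄ : a₄ ≤ 1) : genusOneSupport a₁ a₂ a₃ a₄ ⊆ Set.Icc (-1) 1 := by
  rintro w ((hw | hw) | hw)
  · exact ⟨hw.1, by linarith [hw.2]⟩
  · exact ⟨by linarith [hw.1], by linarith [hw.2]⟩
  · exact ⟨by linarith [hw.1], hw.2⟩

theorem measurableSet_genusOneSupport (a₁ a₂ a₃ a₄ : ℝ) :
    MeasurableSet (genusOneSupport a₁ a₂ a₃ a₄) :=
  (measurableSet_Icc.union measurableSet_Icc).union measurableSet_Icc

theorem setIntegral_Icc_eq_genusOneSupport_add {a₁ a₂ a₃ a₄ : ℝ} (h₁ : -1 ≤ a₁) (h₁₂ : a₁ < a₂)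
    (h₂₃ : a₂ < a₃) (h₃₄ : a₃ < a₄) (h₄ : a₄ ≤ 1) {f : ℝ → ℝ}
    (hΓ : IntegrableOn f (genusOneSupport a₁ a₂ a₃ a₄)) (h12 : IntegrableOn f (Set.Ioo a₁ a₂))
    (h34 : IntegrableOn f (Set.Ioo a₃ a₄)) :
    ∫ w in Set.Icc (-1) 1, f w = (∫ w in genusOneSupport a₁ a₂ a₃ a₄, f w) +
      (∫ w in Set.Ioo a₁ a₂, f w) + ∫ w in Set.Ioo a₃ a₄, f w := by
  have hset : Set.Icc (-1) 1 =
      (genusOneSupport a₁ a₂ a₃ a₄ ∪ Set.Ioo a₁ a₂) ∪ Set.Ioo a₃ a₄ := by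
    ext w
    simp only [genusOneSupport, Set.mem_union, Set.mem_Icc, Set.mem_Ioo]
    constructor
    · rintro ⟨h, h'⟩
      by_cases c1 : w ≤ a₁
      · exact Or.inl (Or.inl (Or.inl (Or.inl ⟨h, c1⟩)))
      by_cases c2 : w < a₂
      · exact Or.inl (Or.inr ⟨not_le.1 c1, c2⟩)
      by_cases c3 : w ≤ a₃
      · exact Or.inl (Or.inl (Or.inl (Or.inr ⟨not_lt.1 c2, c3⟩)))
      by_cases c4 : w < a₄
      · exact Or.inr ⟨not_le.1 c3, c4⟩
      · exact Or.inl (Or.inl (Or.inr ⟨not_lt.1 c4, h'⟩))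
    · rintro ((((h | h) | h) | h) | h) <;> constructor <;> linarith [h.1, h.2]
  rw [hset, setIntegral_union _ measurableSet_Ioo (hΓ.union h12) h34,
    setIntegral_union _ measurableSet_Ioo hΓ h12]
  · rw [Set.disjoint_left]
    rintro w ((hw | hw) | hw) hw' <;> linarith [hw.1, hw.2, hw'.1, hw'.2]
  · rw [Set.disjoint_left]
    rintro w (((hw | hw) | hw) | hw) hw' <;> linarith [hw.1, hw.2, hw'.1, hw'.2]

theorem integral_sin_mul_comp_cos (f : ℝ → ℝ) :
    ∫ β in (0 : ℝ)..Real.pi, Real.sin β * f (Real.cos β) = ∫ w in Set.Icc (-1) 1, f w := by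
  have h := integral_image_eq_integral_abs_deriv_smul (s := Set.Icc 0 Real.pi) measurableSet_Icc
    (fun x _ => (Real.hasDerivAt_cos x).hasDerivWithinAt) Real.injOn_cos f
  rw [Real.bijOn_cos.image_eq] at h
  rw [h, intervalIntegral.integral_of_le Real.pi_pos.le, ← integral_Icc_eq_integral_Ioc]
  refine setIntegral_congr_fun measurableSet_Icc fun x hx => ?_
  simp only [abs_neg, smul_eq_mul, abs_of_nonneg (Real.sin_nonneg_of_nonneg_of_le_pi hx.1 hx.2)]

end DefNLS

namespace DefNLS

/-! ### Integrals against the spectral densities -/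

theorem integrableOn_quartic_div (p : Fin 5 → ℝ) {a₁ a₂ a₃ a₄ : ℝ} (h₁₂ : a₁ < a₂) (h₂₃ : a₂ < a₃)
    (h₃₄ : a₃ < a₄) :
    IntegrableOn (fun w => quartic p w / sqrtAbsProd a₁ a₂ a₃ a₄ w) (Set.Icc (-1) 1) := by
  have := integrableOn_mul_quartic_div (p := p) h₁₂ h₂₃ h₃₄ (g := fun _ => 1) measurable_const
    (z := 0) (C := 1) (fun w _ => by
      have : 0 ≤ |w - 0| ^ (-(1 / 8) : ℝ) := by positivity
      simp only [abs_one]; linarith)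
  simpa using this

/-- The differential `P dw / √∏ (w - aⱼ)` has vanishing integrals over both bands. -/
structure BandNull (p : Fin 5 → ℝ) (a₁ a₂ a₃ a₄ : ℝ) : Prop where
  left : ∫ w in Set.Ioo a₁ a₂, quartic p w / sqrtAbsProd a₁ a₂ a₃ a₄ w = 0
  right : ∫ w in Set.Ioo a₃ a₄, quartic p w / sqrtAbsProd a₁ a₂ a₃ a₄ w = 0

/-- The product of the phases of `(w - aⱼ) ^ (-1/2)`. -/
noncomputable def totalPhase (a₁ a₂ a₃ a₄ w : ℝ) : ℂ :=
  branchPhase a₁ w * branchPhase a₂ w * branchPhase a₃ w * branchPhase a₄ w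

theorem sqrtAbsProd_eq_zero {a₁ a₂ a₃ a₄ w : ℝ} (h : w = a₁ ∨ w = a₂ ∨ w = a₃ ∨ w = a₄) :
    sqrtAbsProd a₁ a₂ a₃ a₄ w = 0 := by
  rcases h with rfl | rfl | rfl | rfl <;> simp [sqrtAbsProd]

/-- The phase is i to the number of aⱼ above w, which is 4, 2 or 0 on the three components of Γ;
this is the sign built into `spectralDensity`. At a branch point both sides are 0 through division
by zero. -/
theorem re_totalPhase_of_mem {p : Fin 5 → ℝ} {a₁ a₂ a₃ a₄ : ℝ} (h₁₂ : a₁ < a₂) (h₂₃ : a₂ < a₃)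
    (h₃₄ : a₃ < a₄) {w : ℝ} (hw : w ∈ genusOneSupport a₁ a₂ a₃ a₄) (x : ℂ) :
    (((quartic p w / sqrtAbsProd a₁ a₂ a₃ a₄ w : ℝ) : ℂ) * totalPhase a₁ a₂ a₃ a₄ w * x).re =
      Real.pi * (x.re * spectralDensity p a₁ a₂ a₃ a₄ w) := by
  have hπ := Real.pi_ne_zero
  by_cases h : w = a₁ ∨ w = a₂ ∨ w = a₃ ∨ w = a₄
  · simp [spectralDensity, sqrtAbsProd_eq_zero h]
  push Not at h
  obtain ⟨n₁, n₂, n₃, n₄⟩ := h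
  have hI := Complex.I_mul_I
  have hre : ∀ q : ℝ, ((q : ℂ) * x).re = q * x.re := fun q => Complex.re_ofReal_mul q x
  rcases hw with (hw | hw) | hw
  · have w1 : w < a₁ := lt_of_le_of_ne hw.2 n₁
    have : totalPhase a₁ a₂ a₃ a₄ w = 1 := by
      rw [totalPhase, branchPhase, branchPhase, branchPhase, branchPhase, if_pos w1,
        if_pos (by linarith), if_pos (by linarith), if_pos (by linarith)]
      linear_combination (Complex.I * Complex.I - 1) * hI
    rw [this, mul_one, hre, spectralDensity, if_neg (by intro h; linarith [h.1])]
    field_simp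
  · have w1 : a₂ < w := lt_of_le_of_ne hw.1 n₂.symm
    have w2 : w < a₃ := lt_of_le_of_ne hw.2 n₃
    have : totalPhase a₁ a₂ a₃ a₄ w = -1 := by
      rw [totalPhase, branchPhase, branchPhase, branchPhase, branchPhase,
        if_neg (by linarith), if_neg (by linarith), if_pos (by linarith), if_pos (by linarith)]
      linear_combination hI
    rw [this, mul_neg_one, ← Complex.ofReal_neg, hre, spectralDensity, if_pos ⟨hw.1, hw.2⟩]
    field_simp
  · have w1 : a₄ < w := lt_of_le_of_ne hw.1 n₄.symm
    have : totalPhase a₁ a₂ a₃ a₄ w = 1 := by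
      rw [totalPhase, branchPhase, branchPhase, branchPhase, branchPhase,
        if_neg (by linarith), if_neg (by linarith), if_neg (by linarith), if_neg (by linarith)]
      norm_num
    rw [this, mul_one, hre, spectralDensity, if_neg (by intro h; linarith [h.2])]
    field_simp

theorem re_totalPhase_of_mem_left {a₁ a₂ a₃ a₄ : ℝ} (h₂₃ : a₂ < a₃) (h₃₄ : a₃ < a₄) {w : ℝ}
    (hw : w ∈ Set.Ioo a₁ a₂) (q : ℝ) (x : ℂ) :
    ((q : ℂ) * totalPhase a₁ a₂ a₃ a₄ w * x).re = x.im * q := by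
  have : totalPhase a₁ a₂ a₃ a₄ w = -Complex.I := by
    rw [totalPhase, branchPhase, branchPhase, branchPhase, branchPhase,
      if_neg (by linarith [hw.1]), if_pos hw.2, if_pos (by linarith [hw.2]),
      if_pos (by linarith [hw.2])]
    linear_combination Complex.I * Complex.I_mul_I
  rw [this]
  simp
  ring

theorem re_totalPhase_of_mem_right {a₁ a₂ a₃ a₄ : ℝ} (h₁₂ : a₁ < a₂) (h₂₃ : a₂ < a₃) {w : ℝ}
    (hw : w ∈ Set.Ioo a₃ a₄) (q : ℝ) (x : ℂ) :
    ((q : ℂ) * totalPhase a₁ a₂ a₃ a₄ w * x).re = -x.im * q := by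
  have : totalPhase a₁ a₂ a₃ a₄ w = Complex.I := by
    rw [totalPhase, branchPhase, branchPhase, branchPhase, branchPhase,
      if_neg (by linarith [hw.1]), if_neg (by linarith [hw.1]), if_neg (by linarith [hw.1]),
      if_pos hw.2]
    ring
  rw [this]
  simp
  ring

/-- The central contour argument, for a boundary function g of a general analytic G. On the bands
the phase is ±i, so only Im g survives there; being constant, it multiplies a vanishing band
integral. What remains of the mean value property is the integral over Γ. -/
theorem integral_mul_spectralDensity {p : Fin 5 → ℝ} {a₁ a₂ a₃ a₄ : ℝ} (h₁ : -1 ≤ a₁)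
    (h₁₂ : a₁ < a₂) (h₂₃ : a₂ < a₃) (h₃₄ : a₃ < a₄) (h₄ : a₄ ≤ 1) (hp : BandNull p a₁ a₂ a₃ a₄)
    {g : ℝ → ℂ} (hg : Measurable g) {z B : ℝ}
    (hgB : ∀ w ∈ Set.Icc (-1 : ℝ) 1, |(g w).re| ≤ B * (1 + |w - z| ^ (-(1 / 8) : ℝ)))
    {l r : ℝ} (hl : ∀ w ∈ Set.Ioo a₁ a₂, (g w).im = l) (hr : ∀ w ∈ Set.Ioo a₃ a₄, (g w).im = r)
    {G : ℂ → ℂ} {c : ℕ → ℂ} {α C : ℝ} {k : ℕ} (hG : DifferentiableOn ℂ G (Metric.ball 0 1))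
    (hconj : ∀ ζ ∈ Metric.ball (0 : ℂ) 1, G ((starRingEnd ℂ) ζ) = -(starRingEnd ℂ) (G ζ))
    (hbound : ∀ r ∈ Set.Ico (0 : ℝ) 1, ∀ β ∈ Set.Icc 0 Real.pi, β ≠ α →
      ‖G (r * Complex.exp (β * Complex.I))‖ ≤ C * (1 + |β - α| ^ (-(1 / 8) : ℝ)))
    (hlim : ∀ β ∈ Set.Ioo 0 Real.pi, β ≠ α → ContinuousAt G (Complex.exp (β * Complex.I)))
    (hGg : ∀ β ∈ Set.Ioo 0 Real.pi, β ≠ α → Complex.exp (β * Complex.I) ^ 3 *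
      G (Complex.exp (β * Complex.I)) / Complex.exp (β * Complex.I) ^ k = g (Real.cos β))
    (hc : HasTaylorSix (fun ζ => spectralFun p (Real.arccos a₁) (Real.arccos a₂) (Real.arccos a₃)
      (Real.arccos a₄) ζ * G ζ) c) (hk : k < 6) :
    ∫ w in genusOneSupport a₁ a₂ a₃ a₄, (g w).re * spectralDensity p a₁ a₂ a₃ a₄ w = (c k).im := by
  have m : ∀ a, Real.arccos a ∈ Set.Icc 0 Real.pi := fun a =>
    ⟨Real.arccos_nonneg a, Real.arccos_le_pi a⟩
  have master := integral_im_spectralFun_mul (Real.arccos_nonneg a₄)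
    (Real.strictAntiOn_arccos (by constructor <;> linarith) (by constructor <;> linarith) h₃₄)
    (Real.strictAntiOn_arccos (by constructor <;> linarith) (by constructor <;> linarith) h₂₃)
    (Real.strictAntiOn_arccos (by constructor <;> linarith) (by constructor <;> linarith) h₁₂)
    (Real.arccos_le_pi a₁) hG hconj hbound hlim hc hk
  set Φ : ℝ → ℝ := fun w => (((quartic p w / sqrtAbsProd a₁ a₂ a₃ a₄ w : ℝ) : ℂ) *
    totalPhase a₁ a₂ a₃ a₄ w * g w).re with hΦ
  have e1 : ∫ β in (0 : ℝ)..Real.pi, Real.sin β * Φ (Real.cos β) = Real.pi * (c k).im := by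
    rw [← master]
    refine intervalIntegral.integral_congr_ae ?_
    have hae : ∀ᵐ β : ℝ, β ∉ ({Real.arccos a₁, Real.arccos a₂, Real.arccos a₃, Real.arccos a₄, α,
        Real.pi} : Set ℝ) := (Set.countable_singleton _ |>.insert _ |>.insert _ |>.insert _
          |>.insert _ |>.insert _).ae_notMem volume
    filter_upwards [hae] with β hβ hβ'
    simp only [Set.mem_insert_iff, Set.mem_singleton_iff, not_or] at hβ
    obtain ⟨n₁, n₂, n₃, n₄, n₅, n₆⟩ := hβ
    rw [Set.uIoc_of_le Real.pi_pos.le] at hβ'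
    have hβ0 : β ∈ Set.Ioo 0 Real.pi := ⟨hβ'.1, lt_of_le_of_ne hβ'.2 n₆⟩
    rw [spectralFun_exp p hβ0 (m _) (m _) (m _) (m _) n₁ n₂ n₃ n₄,
      Real.cos_arccos h₁ (by linarith), Real.cos_arccos (by linarith) (by linarith),
      Real.cos_arccos (by linarith) (by linarith), Real.cos_arccos (by linarith) h₄]
    have : ∀ q : ℂ, (Complex.I * (Real.sin β : ℝ) * q).im = Real.sin β * q.re := fun q => by
      rw [mul_comm Complex.I, mul_assoc, Complex.im_ofReal_mul, Complex.I_mul_im]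
    simp only [hΦ]
    rw [← this, ← hGg β hβ0 n₅]
    congr 1
    unfold totalPhase
    ring
  rw [integral_sin_mul_comp_cos] at e1
  have i1 := integrableOn_quartic_div p h₁₂ h₂₃ h₃₄
  have i2 := integrableOn_mul_quartic_div (p := p) h₁₂ h₂₃ h₃₄
    (g := fun w => (g w).re * (if a₂ ≤ w ∧ w ≤ a₃ then -1 else 1))
    ((Complex.measurable_re.comp hg).mul (Measurable.ite measurableSet_Icc measurable_const
      measurable_const)) (z := z) (C := B) (fun w hw => by
        have := hgB w hw
        split_ifs <;> simpa using this)
  have c0 : Set.EqOn (fun w => (g w).re * (if a₂ ≤ w ∧ w ≤ a₃ then -1 else 1) *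
      (quartic p w / sqrtAbsProd a₁ a₂ a₃ a₄ w)) Φ (genusOneSupport a₁ a₂ a₃ a₄) := fun w hw => by
    simp only [hΦ]
    rw [re_totalPhase_of_mem h₁₂ h₂₃ h₃₄ hw, spectralDensity]
    field_simp
  have c1 : Set.EqOn (fun w => l * (quartic p w / sqrtAbsProd a₁ a₂ a₃ a₄ w)) Φ (Set.Ioo a₁ a₂) :=
    fun w hw => by
      simp only [hΦ]
      rw [re_totalPhase_of_mem_left h₂₃ h₃₄ hw, hl w hw]
  have c2 : Set.EqOn (fun w => -r * (quartic p w / sqrtAbsProd a₁ a₂ a₃ a₄ w)) Φ (Set.Ioo a₃ a₄) :=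
    fun w hw => by
      simp only [hΦ]
      rw [re_totalPhase_of_mem_right h₁₂ h₂₃ hw, hr w hw]
  have s1 : Set.Ioo a₁ a₂ ⊆ Set.Icc (-1) 1 := fun w hw =>
    ⟨by linarith [hw.1], by linarith [hw.2]⟩
  have s2 : Set.Ioo a₃ a₄ ⊆ Set.Icc (-1) 1 := fun w hw =>
    ⟨by linarith [hw.1], by linarith [hw.2]⟩
  have e2 := setIntegral_Icc_eq_genusOneSupport_add h₁ h₁₂ h₂₃ h₃₄ h₄ (f := Φ)
    ((i2.mono_set (genusOneSupport_subset h₁ h₁₂ h₂₃ h₃₄ h₄)).congr_fun c0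
      (measurableSet_genusOneSupport _ _ _ _))
    (IntegrableOn.congr_fun ((i1.mono_set s1).const_mul l) c1 measurableSet_Ioo)
    (IntegrableOn.congr_fun ((i1.mono_set s2).const_mul (-r)) c2 measurableSet_Ioo)
  -- The two band contributions disappear here, by `BandNull`.
  rw [← setIntegral_congr_fun measurableSet_Ioo c1, ← setIntegral_congr_fun measurableSet_Ioo c2,
    integral_const_mul, integral_const_mul, hp.left, hp.right, e1] at e2
  have e3 : ∫ w in genusOneSupport a₁ a₂ a₃ a₄, Φ w = Real.pi *
      ∫ w in genusOneSupport a₁ a₂ a₃ a₄, (g w).re * spectralDensity p a₁ a₂ a₃ a₄ w := by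
    rw [← integral_const_mul]
    refine setIntegral_congr_fun (measurableSet_genusOneSupport _ _ _ _) fun w hw => ?_
    simp only [hΦ]
    rw [re_totalPhase_of_mem h₁₂ h₂₃ h₃₄ hw]
  rw [e3] at e2
  have := Real.pi_pos
  refine mul_left_cancel₀ this.ne' ?_
  linarith

end DefNLS

/-! ### Explicit potentials and moments of the spectral densities -/

namespace DefNLS

/-- `e₁, …, e₄` are the elementary symmetric functions of `a₁, …, a₄`. -/
structure IsElementarySymmetric (e₁ e₂ e₃ e₄ a₁ a₂ a₃ a₄ : ℝ) : Prop where
  one : e₁ = a₁ + a₂ + a₃ + a₄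
  two : e₂ = a₁ * a₂ + a₁ * a₃ + a₁ * a₄ + a₂ * a₃ + a₂ * a₄ + a₃ * a₄
  three : e₃ = a₁ * a₂ * a₃ + a₁ * a₂ * a₄ + a₁ * a₃ * a₄ + a₂ * a₃ * a₄
  four : e₄ = a₁ * a₂ * a₃ * a₄

theorem exists_hasTaylorSix_spectralFun (p : Fin 5 → ℝ) {e₁ e₂ e₃ e₄ a₁ a₂ a₃ a₄ : ℝ}
    (h₁ : -1 ≤ a₁) (h₁₂ : a₁ < a₂) (h₂₃ : a₂ < a₃) (h₃₄ : a₃ < a₄) (h₄ : a₄ ≤ 1)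
    (he : IsElementarySymmetric e₁ e₂ e₃ e₄ a₁ a₂ a₃ a₄) :
    ∃ b : ℕ → ℂ, HasTaylorSix (spectralFun p (Real.arccos a₁) (Real.arccos a₂) (Real.arccos a₃)
      (Real.arccos a₄)) b ∧
      b 0 = ((-p 4 / 8 : ℝ) : ℂ) ∧ b 1 = ((-p 3 / 4 - p 4 * e₁ / 8 : ℝ) : ℂ) ∧
      b 2 = (((-3 * p 4 - 4 * p 2) / 8 - p 3 / 4 * e₁ -
        p 4 / 8 * (-2 - 2 * e₂ + 3 / 2 * e₁ ^ 2) : ℝ) : ℂ) ∧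
      b 4 = (((-2 * p 4 - 4 * p 2 - 16 * p 0) / 8 + (-4 * p 3 - 8 * p 1) / 8 * e₁ +
        (-3 * p 4 - 4 * p 2) / 8 * (-2 - 2 * e₂ + 3 / 2 * e₁ ^ 2) -
        p 3 / 4 * (-3 * e₁ + 4 * e₃ - 6 * e₁ * e₂ + 5 / 2 * e₁ ^ 3) -
        p 4 / 8 * (3 + 8 * e₂ - 6 * e₁ ^ 2 - 8 * e₄ + 6 * e₂ ^ 2 + 12 * e₁ * e₃ -
          15 * e₁ ^ 2 * e₂ + 35 / 8 * e₁ ^ 4) : ℝ) : ℂ) ∧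
      (p 4 = 0 → b 5 = (((-4 * p 2 - 16 * p 0) / 8 * e₁ +
        (-4 * p 3 - 8 * p 1) / 8 * (-2 - 2 * e₂ + 3 / 2 * e₁ ^ 2) -
        p 2 / 2 * (-3 * e₁ + 4 * e₃ - 6 * e₁ * e₂ + 5 / 2 * e₁ ^ 3) -
        p 3 / 4 * (3 + 8 * e₂ - 6 * e₁ ^ 2 - 8 * e₄ + 6 * e₂ ^ 2 + 12 * e₁ * e₃ -
          15 * e₁ ^ 2 * e₂ + 35 / 8 * e₁ ^ 4) : ℝ) : ℂ)) := by
  have c₁ := Real.cos_arccos h₁ (by linarith)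
  have c₂ := Real.cos_arccos (x := a₂) (by linarith) (by linarith)
  have c₃ := Real.cos_arccos (x := a₃) (by linarith) (by linarith)
  have c₄ := Real.cos_arccos (x := a₄) (by linarith) h₄
  obtain ⟨t, ht, t0, t1, t2, t3, t4⟩ := exists_hasTaylorSix_invSqrtFactor_prod (Real.arccos a₁)
    (Real.arccos a₂) (Real.arccos a₃) (Real.arccos a₄) e₁ e₂ e₃ e₄ (by rw [c₁, c₂, c₃, c₄, he.one])
    (by rw [c₁, c₂, c₃, c₄, he.two]) (by rw [c₁, c₂, c₃, c₄, he.three])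
    (by rw [c₁, c₂, c₃, c₄, he.four])
  -- The unknown fifth coefficient of the root product would enter b 5 multiplied by -p 4 / 8, which
  -- is why that coefficient is computed only for p 4 = 0.
  refine ⟨_, (hasTaylorSix_spectralNum p).mul ht, ?_, ?_, ?_, ?_, fun h5 => ?_⟩
  all_goals
    simp [Finset.sum_range_succ, t0, t1, t2, t3, t4]
  · ring
  · ring
  · ring
  · simp [h5]
    ring

/-- The ζ³ coefficient of the product pairs b 0, b 1, b 2 with sin 3α, sin 2α, sin α, that is, with
√(1 - z²) times polynomials in z = cos α of degrees 2, 1 and 0. The coefficient b 3 drops out since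
`logKernel` vanishes at the origin. -/
theorem integral_ndrKernel_mul_spectralDensity {p : Fin 5 → ℝ} {e₁ e₂ e₃ e₄ a₁ a₂ a₃ a₄ : ℝ}
    (h₁ : -1 ≤ a₁) (h₁₂ : a₁ < a₂) (h₂₃ : a₂ < a₃) (h₃₄ : a₃ < a₄) (h₄ : a₄ ≤ 1)
    (he : IsElementarySymmetric e₁ e₂ e₃ e₄ a₁ a₂ a₃ a₄) (hp : BandNull p a₁ a₂ a₃ a₄)
    {z : ℝ} (hz : z ∈ genusOneSupport a₁ a₂ a₃ a₄) :
    ∫ w in genusOneSupport a₁ a₂ a₃ a₄, ndrKernel z w * spectralDensity p a₁ a₂ a₃ a₄ w =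
      (-2 * ((-3 * p 4 - 4 * p 2) / 8 - p 3 / 4 * e₁ -
        p 4 / 8 * (-2 - 2 * e₂ + 3 / 2 * e₁ ^ 2)) + (p 3 / 2 + p 4 * e₁ / 4) * z +
        p 4 / 12 * (4 * z ^ 2 - 1)) * √(1 - z ^ 2) := by
  have hz1 := genusOneSupport_subset h₁ h₁₂ h₂₃ h₃₄ h₄ hz
  obtain ⟨b, hb, b0, b1, b2, -, -⟩ := exists_hasTaylorSix_spectralFun p h₁ h₁₂ h₂₃ h₃₄ h₄ he
  set α := Real.arccos z with hα
  have hcos : Real.cos α = z := Real.cos_arccos hz1.1 hz1.2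
  have hαm : α ∈ Set.Icc 0 Real.pi := ⟨Real.arccos_nonneg z, Real.arccos_le_pi z⟩
  obtain ⟨C, hC, hLC⟩ := exists_norm_logKernel_le hαm
  have hmeas : Measurable fun w => ndrKernel z w := measurable_ndrKernel.of_uncurry_left
  have key := integral_mul_spectralDensity h₁ h₁₂ h₂₃ h₃₄ h₄ hp
    (g := fun w => (ndrKernel z w : ℂ) + ((if w < z then α else α - Real.pi : ℝ) : ℂ) * Complex.I)
    (by
      refine (Complex.measurable_ofReal.comp hmeas).add (Measurable.mul_const ?_ _)
      exact Complex.measurable_ofReal.comp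
        (Measurable.ite measurableSet_Iio measurable_const measurable_const))
    (z := z) (B := 2 ^ (1 / 8 : ℝ) / (1 / 8)) (fun w hw => by
      simp only [Complex.add_re, Complex.re_ofReal_mul, Complex.ofReal_re, Complex.I_re, mul_zero,
        add_zero]
      rw [abs_of_nonneg (ndrKernel_nonneg hz1 hw)]
      refine (ndrKernel_le hz1 hw (ε := 1 / 8) (by norm_num)).trans ?_
      gcongr
      linarith)
    -- Since z lies in Γ, the jump of the imaginary part at w = z does not occur inside either band.
    (l := if z ≤ a₁ then α - Real.pi else α) (r := if z ≤ a₃ then α - Real.pi else α)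
    (fun w hw => by
      simp only [Complex.add_im, Complex.im_ofReal_mul, Complex.ofReal_im, Complex.I_im, mul_one,
        zero_add]
      by_cases h : z ≤ a₁
      · rw [if_pos h, if_neg (by linarith [hw.1])]
      · rw [if_neg h, if_pos]
        rcases hz with (hz | hz) | hz
        · exact absurd hz.2 h
        · linarith [hz.1, hw.2]
        · linarith [hz.1, hw.2])
    (fun w hw => by
      simp only [Complex.add_im, Complex.im_ofReal_mul, Complex.ofReal_im, Complex.I_im, mul_one,
        zero_add]
      by_cases h : z ≤ a₃
      · rw [if_pos h, if_neg (by linarith [hw.1])]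
      · rw [if_neg h, if_pos]
        rcases hz with (hz | hz) | hz
        · linarith [hz.2]
        · exact absurd hz.2 h
        · linarith [hz.1, hw.2])
    (differentiableOn_logKernel α) (fun ζ hζ => logKernel_conj α (by simpa using hζ)) hLC
    (fun β hβ hne => continuousAt_logKernel (sin_half_ne_zero hβ hαm hne).1
      (sin_half_ne_zero hβ hαm hne).2)
    (k := 3) (fun β hβ hne => by
      rw [mul_div_cancel_left₀ _ (pow_ne_zero _ (Complex.exp_ne_zero _)), logKernel_exp hαm hβ hne,
        hcos]
      have : α < β ↔ Real.cos β < z := by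
        rw [← hcos]
        exact (Real.strictAntiOn_cos.lt_iff_gt (Set.Ioo_subset_Icc_self hβ) hαm).symm
      simp only [this])
    (hb.mul (hasTaylorSix_logKernel α)) (by norm_num)
  simp only [Complex.add_re, Complex.re_ofReal_mul, Complex.ofReal_re, Complex.I_re, mul_zero,
    add_zero] at key
  rw [key]
  have hsin : Real.sin α = √(1 - z ^ 2) := Real.sin_arccos z
  have hsin2 : Real.sin (2 * α) = 2 * z * √(1 - z ^ 2) := by
    rw [Real.sin_two_mul, hcos, hsin]; ring
  have hsin3 : Real.sin (3 * α) = (4 * z ^ 2 - 1) * √(1 - z ^ 2) := by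
    rw [Real.sin_three_mul, hsin]
    have := Real.sq_sqrt (show 0 ≤ 1 - z ^ 2 by nlinarith [hz1.1, hz1.2])
    linear_combination -4 * √(1 - z ^ 2) * this
  have hk : ∀ B₀ B₁ B₂ : ℝ, ∀ d : ℂ, ((B₀ : ℂ) * (-(2 * Complex.I * (Real.sin (3 * α) : ℝ)) / 3) +
      B₁ * (-(2 * Complex.I * (Real.sin (2 * α) : ℝ)) / 2) +
      B₂ * (-(2 * Complex.I * (Real.sin α : ℝ)) / 1) + d * 0).im =
      -(2 / 3 * B₀ * Real.sin (3 * α) + B₁ * Real.sin (2 * α) + 2 * B₂ * Real.sin α) :=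
    fun B₀ B₁ B₂ d => by
      rw [show (B₀ : ℂ) * (-(2 * Complex.I * (Real.sin (3 * α) : ℝ)) / 3) +
        B₁ * (-(2 * Complex.I * (Real.sin (2 * α) : ℝ)) / 2) +
        B₂ * (-(2 * Complex.I * (Real.sin α : ℝ)) / 1) + d * 0 =
        ((-(2 / 3 * B₀ * Real.sin (3 * α) + B₁ * Real.sin (2 * α) + 2 * B₂ * Real.sin α) : ℝ) : ℂ) *
          Complex.I by push_cast; ring, Complex.im_ofReal_mul, Complex.I_im, mul_one]
  have hsum : (∑ i ∈ Finset.range (3 + 1), b i *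
      (-(2 * Complex.I * (Real.sin ((3 - i : ℕ) * α) : ℝ)) / (3 - i : ℕ))) =
      b 0 * (-(2 * Complex.I * (Real.sin (3 * α) : ℝ)) / 3) +
      b 1 * (-(2 * Complex.I * (Real.sin (2 * α) : ℝ)) / 2) +
      b 2 * (-(2 * Complex.I * (Real.sin α : ℝ)) / 1) + b 3 * 0 := by
    simp [Finset.sum_range_succ]
  rw [hsum, b0, b1, b2, hk, hsin, hsin2, hsin3]
  ring

/-- On the circle (ζ^(2n) - 1)/(2i) equals ζⁿ sin(nβ). After division by ζⁿ the boundary value is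
real, so the band constants are 0, and the relevant Taylor coefficient has index 3 + n. -/
theorem integral_mul_spectralDensity_of_sin {p : Fin 5 → ℝ} {a₁ a₂ a₃ a₄ : ℝ}
    (h₁ : -1 ≤ a₁) (h₁₂ : a₁ < a₂) (h₂₃ : a₂ < a₃) (h₃₄ : a₃ < a₄) (h₄ : a₄ ≤ 1)
    (hp : BandNull p a₁ a₂ a₃ a₄) {b : ℕ → ℂ} (hb : HasTaylorSix (spectralFun p (Real.arccos a₁)
      (Real.arccos a₂) (Real.arccos a₃) (Real.arccos a₄)) b) {n : ℕ} (hn : n < 3) {f : ℝ → ℝ}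
    (hf : Continuous f) (hfn : ∀ β ∈ Set.Ioo 0 Real.pi, f (Real.cos β) = Real.sin (n * β))
    {c : ℕ → ℂ} (hc : HasTaylorSix (fun ζ => (ζ ^ (2 * n) - 1) / (2 * Complex.I)) c) :
    ∫ w in genusOneSupport a₁ a₂ a₃ a₄, f w * spectralDensity p a₁ a₂ a₃ a₄ w =
      (∑ i ∈ Finset.range (3 + n + 1), b i * c (3 + n - i)).im := by
  obtain ⟨B, hB⟩ := (isCompact_Icc (a := (-1 : ℝ)) (b := 1)).exists_bound_of_continuousOn
    hf.continuousOn
  have hB0 : 0 ≤ B := (norm_nonneg _).trans (hB 0 (by simp))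
  have hdiff : Differentiable ℂ fun ζ : ℂ => (ζ ^ (2 * n) - 1) / (2 * Complex.I) := by fun_prop
  have key := integral_mul_spectralDensity h₁ h₁₂ h₂₃ h₃₄ h₄ hp (g := fun w => (f w : ℂ))
    (Complex.measurable_ofReal.comp hf.measurable) (z := 0) (B := B) (fun w hw => by
      have h1 : 0 ≤ |w - 0| ^ (-(1 / 8) : ℝ) := by positivity
      have h2 := hB w hw
      rw [Real.norm_eq_abs] at h2
      rw [Complex.ofReal_re]
      nlinarith)
    (l := 0) (r := 0) (fun w _ => Complex.ofReal_im _) (fun w _ => Complex.ofReal_im _)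
    (G := fun ζ => (ζ ^ (2 * n) - 1) / (2 * Complex.I)) (α := 0) (C := 1) (k := 3 + n)
    hdiff.differentiableOn (fun ζ _ => by
      simp only [map_div₀, map_sub, map_pow, map_one, map_mul, Complex.conj_I, Complex.conj_ofNat]
      rw [mul_neg, div_neg, neg_neg])
    (fun r hr β _ _ => by
      have h1 : 0 ≤ |β - 0| ^ (-(1 / 8) : ℝ) := by positivity
      have h2 := norm_mul_exp_lt_one hr β
      have h3 : ‖((r : ℂ) * Complex.exp (β * Complex.I)) ^ (2 * n) - 1‖ ≤ 2 := by
        refine (norm_sub_le _ _).trans ?_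
        rw [norm_pow, norm_one]
        have := pow_le_one₀ (n := 2 * n) (norm_nonneg _) h2.le
        linarith
      rw [norm_div, norm_mul, Complex.norm_I, mul_one, Complex.norm_ofNat]
      linarith)
    (fun β _ _ => hdiff.continuous.continuousAt) (fun β hβ _ => by
      rw [hfn β hβ, pow_add, mul_div_mul_left _ _ (pow_ne_zero _ (Complex.exp_ne_zero _)),
        Complex.ofReal_sin, Complex.sin, pow_mul', ← Complex.exp_nat_mul]
      push_cast
      have h1 : Complex.exp (-((n : ℂ) * β) * Complex.I) * Complex.exp (n * (β * Complex.I)) = 1 := by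
        rw [← Complex.exp_add]; ring_nf; simp
      have h2 : Complex.exp ((n : ℂ) * β * Complex.I) = Complex.exp (n * (β * Complex.I)) := by
        ring_nf
      rw [h2, div_div, div_eq_iff (by simp [Complex.exp_ne_zero])]
      linear_combination (Complex.exp (n * (β * Complex.I)) ^ 2 - Complex.exp (-((n : ℂ) * β) *
        Complex.I) * Complex.exp (n * (β * Complex.I))) * Complex.I_sq + h1)
    (hb.mul hc) (by omega)
  simpa using key

theorem integral_sqrt_mul_spectralDensity {p : Fin 5 → ℝ} {e₁ e₂ e₃ e₄ a₁ a₂ a₃ a₄ : ℝ}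
    (h₁ : -1 ≤ a₁) (h₁₂ : a₁ < a₂) (h₂₃ : a₂ < a₃) (h₃₄ : a₃ < a₄) (h₄ : a₄ ≤ 1)
    (he : IsElementarySymmetric e₁ e₂ e₃ e₄ a₁ a₂ a₃ a₄) (hp : BandNull p a₁ a₂ a₃ a₄) :
    ∫ w in genusOneSupport a₁ a₂ a₃ a₄, √(1 - w ^ 2) * spectralDensity p a₁ a₂ a₃ a₄ w =
      (((-2 * p 4 - 4 * p 2 - 16 * p 0) / 8 + (-4 * p 3 - 8 * p 1) / 8 * e₁ +
        (-3 * p 4 - 4 * p 2) / 8 * (-2 - 2 * e₂ + 3 / 2 * e₁ ^ 2) -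
        p 3 / 4 * (-3 * e₁ + 4 * e₃ - 6 * e₁ * e₂ + 5 / 2 * e₁ ^ 3) -
        p 4 / 8 * (3 + 8 * e₂ - 6 * e₁ ^ 2 - 8 * e₄ + 6 * e₂ ^ 2 + 12 * e₁ * e₃ -
          15 * e₁ ^ 2 * e₂ + 35 / 8 * e₁ ^ 4)) - ((-3 * p 4 - 4 * p 2) / 8 - p 3 / 4 * e₁ -
        p 4 / 8 * (-2 - 2 * e₂ + 3 / 2 * e₁ ^ 2))) / 2 := by
  obtain ⟨b, hb, -, -, b2, b4, -⟩ := exists_hasTaylorSix_spectralFun p h₁ h₁₂ h₂₃ h₃₄ h₄ he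
  have hc : HasTaylorSix (fun ζ => (ζ ^ (2 * 1) - 1) / (2 * Complex.I))
      (fun k => if k = 0 then Complex.I / 2 else if k = 2 then -Complex.I / 2 else 0) :=
    ⟨fun _ => 0, by fun_prop, fun ζ _ => by
      beta_reduce
      rw [mul_comm 2 Complex.I, ← div_div, Complex.div_I]
      simp [Finset.sum_range_succ]
      ring⟩
  rw [integral_mul_spectralDensity_of_sin h₁ h₁₂ h₂₃ h₃₄ h₄ hp hb (n := 1) (by norm_num) (by fun_prop)
    (fun β hβ => by
      rw [← Real.sin_sq, Real.sqrt_sq (Real.sin_nonneg_of_nonneg_of_le_pi hβ.1.le hβ.2.le)]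
      simp) hc]
  have hsum : ∑ i ∈ Finset.range (3 + 1 + 1), b i * (if 3 + 1 - i = 0 then Complex.I / 2 else
      if 3 + 1 - i = 2 then -Complex.I / 2 else 0) = (b 4 - b 2) / 2 * Complex.I := by
    simp [Finset.sum_range_succ]
    ring
  rw [hsum, b2, b4, ← Complex.ofReal_sub, ← Complex.ofReal_ofNat, ← Complex.ofReal_div,
    Complex.im_ofReal_mul, Complex.I_im, mul_one]

theorem integral_mul_sqrt_mul_spectralDensity {p : Fin 5 → ℝ} {e₁ e₂ e₃ e₄ a₁ a₂ a₃ a₄ : ℝ}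
    (h₁ : -1 ≤ a₁) (h₁₂ : a₁ < a₂) (h₂₃ : a₂ < a₃) (h₃₄ : a₃ < a₄) (h₄ : a₄ ≤ 1)
    (he : IsElementarySymmetric e₁ e₂ e₃ e₄ a₁ a₂ a₃ a₄) (hp : BandNull p a₁ a₂ a₃ a₄)
    (hp4 : p 4 = 0) :
    ∫ w in genusOneSupport a₁ a₂ a₃ a₄, 2 * w * √(1 - w ^ 2) * spectralDensity p a₁ a₂ a₃ a₄ w =
      (((-4 * p 2 - 16 * p 0) / 8 * e₁ +
        (-4 * p 3 - 8 * p 1) / 8 * (-2 - 2 * e₂ + 3 / 2 * e₁ ^ 2) -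
        p 2 / 2 * (-3 * e₁ + 4 * e₃ - 6 * e₁ * e₂ + 5 / 2 * e₁ ^ 3) -
        p 3 / 4 * (3 + 8 * e₂ - 6 * e₁ ^ 2 - 8 * e₄ + 6 * e₂ ^ 2 + 12 * e₁ * e₃ -
          15 * e₁ ^ 2 * e₂ + 35 / 8 * e₁ ^ 4)) - (-p 3 / 4 - p 4 * e₁ / 8)) / 2 := by
  obtain ⟨b, hb, -, b1, -, -, b5⟩ := exists_hasTaylorSix_spectralFun p h₁ h₁₂ h₂₃ h₃₄ h₄ he
  have hc : HasTaylorSix (fun ζ => (ζ ^ (2 * 2) - 1) / (2 * Complex.I))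
      (fun k => if k = 0 then Complex.I / 2 else if k = 4 then -Complex.I / 2 else 0) :=
    ⟨fun _ => 0, by fun_prop, fun ζ _ => by
      beta_reduce
      rw [mul_comm 2 Complex.I, ← div_div, Complex.div_I]
      simp [Finset.sum_range_succ]
      ring⟩
  rw [integral_mul_spectralDensity_of_sin h₁ h₁₂ h₂₃ h₃₄ h₄ hp hb (n := 2) (by norm_num) (by fun_prop)
    (fun β hβ => by
      rw [← Real.sin_sq, Real.sqrt_sq (Real.sin_nonneg_of_nonneg_of_le_pi hβ.1.le hβ.2.le),
        Nat.cast_ofNat, Real.sin_two_mul]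
      ring) hc]
  have hsum : ∑ i ∈ Finset.range (3 + 2 + 1), b i * (if 3 + 2 - i = 0 then Complex.I / 2 else
      if 3 + 2 - i = 4 then -Complex.I / 2 else 0) = (b 5 - b 1) / 2 * Complex.I := by
    simp [Finset.sum_range_succ]
    ring
  rw [hsum, b1, b5 hp4, ← Complex.ofReal_sub, ← Complex.ofReal_ofNat, ← Complex.ofReal_div,
    Complex.im_ofReal_mul, Complex.I_im, mul_one]

end DefNLS

namespace DefNLS

/-! ### Reciprocity for the kernel -/

theorem exists_setIntegral_abs_sub_rpow_le : ∃ M : ℝ, ∀ z ∈ Set.Icc (-1 : ℝ) 1,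
    ∫ w in Set.Icc (-1 : ℝ) 1, |w - z| ^ (-(1 / 2) : ℝ) ≤ M := by
  refine ⟨∫ x in (-2 : ℝ)..2, |x| ^ (-(1 / 2) : ℝ), fun z hz => ?_⟩
  rw [integral_Icc_eq_integral_Ioc, ← intervalIntegral.integral_of_le (by norm_num),
    intervalIntegral.integral_comp_sub_right (fun x => |x| ^ (-(1 / 2) : ℝ)) z]
  refine intervalIntegral.integral_mono_interval (by linarith [hz.2]) (by linarith)
    (by linarith [hz.1]) (Filter.Eventually.of_forall fun x => by positivity) ?_
  rw [intervalIntegrable_iff_integrableOn_Icc_of_le (by norm_num)]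
  simpa using integrableOn_abs_sub_rpow (s := -(1 / 2)) (by norm_num) 0 (-2) 2

theorem integrable_mul_abs_sub_rpow {Γ : Set ℝ} (hΓ : Γ ⊆ Set.Icc (-1) 1) (hm : MeasurableSet Γ)
    {d : ℝ → ℝ} (hd : IntegrableOn d Γ) :
    Integrable (fun q : ℝ × ℝ => d q.1 * |q.2 - q.1| ^ (-(1 / 2) : ℝ))
      ((volume.restrict Γ).prod (volume.restrict Γ)) := by
  obtain ⟨M, hM⟩ := exists_setIntegral_abs_sub_rpow_le
  have hmeas : AEStronglyMeasurable (fun q : ℝ × ℝ => d q.1 * |q.2 - q.1| ^ (-(1 / 2) : ℝ))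
      ((volume.restrict Γ).prod (volume.restrict Γ)) := by
    refine (hd.aestronglyMeasurable.comp_fst).mul (Measurable.aestronglyMeasurable ?_)
    have h : Measurable fun x : ℝ => |x| := measurable_norm
    fun_prop
  have hint : ∀ z : ℝ, IntegrableOn (fun w : ℝ => |w - z| ^ (-(1 / 2) : ℝ)) (Set.Icc (-1) 1) := fun z =>
    integrableOn_abs_sub_rpow (by norm_num) z (-1) 1
  refine (integrable_prod_iff hmeas).2 ⟨Filter.Eventually.of_forall fun z => ?_, ?_⟩
  · exact ((hint z).mono_set hΓ).const_mul (d z)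
  · refine Integrable.mono' (hd.norm.mul_const M) hmeas.norm.integral_prod_right' ?_
    filter_upwards [ae_restrict_mem hm] with z hz
    simp only [norm_mul]
    rw [integral_const_mul, norm_mul, norm_norm]
    refine mul_le_mul_of_nonneg_left ?_ (norm_nonneg _)
    have h1 : ∀ w : ℝ, ‖|w - z| ^ (-(1 / 2) : ℝ)‖ = |w - z| ^ (-(1 / 2) : ℝ) := fun w =>
      Real.norm_of_nonneg (by positivity)
    simp only [h1]
    rw [Real.norm_of_nonneg (integral_nonneg fun w => by positivity)]
    exact (setIntegral_mono_set (hint z) (Filter.Eventually.of_forall fun w => by positivity)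
      (Filter.Eventually.of_forall hΓ)).trans (hM z (hΓ hz))

/-- Young's inequality bounds K|u| by K^q + |u|^p with q conjugate to p. The choice ε = 1/(2q) makes
K^q at most a constant times |w - z|^(-1/2), whose integral in w is bounded uniformly in z; hence d
∈ L¹ is enough. -/
theorem integrable_mul_ndrKernel_mul {Γ : Set ℝ} (hΓ : Γ ⊆ Set.Icc (-1) 1) (hm : MeasurableSet Γ)
    {d u : ℝ → ℝ} (hd : IntegrableOn d Γ)
    (hu : ∃ p : ℝ≥0∞, 1 < p ∧ MemLp u p (volume.restrict Γ)) :
    Integrable (fun q : ℝ × ℝ => d q.1 * (ndrKernel q.1 q.2 * u q.2))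
      ((volume.restrict Γ).prod (volume.restrict Γ)) := by
  obtain ⟨p', hp', hup'⟩ := hu
  have : IsFiniteMeasure (volume.restrict Γ) :=
    ⟨by simpa using (measure_mono hΓ).trans_lt measure_Icc_lt_top⟩
  -- Lowering the exponent to at most 2 covers p = ∞; on a set of finite measure this loses nothing.
  have hp1 : 1 < min p' 2 := lt_min hp' (by norm_num)
  have hptop : min p' 2 ≠ ∞ := ((min_le_right _ _).trans_lt (by norm_num)).ne
  have hup : MemLp u (min p' 2) (volume.restrict Γ) := hup'.mono_exponent (min_le_left _ _)
  have hpint := hup.integrable_norm_rpow (by positivity) hptop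
  set p := (min p' 2).toReal with hp
  have hp2 : 1 < p := by
    rw [hp, ← ENNReal.toReal_one]
    exact (ENNReal.toReal_lt_toReal (by norm_num) hptop).2 hp1
  have hconj : p.HolderConjugate p.conjExponent := Real.HolderConjugate.conjExponent hp2
  set q := p.conjExponent
  have hq : 0 < q := hconj.symm.pos
  set B : ℝ := 2 ^ (1 / (2 * q)) / (1 / (2 * q)) with hB
  have hB0 : 0 ≤ B := by positivity
  have h1 := (integrable_mul_abs_sub_rpow hΓ hm hd).norm.mul_const (B ^ q)
  have h2 := hd.norm.mul_prod hpint
  refine Integrable.mono' (h1.add h2) ?_ ?_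
  · exact hd.aestronglyMeasurable.comp_fst.mul
      (measurable_ndrKernel.aestronglyMeasurable.mul hup.aestronglyMeasurable.comp_snd)
  · rw [Measure.prod_restrict]
    filter_upwards [ae_restrict_mem (hm.prod hm)] with x hx
    have hK0 := ndrKernel_nonneg (hΓ hx.1) (hΓ hx.2)
    have hK := ndrKernel_le (hΓ hx.1) (hΓ hx.2) (ε := 1 / (2 * q)) (by positivity)
    have hKq : ndrKernel x.1 x.2 ^ q ≤ B ^ q * |x.2 - x.1| ^ (-(1 / 2) : ℝ) := by
      refine (Real.rpow_le_rpow hK0 hK hq.le).trans (le_of_eq ?_)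
      rw [Real.mul_rpow hB0 (by positivity), ← Real.rpow_mul (abs_nonneg _)]
      congr 2
      field_simp
    have hy := Real.young_inequality_of_nonneg hK0 (norm_nonneg (u x.2)) hconj.symm
    have e1 : ndrKernel x.1 x.2 ^ q / q ≤ ndrKernel x.1 x.2 ^ q :=
      div_le_self (by positivity) hconj.symm.lt.le
    have e2 : ‖u x.2‖ ^ p / p ≤ ‖u x.2‖ ^ p := div_le_self (by positivity) hp2.le
    have h3 : ‖|x.2 - x.1| ^ (-(1 / 2) : ℝ)‖ = |x.2 - x.1| ^ (-(1 / 2) : ℝ) :=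
      Real.norm_of_nonneg (by positivity)
    simp only [Pi.add_apply, norm_mul, h3, Real.norm_of_nonneg hK0]
    calc _ ≤ ‖d x.1‖ * (B ^ q * |x.2 - x.1| ^ (-(1 / 2) : ℝ) + ‖u x.2‖ ^ p) := by
          gcongr
          linarith
      _ = _ := by ring

/-- Symmetry of the kernel and Fubini. Applied with an explicit density d, it evaluates moments of
an arbitrary solution u without a uniqueness theorem. -/
theorem setIntegral_mul_comm_of_ndr {Γ : Set ℝ} (hΓ : Γ ⊆ Set.Icc (-1) 1) (hm : MeasurableSet Γ)
    {d u f g : ℝ → ℝ} (hd : IntegrableOn d Γ)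
    (hu : ∃ p : ℝ≥0∞, 1 < p ∧ MemLp u p (volume.restrict Γ))
    (hdg : ∀ z ∈ Γ, ∫ w in Γ, ndrKernel z w * d w = g z)
    (huf : ∀ z ∈ Γ, ∫ w in Γ, ndrKernel z w * u w = f z) :
    ∫ w in Γ, u w * g w = ∫ z in Γ, d z * f z := by
  have h1 : ∫ z in Γ, d z * f z = ∫ z in Γ, ∫ w in Γ, d z * (ndrKernel z w * u w) :=
    setIntegral_congr_fun hm fun z hz => by simp only [← huf z hz, integral_const_mul]
  have h2 : ∫ w in Γ, u w * g w = ∫ w in Γ, ∫ z in Γ, d z * (ndrKernel z w * u w) :=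
    setIntegral_congr_fun hm fun w hw => by
      simp only [← hdg w hw, ← integral_const_mul]
      refine integral_congr_ae (Filter.Eventually.of_forall fun z => ?_)
      simp only [ndrKernel_comm w z]
      ring
  rw [h1, h2]
  exact (integral_integral_swap (f := fun z w => d z * (ndrKernel z w * u w))
    (integrable_mul_ndrKernel_mul hΓ hm hd hu)).symm

/-! ### L^p membership of the explicit densities -/

/-- With exponent 3/2 the singularity |x - t|^(-1/2) becomes |x - t|^(-3/4), still integrable. -/
theorem memLp_rootWeight (t : ℝ) :
    MemLp (rootWeight t) (3 / 2) (volume.restrict (Set.Icc (-1) 1)) := by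
  have h1 : MemLp (fun x => |x - t| ^ (-(1 / 2) : ℝ)) (3 / 2)
      (volume.restrict (Set.Icc (-1) 1)) := by
    have hm : Measurable fun x : ℝ => |x - t| ^ (-(1 / 2) : ℝ) := by
      have h : Measurable fun x : ℝ => |x| := measurable_norm
      fun_prop
    have hne : (3 / 2 : ℝ≥0∞) ≠ 0 := by simp
    have hnt : (3 / 2 : ℝ≥0∞) ≠ ∞ := ENNReal.div_ne_top (by simp) (by simp)
    refine (integrable_norm_rpow_iff hm.aestronglyMeasurable hne hnt).1 ?_
    refine (integrableOn_abs_sub_rpow (s := -(3 / 4)) (by norm_num) t (-1) 1).congr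
      (Filter.Eventually.of_forall fun x => ?_)
    simp only [Real.norm_of_nonneg (Real.rpow_nonneg (abs_nonneg (x - t)) _)]
    rw [← Real.rpow_mul (abs_nonneg _)]
    congr 1
    rw [ENNReal.toReal_div]
    norm_num
  have h2 : MemLp (fun _ : ℝ => (1 : ℝ)) (3 / 2) (volume.restrict (Set.Icc (-1) 1)) :=
    memLp_const 1
  exact h2.add h1

theorem memLp_spectralDensity (p : Fin 5 → ℝ) {a₁ a₂ a₃ a₄ : ℝ}
    (h₁ : -1 ≤ a₁) (h₁₂ : a₁ < a₂) (h₂₃ : a₂ < a₃) (h₃₄ : a₃ < a₄) (h₄ : a₄ ≤ 1) :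
    MemLp (spectralDensity p a₁ a₂ a₃ a₄) (3 / 2)
      (volume.restrict (genusOneSupport a₁ a₂ a₃ a₄)) := by
  obtain ⟨B, hB, h⟩ := exists_abs_quartic_div_le p a₁ a₂ a₃ a₄
  obtain ⟨M, hM, h'⟩ := exists_rootWeight_prod_le h₁₂.ne (h₁₂.trans h₂₃).ne
    ((h₁₂.trans h₂₃).trans h₃₄).ne h₂₃.ne (h₂₃.trans h₃₄).ne h₃₄.ne
  have hsum : MemLp (fun w => B * M * (rootWeight a₁ w + rootWeight a₂ w + rootWeight a₃ w +
      rootWeight a₄ w)) (3 / 2) (volume.restrict (Set.Icc (-1) 1)) :=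
    ((((memLp_rootWeight a₁).add (memLp_rootWeight a₂)).add (memLp_rootWeight a₃)).add
      (memLp_rootWeight a₄)).const_mul (B * M)
  refine (MemLp.mono' hsum (measurable_spectralDensity p a₁ a₂ a₃ a₄).aestronglyMeasurable
    ?_).mono_measure (Measure.restrict_mono (genusOneSupport_subset h₁ h₁₂ h₂₃ h₃₄ h₄) le_rfl)
  filter_upwards [ae_restrict_mem measurableSet_Icc] with w hw
  have h3 : |(if a₂ ≤ w ∧ w ≤ a₃ then (-1 : ℝ) else 1)| = 1 := by split_ifs <;> simp
  rw [spectralDensity, Real.norm_eq_abs, abs_div, abs_mul, h3, one_mul,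
    abs_of_pos Real.pi_pos]
  calc _ ≤ |quartic p w / sqrtAbsProd a₁ a₂ a₃ a₄ w| :=
        div_le_self (abs_nonneg _) (by linarith [Real.pi_gt_three])
    _ ≤ _ := h w hw
    _ ≤ B * (M * (rootWeight a₁ w + rootWeight a₂ w + rootWeight a₃ w + rootWeight a₄ w)) :=
        mul_le_mul_of_nonneg_left (h' w) hB
    _ = _ := by ring

theorem one_lt_three_halves : (1 : ℝ≥0∞) < 3 / 2 := by
  rw [ENNReal.lt_div_iff_mul_lt (by simp) (by simp)]
  norm_num

end DefNLS

namespace DefNLS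

/-! ### Band integrals -/

theorem BandNull.add_mul {p q r : Fin 5 → ℝ} {a₁ a₂ a₃ a₄ : ℝ} (h₁ : -1 ≤ a₁) (h₁₂ : a₁ < a₂)
    (h₂₃ : a₂ < a₃) (h₃₄ : a₃ < a₄) (h₄ : a₄ ≤ 1) (hp : BandNull p a₁ a₂ a₃ a₄)
    (hq : BandNull q a₁ a₂ a₃ a₄) (x : ℝ)
    (hr : ∀ w, quartic r w = quartic p w + x * quartic q w) : BandNull r a₁ a₂ a₃ a₄ := by
  have ip := integrableOn_quartic_div p h₁₂ h₂₃ h₃₄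
  have iq := integrableOn_quartic_div q h₁₂ h₂₃ h₃₄
  have h : ∀ w, quartic r w / sqrtAbsProd a₁ a₂ a₃ a₄ w =
      quartic p w / sqrtAbsProd a₁ a₂ a₃ a₄ w + x * (quartic q w / sqrtAbsProd a₁ a₂ a₃ a₄ w) :=
    fun w => by rw [hr w]; ring
  have s1 : Set.Ioo a₁ a₂ ⊆ Set.Icc (-1) 1 := fun w hw =>
    ⟨by linarith [hw.1], by linarith [hw.2]⟩
  have s2 : Set.Ioo a₃ a₄ ⊆ Set.Icc (-1) 1 := fun w hw =>
    ⟨by linarith [hw.1], by linarith [hw.2]⟩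
  constructor
  · simp only [h]
    rw [integral_add (ip.mono_set s1) ((iq.mono_set s1).const_mul x), integral_const_mul, hp.left,
      hq.left]
    simp
  · simp only [h]
    rw [integral_add (ip.mono_set s2) ((iq.mono_set s2).const_mul x), integral_const_mul, hp.right,
      hq.right]
    simp

theorem sqrtAbsProd_eq {a₁ a₂ a₃ a₄ w : ℝ} (h : (w - a₁) * (w - a₂) * (w - a₃) * (w - a₄) ≤ 0) :
    sqrtAbsProd a₁ a₂ a₃ a₄ w = √(-((w - a₁) * (w - a₂) * (w - a₃) * (w - a₄))) := by
  rw [sqrtAbsProd, ← abs_mul, ← abs_mul, ← abs_mul, abs_of_nonpos h]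

/-- With R = ∏(w - aⱼ), the integrand is the derivative of -2(α + βw)√(-R), which vanishes at both
ends of a band. -/
theorem setIntegral_band_of_deriv {p : Fin 5 → ℝ} {a₁ a₂ a₃ a₄ a b : ℝ} (hab : a < b) (α β : ℝ)
    (hint : IntegrableOn (fun w => quartic p w / sqrtAbsProd a₁ a₂ a₃ a₄ w) (Set.Icc a b))
    (hneg : ∀ w ∈ Set.Ioo a b, (w - a₁) * (w - a₂) * (w - a₃) * (w - a₄) < 0)
    (ha : (a - a₁) * (a - a₂) * (a - a₃) * (a - a₄) = 0)
    (hb : (b - a₁) * (b - a₂) * (b - a₃) * (b - a₄) = 0)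
    (hp : ∀ w, quartic p w = 2 * β * ((w - a₁) * (w - a₂) * (w - a₃) * (w - a₄)) +
      (α + β * w) * ((w - a₂) * (w - a₃) * (w - a₄) + (w - a₁) * (w - a₃) * (w - a₄) +
        (w - a₁) * (w - a₂) * (w - a₄) + (w - a₁) * (w - a₂) * (w - a₃))) :
    ∫ w in Set.Ioo a b, quartic p w / sqrtAbsProd a₁ a₂ a₃ a₄ w = 0 := by
  rw [← integral_Ioc_eq_integral_Ioo, ← intervalIntegral.integral_of_le hab.le]
  rw [intervalIntegral.integral_eq_sub_of_hasDerivAt_of_le hab.le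
    (f := fun w => -2 * (α + β * w) * √(-((w - a₁) * (w - a₂) * (w - a₃) * (w - a₄))))
    (Continuous.continuousOn (by fun_prop)) (fun w hw => ?_)
    ((intervalIntegrable_iff_integrableOn_Icc_of_le hab.le).2 hint)]
  · simp [ha, hb]
  · have hn := hneg w hw
    rw [sqrtAbsProd_eq hn.le]
    have hd : HasDerivAt (fun w => -((w - a₁) * (w - a₂) * (w - a₃) * (w - a₄)))
        (-((w - a₂) * (w - a₃) * (w - a₄) + (w - a₁) * (w - a₃) * (w - a₄) +
        (w - a₁) * (w - a₂) * (w - a₄) + (w - a₁) * (w - a₂) * (w - a₃))) w := by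
      have d : ∀ a : ℝ, HasDerivAt (fun w => w - a) 1 w := fun a => (hasDerivAt_id w).sub_const a
      refine ((((d a₁).mul (d a₂)).mul (d a₃)).mul (d a₄)).neg.congr_deriv ?_
      simp only [Pi.mul_apply]
      ring
    have hl : HasDerivAt (fun w => -2 * (α + β * w)) (-2 * β) w := by
      refine ((((hasDerivAt_id w).const_mul β).const_add α).const_mul (-2)).congr_deriv ?_
      ring
    refine (hl.mul (hd.sqrt (by linarith))).congr_deriv ?_
    rw [hp w]
    have hpos : 0 < √(-((w - a₁) * (w - a₂) * (w - a₃) * (w - a₄))) := Real.sqrt_pos.2 (by linarith)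
    have hsq := Real.sq_sqrt (show 0 ≤ -((w - a₁) * (w - a₂) * (w - a₃) * (w - a₄)) by linarith)
    field_simp
    linear_combination -2 * β * hsq

theorem bandNull_of_deriv {p : Fin 5 → ℝ} {a₁ a₂ a₃ a₄ : ℝ} (h₁ : -1 ≤ a₁) (h₁₂ : a₁ < a₂)
    (h₂₃ : a₂ < a₃) (h₃₄ : a₃ < a₄) (h₄ : a₄ ≤ 1) (α β : ℝ)
    (hp : ∀ w, quartic p w = 2 * β * ((w - a₁) * (w - a₂) * (w - a₃) * (w - a₄)) +
      (α + β * w) * ((w - a₂) * (w - a₃) * (w - a₄) + (w - a₁) * (w - a₃) * (w - a₄) +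
        (w - a₁) * (w - a₂) * (w - a₄) + (w - a₁) * (w - a₂) * (w - a₃))) :
    BandNull p a₁ a₂ a₃ a₄ := by
  have ip := integrableOn_quartic_div p h₁₂ h₂₃ h₃₄
  constructor
  · refine setIntegral_band_of_deriv h₁₂ α β (ip.mono_set (Set.Icc_subset_Icc h₁ (by linarith)))
      (fun w hw => ?_) (by ring) (by ring) hp
    have := mul_pos (mul_pos (sub_pos.2 hw.1) (sub_pos.2 hw.2)) (mul_pos
      (show 0 < a₃ - w by linarith [hw.2]) (show 0 < a₄ - w by linarith [hw.2]))
    linarith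
  · refine setIntegral_band_of_deriv h₃₄ α β (ip.mono_set (Set.Icc_subset_Icc (by linarith) h₄))
      (fun w hw => ?_) (by ring) (by ring) hp
    have := mul_pos (mul_pos (sub_pos.2 hw.1) (sub_pos.2 hw.2)) (mul_pos
      (show 0 < w - a₁ by linarith [hw.1]) (show 0 < w - a₂ by linarith [hw.1]))
    linarith

/-! ### Elliptic moments -/

/-- The moments `∫ sin²ⁿ θ / √(1 - m sin² θ) dθ` over a quarter period. -/
noncomputable def ellipticMoment (m : ℝ) (n : ℕ) : ℝ :=
  ∫ θ in (0 : ℝ)..Real.pi / 2, Real.sin θ ^ (2 * n) / √(1 - m * Real.sin θ ^ 2)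

theorem one_sub_mul_sin_sq_pos {m : ℝ} (hm : m < 1) (θ : ℝ) :
    0 < 1 - m * Real.sin θ ^ 2 := by
  have h1 := Real.sin_sq_le_one θ
  have h2 := sq_nonneg (Real.sin θ)
  rcases le_or_gt m 0 with h | h <;> nlinarith

theorem continuous_comp_sin_div {m : ℝ} (hm : m < 1) {f : ℝ → ℝ} (hf : Continuous f) :
    Continuous fun θ => f θ / √(1 - m * Real.sin θ ^ 2) :=
  hf.div (by fun_prop) fun θ => (Real.sqrt_pos.2 (one_sub_mul_sin_sq_pos hm θ)).ne'

theorem ellipticMoment_pos {m : ℝ} (hm : m < 1) (n : ℕ) : 0 < ellipticMoment m n := by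
  unfold ellipticMoment
  refine intervalIntegral.intervalIntegral_pos_of_pos_on
    ((continuous_comp_sin_div hm (by fun_prop)).intervalIntegrable _ _) (fun θ hθ => ?_)
    (by linarith [Real.pi_pos])
  have := Real.sqrt_pos.2 (one_sub_mul_sin_sq_pos hm θ)
  have := Real.sin_pos_of_pos_of_lt_pi hθ.1 (by linarith [hθ.2, Real.pi_pos])
  positivity

end DefNLS
namespace DefNLS

/-! ### The quadratic with vanishing band integrals -/

/-- The rational substitution `w = (a₁ A + a₄ B s) / (A + B s)`, `A = a₄ - a₂`, `B = a₂ - a₁`, of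
the left band. -/
noncomputable def bandPoint (a₁ a₂ a₄ s : ℝ) : ℝ :=
  (a₁ * (a₄ - a₂) + a₄ * (a₂ - a₁) * s) / (a₄ - a₂ + (a₂ - a₁) * s)

theorem bandPoint_prod {a₁ a₂ a₃ a₄ m s : ℝ} (hD : a₄ - a₂ + (a₂ - a₁) * s ≠ 0)
    (hm : m * ((a₄ - a₂) * (a₃ - a₁)) = (a₄ - a₃) * (a₂ - a₁)) :
    -((bandPoint a₁ a₂ a₄ s - a₁) * (bandPoint a₁ a₂ a₄ s - a₂) * (bandPoint a₁ a₂ a₄ s - a₃) *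
        (bandPoint a₁ a₂ a₄ s - a₄)) =
      (a₄ - a₁) ^ 2 * (a₄ - a₂) ^ 3 * (a₂ - a₁) ^ 2 * (a₃ - a₁) * s * (1 - s) * (1 - m * s) /
        (a₄ - a₂ + (a₂ - a₁) * s) ^ 4 := by
  have e1 : bandPoint a₁ a₂ a₄ s - a₁ = (a₄ - a₁) * (a₂ - a₁) * s / (a₄ - a₂ + (a₂ - a₁) * s) := by
    unfold bandPoint; field_simp; ring
  have e2 : bandPoint a₁ a₂ a₄ s - a₂ =
      -((a₄ - a₂) * (a₂ - a₁) * (1 - s) / (a₄ - a₂ + (a₂ - a₁) * s)) := by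
    unfold bandPoint; field_simp; ring
  have e4 : bandPoint a₁ a₂ a₄ s - a₄ = -((a₄ - a₁) * (a₄ - a₂) / (a₄ - a₂ + (a₂ - a₁) * s)) := by
    unfold bandPoint; field_simp; ring
  have e3 : bandPoint a₁ a₂ a₄ s - a₃ =
      -((a₄ - a₂) * (a₃ - a₁) * (1 - m * s) / (a₄ - a₂ + (a₂ - a₁) * s)) := by
    unfold bandPoint; field_simp; linear_combination -s * hm
  rw [e1, e2, e3, e4]
  field_simp

/-- In the variable s = sin²φ the quadratic is a constant, plus a multiple of s, plus a term which
on division by √(1 - ms) becomes an exact derivative. So its band integral needs only the moments of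
order 0 and 1, with no integral of the third kind. -/
theorem bandPoint_quadratic {a₁ a₂ a₃ a₄ m s : ℝ} (hD : a₄ - a₂ + (a₂ - a₁) * s ≠ 0)
    (hm : m * ((a₄ - a₂) * (a₃ - a₁)) = (a₄ - a₃) * (a₂ - a₁)) :
    bandPoint a₁ a₂ a₄ s ^ 2 - (a₁ + a₂ + a₃ + a₄) / 2 * bandPoint a₁ a₂ a₄ s =
      -((a₁ - a₂ - a₃ + a₄) ^ 2 / 8 - (a₁ + a₂ + a₃ + a₄) ^ 2 / 8 +
        (a₁ * a₂ + a₁ * a₃ + a₁ * a₄ + a₂ * a₃ + a₂ * a₄ + a₃ * a₄) / 2) -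
      (a₂ - a₁) * (a₄ - a₃) / 2 * s +
      (a₄ - a₂) * (a₂ - a₁) * (a₃ - a₁) / 2 *
        (((1 - 2 * s) * (1 - m * s) * (a₄ - a₂ + (a₂ - a₁) * s) -
          m * s * (1 - s) * (a₄ - a₂ + (a₂ - a₁) * s) -
          2 * (a₂ - a₁) * s * (1 - s) * (1 - m * s)) / (a₄ - a₂ + (a₂ - a₁) * s) ^ 2) := by
  have hN : (a₄ - a₂) * (a₂ - a₁) * (a₃ - a₁) * ((1 - 2 * s) * (1 - m * s) *
      (a₄ - a₂ + (a₂ - a₁) * s) - m * s * (1 - s) * (a₄ - a₂ + (a₂ - a₁) * s) -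
          2 * (a₂ - a₁) * s * (1 - s) * (1 - m * s)) = (a₂ - a₁) * ((1 - 2 * s) *
      (a₄ - a₂ + (a₂ - a₁) * s) * ((a₄ - a₂) * (a₃ - a₁) - (a₄ - a₃) * (a₂ - a₁) * s) -
      (a₄ - a₃) * (a₂ - a₁) * s * (1 - s) * (a₄ - a₂ + (a₂ - a₁) * s) -
      2 * (a₂ - a₁) * s * (1 - s) *
        ((a₄ - a₂) * (a₃ - a₁) - (a₄ - a₃) * (a₂ - a₁) * s)) := by
    linear_combination (a₂ - a₁) * (-s * (1 - 2 * s) * (a₄ - a₂ + (a₂ - a₁) * s) -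
      s * (1 - s) * (a₄ - a₂ + (a₂ - a₁) * s) + 2 * (a₂ - a₁) * s ^ 2 * (1 - s)) * hm
  rw [div_mul_div_comm, hN]
  unfold bandPoint
  field_simp
  ring

theorem hasDerivAt_bandPoint {a₁ a₂ a₄ : ℝ} (φ : ℝ)
    (hD : a₄ - a₂ + (a₂ - a₁) * Real.sin φ ^ 2 ≠ 0) :
    HasDerivAt (fun φ => bandPoint a₁ a₂ a₄ (Real.sin φ ^ 2))
      (2 * (a₄ - a₁) * (a₄ - a₂) * (a₂ - a₁) * Real.sin φ * Real.cos φ /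
        (a₄ - a₂ + (a₂ - a₁) * Real.sin φ ^ 2) ^ 2) φ := by
  unfold bandPoint
  have hs : HasDerivAt (fun φ => Real.sin φ ^ 2) (2 * Real.sin φ * Real.cos φ) φ := by
    refine ((Real.hasDerivAt_sin φ).pow 2).congr_deriv ?_
    norm_num
  refine (((hs.const_mul _).const_add _).div ((hs.const_mul _).const_add _) hD).congr_deriv ?_
  field_simp
  ring

theorem hasDerivAt_sin_mul_cos_mul_sqrt_div {A B m : ℝ} (hm : m < 1) (φ : ℝ)
    (hD : A + B * Real.sin φ ^ 2 ≠ 0) :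
    HasDerivAt
      (fun φ => Real.sin φ * Real.cos φ * √(1 - m * Real.sin φ ^ 2) / (A + B * Real.sin φ ^ 2))
      ((((1 - 2 * Real.sin φ ^ 2) * (1 - m * Real.sin φ ^ 2) * (A + B * Real.sin φ ^ 2) -
          m * Real.sin φ ^ 2 * (1 - Real.sin φ ^ 2) * (A + B * Real.sin φ ^ 2) -
          2 * B * Real.sin φ ^ 2 * (1 - Real.sin φ ^ 2) * (1 - m * Real.sin φ ^ 2)) /
            (A + B * Real.sin φ ^ 2) ^ 2) / √(1 - m * Real.sin φ ^ 2)) φ := by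
  have hs : HasDerivAt (fun φ => Real.sin φ ^ 2) (2 * Real.sin φ * Real.cos φ) φ := by
    refine ((Real.hasDerivAt_sin φ).pow 2).congr_deriv ?_
    norm_num
  have h0 := one_sub_mul_sin_sq_pos hm φ
  refine ((((Real.hasDerivAt_sin φ).mul (Real.hasDerivAt_cos φ)).mul
    (((hs.const_mul m).const_sub 1).sqrt h0.ne')).div ((hs.const_mul B).const_add A)
    hD).congr_deriv ?_
  have hp := Real.sqrt_pos.2 h0
  have hq := Real.sq_sqrt h0.le
  have hc := Real.cos_sq' φ
  set S := √(1 - m * Real.sin φ ^ 2)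
  simp only [Pi.mul_apply]
  rw [← hq]
  field_simp
  rw [Real.sqrt_sq hp.le, hc]
  ring

theorem ellipticParam_mem {a₁ a₂ a₃ a₄ m : ℝ} (h₁₂ : a₁ < a₂) (h₂₃ : a₂ < a₃) (h₃₄ : a₃ < a₄)
    (hm : m * ((a₄ - a₂) * (a₃ - a₁)) = (a₄ - a₃) * (a₂ - a₁)) : 0 < m ∧ m < 1 := by
  have hA : 0 < (a₄ - a₂) * (a₃ - a₁) := mul_pos (by linarith) (by linarith)
  have hB : 0 < (a₄ - a₃) * (a₂ - a₁) := mul_pos (by linarith) (by linarith)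
  have hC : 0 < (a₄ - a₁) * (a₃ - a₂) := mul_pos (by linarith) (by linarith)
  constructor
  · by_contra h
    nlinarith
  · by_contra h
    nlinarith

/-- The exact term integrates to zero over a quarter period, leaving a multiple of the integral of x
- sin²φ against dφ/√(1 - m sin²φ), where x is the average of sin²φ for this weight. The constant c
is chosen to produce exactly this x. -/
theorem integral_bandPoint {a₁ a₂ a₃ a₄ m c : ℝ} (h₁₂ : a₁ < a₂) (h₂₃ : a₂ < a₃) (h₃₄ : a₃ < a₄)
    (hm : m * ((a₄ - a₂) * (a₃ - a₁)) = (a₄ - a₃) * (a₂ - a₁))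
    (hc : c = ((a₁ - a₂ - a₃ + a₄) ^ 2 / 4 +
      (a₂ - a₁) * (a₄ - a₃) * (ellipticMoment m 1 / ellipticMoment m 0)) / 2 -
      (a₁ + a₂ + a₃ + a₄) ^ 2 / 8 +
        (a₁ * a₂ + a₁ * a₃ + a₁ * a₄ + a₂ * a₃ + a₂ * a₄ + a₃ * a₄) / 2) :
    ∫ φ in (0 : ℝ)..Real.pi / 2, (bandPoint a₁ a₂ a₄ (Real.sin φ ^ 2) ^ 2 -
      (a₁ + a₂ + a₃ + a₄) / 2 * bandPoint a₁ a₂ a₄ (Real.sin φ ^ 2) + c) /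
        √(1 - m * Real.sin φ ^ 2) = 0 := by
  obtain ⟨hm0, hm1⟩ := ellipticParam_mem h₁₂ h₂₃ h₃₄ hm
  have hD : ∀ φ : ℝ, a₄ - a₂ + (a₂ - a₁) * Real.sin φ ^ 2 ≠ 0 := fun φ => by
    have : 0 ≤ (a₂ - a₁) * Real.sin φ ^ 2 := mul_nonneg (by linarith) (sq_nonneg _)
    linarith
  have hI0 := ellipticMoment_pos hm1 0
  have hFTC := intervalIntegral.integral_eq_sub_of_hasDerivAt
    (fun φ _ => hasDerivAt_sin_mul_cos_mul_sqrt_div hm1 φ (hD φ)) (a := 0) (b := Real.pi / 2)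
    ((continuous_comp_sin_div hm1 (by
      refine Continuous.div (by fun_prop) (by fun_prop) fun φ => pow_ne_zero 2 (hD φ)
      )).intervalIntegrable _ _)
  rw [Real.cos_pi_div_two, Real.sin_zero, mul_zero, zero_mul, zero_mul, zero_mul, zero_div,
    zero_div, sub_zero] at hFTC
  have hsplit : ∀ φ : ℝ, (bandPoint a₁ a₂ a₄ (Real.sin φ ^ 2) ^ 2 -
      (a₁ + a₂ + a₃ + a₄) / 2 * bandPoint a₁ a₂ a₄ (Real.sin φ ^ 2) + c) /
        √(1 - m * Real.sin φ ^ 2) =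
      ((a₂ - a₁) * (a₄ - a₃) / 2 * (ellipticMoment m 1 / ellipticMoment m 0)) *
        (Real.sin φ ^ (2 * 0) / √(1 - m * Real.sin φ ^ 2)) -
      (a₂ - a₁) * (a₄ - a₃) / 2 * (Real.sin φ ^ (2 * 1) / √(1 - m * Real.sin φ ^ 2)) +
      (a₄ - a₂) * (a₂ - a₁) * (a₃ - a₁) / 2 * ((((1 - 2 * Real.sin φ ^ 2) *
        (1 - m * Real.sin φ ^ 2) * (a₄ - a₂ + (a₂ - a₁) * Real.sin φ ^ 2) -
          m * Real.sin φ ^ 2 * (1 - Real.sin φ ^ 2) * (a₄ - a₂ + (a₂ - a₁) * Real.sin φ ^ 2) -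
          2 * (a₂ - a₁) * Real.sin φ ^ 2 * (1 - Real.sin φ ^ 2) * (1 - m * Real.sin φ ^ 2)) /
            (a₄ - a₂ + (a₂ - a₁) * Real.sin φ ^ 2) ^ 2) / √(1 - m * Real.sin φ ^ 2)) := fun φ => by
    rw [bandPoint_quadratic (hD φ) hm, hc]
    ring
  simp only [hsplit]
  have i0 : ∀ n, IntervalIntegrable (fun φ => Real.sin φ ^ (2 * n) / √(1 - m * Real.sin φ ^ 2))
      volume 0 (Real.pi / 2) := fun n =>
    (continuous_comp_sin_div hm1 (by fun_prop)).intervalIntegrable _ _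
  have i1 := (i0 0).const_mul
    ((a₂ - a₁) * (a₄ - a₃) / 2 * (ellipticMoment m 1 / ellipticMoment m 0))
  have i2 := (i0 1).const_mul ((a₂ - a₁) * (a₄ - a₃) / 2)
  rw [intervalIntegral.integral_add (i1.sub i2), intervalIntegral.integral_sub i1 i2,
    intervalIntegral.integral_const_mul, intervalIntegral.integral_const_mul,
    intervalIntegral.integral_const_mul, hFTC]
  · change _ * ellipticMoment m 0 - _ * ellipticMoment m 1 + _ = 0
    field_simp
    ring
  · refine Continuous.intervalIntegrable ((continuous_comp_sin_div hm1 ?_).const_mul _) _ _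
    exact Continuous.div (by fun_prop) (by fun_prop) fun φ => pow_ne_zero 2 (hD φ)

/-- The substitution w = `bandPoint` at s = sin²φ maps [0, π/2] onto [a₁, a₂] and turns dw/√|∏(w -
aⱼ)| into 2/√((a₄ - a₂)(a₃ - a₁)) · dφ/√(1 - m sin²φ). -/
theorem setIntegral_left_band {p : Fin 5 → ℝ} {a₁ a₂ a₃ a₄ m : ℝ} (h₁ : -1 ≤ a₁) (h₁₂ : a₁ < a₂)
    (h₂₃ : a₂ < a₃) (h₃₄ : a₃ < a₄) (h₄ : a₄ ≤ 1)
    (hm : m * ((a₄ - a₂) * (a₃ - a₁)) = (a₄ - a₃) * (a₂ - a₁)) :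
    ∫ w in Set.Ioo a₁ a₂, quartic p w / sqrtAbsProd a₁ a₂ a₃ a₄ w =
      2 / √((a₄ - a₂) * (a₃ - a₁)) * ∫ φ in (0 : ℝ)..Real.pi / 2,
        quartic p (bandPoint a₁ a₂ a₄ (Real.sin φ ^ 2)) / √(1 - m * Real.sin φ ^ 2) := by
  obtain ⟨hm0, hm1⟩ := ellipticParam_mem h₁₂ h₂₃ h₃₄ hm
  have hpi : (0 : ℝ) < Real.pi / 2 := by linarith [Real.pi_pos]
  have hDp : ∀ φ : ℝ, 0 < a₄ - a₂ + (a₂ - a₁) * Real.sin φ ^ 2 := fun φ => by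
    have : 0 ≤ (a₂ - a₁) * Real.sin φ ^ 2 := mul_nonneg (by linarith) (sq_nonneg _)
    linarith
  have hder := fun φ => hasDerivAt_bandPoint (a₁ := a₁) (a₂ := a₂) (a₄ := a₄) φ (hDp φ).ne'
  have hcont : Continuous fun φ => bandPoint a₁ a₂ a₄ (Real.sin φ ^ 2) :=
    continuous_iff_continuousAt.2 fun φ => (hder φ).continuousAt
  have hmem : ∀ φ, bandPoint a₁ a₂ a₄ (Real.sin φ ^ 2) ∈ Set.Icc a₁ a₂ := fun φ => by
    have := Real.sin_sq_le_one φ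
    have := sq_nonneg (Real.sin φ)
    unfold bandPoint
    rw [Set.mem_Icc, le_div_iff₀ (hDp φ), div_le_iff₀ (hDp φ)]
    constructor
    · nlinarith [mul_nonneg (mul_nonneg (sub_nonneg.2 h₁₂.le)
        (show 0 ≤ a₄ - a₁ by linarith)) (sq_nonneg (Real.sin φ))]
    · nlinarith [mul_nonneg (mul_nonneg (sub_nonneg.2 h₁₂.le)
        (show 0 ≤ a₄ - a₂ by linarith)) (sub_nonneg.2 (Real.sin_sq_le_one φ))]
  have hprod := fun φ => bandPoint_prod (a₃ := a₃) (hDp φ).ne' hm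
  have hpos : ∀ φ ∈ Set.Ioo 0 (Real.pi / 2), 0 < Real.sin φ ∧ 0 < Real.cos φ := fun φ hφ =>
    ⟨Real.sin_pos_of_pos_of_lt_pi hφ.1 (by linarith [hφ.2]),
      Real.cos_pos_of_mem_Ioo ⟨by linarith [hφ.1], hφ.2⟩⟩
  have hroot : ∀ φ ∈ Set.Ioo 0 (Real.pi / 2),
      sqrtAbsProd a₁ a₂ a₃ a₄ (bandPoint a₁ a₂ a₄ (Real.sin φ ^ 2)) =
      (a₄ - a₁) * (a₄ - a₂) * (a₂ - a₁) * √((a₄ - a₂) * (a₃ - a₁)) * Real.sin φ * Real.cos φ *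
        √(1 - m * Real.sin φ ^ 2) / (a₄ - a₂ + (a₂ - a₁) * Real.sin φ ^ 2) ^ 2 := fun φ hφ => by
    obtain ⟨hs, hc⟩ := hpos φ hφ
    have hAσ : 0 < (a₄ - a₂) * (a₃ - a₁) := mul_pos (by linarith) (by linarith)
    have h1m := one_sub_mul_sin_sq_pos hm1 φ
    have hfac : 0 < (a₄ - a₁) * (a₄ - a₂) * (a₂ - a₁) := by
      have := sub_pos.2 h₁₂
      have : 0 < a₄ - a₂ := by linarith
      have : 0 < a₄ - a₁ := by linarith
      positivity
    have hsq : -((bandPoint a₁ a₂ a₄ (Real.sin φ ^ 2) - a₁) *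
        (bandPoint a₁ a₂ a₄ (Real.sin φ ^ 2) - a₂) * (bandPoint a₁ a₂ a₄ (Real.sin φ ^ 2) - a₃) *
        (bandPoint a₁ a₂ a₄ (Real.sin φ ^ 2) - a₄)) =
      ((a₄ - a₁) * (a₄ - a₂) * (a₂ - a₁) * √((a₄ - a₂) * (a₃ - a₁)) * Real.sin φ * Real.cos φ *
        √(1 - m * Real.sin φ ^ 2) / (a₄ - a₂ + (a₂ - a₁) * Real.sin φ ^ 2) ^ 2) ^ 2 := by
      rw [hprod φ, div_pow, mul_pow, mul_pow, mul_pow, mul_pow, Real.sq_sqrt hAσ.le,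
        Real.sq_sqrt h1m.le, Real.cos_sq']
      ring
    have hn : 0 ≤ (a₄ - a₁) * (a₄ - a₂) * (a₂ - a₁) * √((a₄ - a₂) * (a₃ - a₁)) * Real.sin φ *
        Real.cos φ * √(1 - m * Real.sin φ ^ 2) / (a₄ - a₂ + (a₂ - a₁) * Real.sin φ ^ 2) ^ 2 := by
      positivity
    rw [sqrtAbsProd_eq (by rw [← neg_nonneg, hsq]; positivity), hsq, Real.sqrt_sq hn]
  have heq : ∀ φ ∈ Set.Ioo 0 (Real.pi / 2),
      (fun w => quartic p w / sqrtAbsProd a₁ a₂ a₃ a₄ w)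
          (bandPoint a₁ a₂ a₄ (Real.sin φ ^ 2)) *
        (2 * (a₄ - a₁) * (a₄ - a₂) * (a₂ - a₁) * Real.sin φ * Real.cos φ /
          (a₄ - a₂ + (a₂ - a₁) * Real.sin φ ^ 2) ^ 2) =
      2 / √((a₄ - a₂) * (a₃ - a₁)) * (quartic p (bandPoint a₁ a₂ a₄ (Real.sin φ ^ 2)) /
        √(1 - m * Real.sin φ ^ 2)) := fun φ hφ => by
    obtain ⟨hs, hc⟩ := hpos φ hφ
    have := Real.sqrt_pos.2 (one_sub_mul_sin_sq_pos hm1 φ)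
    have : 0 < √((a₄ - a₂) * (a₃ - a₁)) :=
      Real.sqrt_pos.2 (mul_pos (by linarith) (by linarith))
    have : a₄ - a₁ ≠ 0 := by linarith
    have : a₄ - a₂ ≠ 0 := by linarith
    have : a₂ - a₁ ≠ 0 := by linarith
    have := (hDp φ).ne'
    simp only [hroot φ hφ]
    generalize a₄ - a₂ + (a₂ - a₁) * Real.sin φ ^ 2 = D at this ⊢
    field_simp
  have hcR : Continuous fun φ => 2 / √((a₄ - a₂) * (a₃ - a₁)) *
      (quartic p (bandPoint a₁ a₂ a₄ (Real.sin φ ^ 2)) / √(1 - m * Real.sin φ ^ 2)) :=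
    (continuous_comp_sin_div hm1 ((continuous_quartic p).comp hcont)).const_mul _
  rw [← intervalIntegral.integral_const_mul, ← integral_Ioc_eq_integral_Ioo,
    ← intervalIntegral.integral_of_le h₁₂.le]
  have hsub := intervalIntegral.integral_comp_mul_deriv''' (a := 0) (b := Real.pi / 2)
    (f := fun φ => bandPoint a₁ a₂ a₄ (Real.sin φ ^ 2))
    (f' := fun φ => 2 * (a₄ - a₁) * (a₄ - a₂) * (a₂ - a₁) * Real.sin φ * Real.cos φ /
      (a₄ - a₂ + (a₂ - a₁) * Real.sin φ ^ 2) ^ 2)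
    (g := fun w => quartic p w / sqrtAbsProd a₁ a₂ a₃ a₄ w) hcont.continuousOn
    (fun φ _ => (hder φ).hasDerivWithinAt) ?_ ?_ ?_
  · have e0 : bandPoint a₁ a₂ a₄ (Real.sin 0 ^ 2) = a₁ := by
      have : a₄ - a₂ ≠ 0 := by linarith
      simp [bandPoint]
      field_simp
    have e1 : bandPoint a₁ a₂ a₄ (Real.sin (Real.pi / 2) ^ 2) = a₂ := by
      have : a₄ - a₂ + (a₂ - a₁) ≠ 0 := by linarith
      simp only [bandPoint, Real.sin_pi_div_two, one_pow, mul_one]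
      field_simp
      ring
    simp only [e0, e1] at hsub
    rw [← hsub]
    rw [intervalIntegral.integral_of_le hpi.le, intervalIntegral.integral_of_le hpi.le,
      integral_Ioc_eq_integral_Ioo, integral_Ioc_eq_integral_Ioo]
    exact setIntegral_congr_fun measurableSet_Ioo heq
  · rw [min_eq_left hpi.le, max_eq_right hpi.le]
    rintro w ⟨φ, hφ, rfl⟩
    refine ContinuousAt.continuousWithinAt (ContinuousAt.div (continuous_quartic p).continuousAt
      (Continuous.continuousAt (by unfold sqrtAbsProd; fun_prop)) ?_)
    obtain ⟨hs, hc⟩ := hpos φ hφ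
    have := Real.sqrt_pos.2 (one_sub_mul_sin_sq_pos hm1 φ)
    have : 0 < √((a₄ - a₂) * (a₃ - a₁)) :=
      Real.sqrt_pos.2 (mul_pos (by linarith) (by linarith))
    have : 0 < a₄ - a₁ := by linarith
    have : 0 < a₄ - a₂ := by linarith
    have : 0 < a₂ - a₁ := by linarith
    have := hDp φ
    simp only [hroot φ hφ]
    positivity
  · refine (integrableOn_quartic_div p h₁₂ h₂₃ h₃₄).mono_set ?_
    rintro w ⟨φ, hφ, rfl⟩
    have := hmem φ
    exact ⟨by linarith [this.1], by linarith [this.2]⟩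
  · rw [Set.uIcc_of_le hpi.le, integrableOn_Icc_iff_integrableOn_Ioo]
    exact (hcR.integrableOn_Icc.mono_set Set.Ioo_subset_Icc_self).congr_fun
      (fun φ hφ => (heq φ hφ).symm) measurableSet_Ioo

theorem sqrtAbsProd_neg (a₁ a₂ a₃ a₄ w : ℝ) :
    sqrtAbsProd (-a₄) (-a₃) (-a₂) (-a₁) (-w) = sqrtAbsProd a₁ a₂ a₃ a₄ w := by
  have h : ∀ a : ℝ, |-w - -a| = |w - a| := fun a => by rw [← abs_neg]; ring_nf
  simp only [sqrtAbsProd, h]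
  congr 1
  ring

theorem bandNull_quadratic {p : Fin 5 → ℝ} {a₁ a₂ a₃ a₄ m c : ℝ} (h₁ : -1 ≤ a₁) (h₁₂ : a₁ < a₂)
    (h₂₃ : a₂ < a₃) (h₃₄ : a₃ < a₄) (h₄ : a₄ ≤ 1)
    (hm : m * ((a₄ - a₂) * (a₃ - a₁)) = (a₄ - a₃) * (a₂ - a₁))
    (hc : c = ((a₁ - a₂ - a₃ + a₄) ^ 2 / 4 +
      (a₂ - a₁) * (a₄ - a₃) * (ellipticMoment m 1 / ellipticMoment m 0)) / 2 -
      (a₁ + a₂ + a₃ + a₄) ^ 2 / 8 +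
        (a₁ * a₂ + a₁ * a₃ + a₁ * a₄ + a₂ * a₃ + a₂ * a₄ + a₃ * a₄) / 2)
    (hp : ∀ w, quartic p w = w ^ 2 - (a₁ + a₂ + a₃ + a₄) / 2 * w + c) :
    BandNull p a₁ a₂ a₃ a₄ := by
  have hl := setIntegral_left_band (p := p) h₁ h₁₂ h₂₃ h₃₄ h₄ hm
  simp only [hp] at hl
  constructor
  · simp only [hp]
    rw [hl, integral_bandPoint h₁₂ h₂₃ h₃₄ hm hc, mul_zero]
  -- Reflection w ↦ -w exchanges the two bands. Both m and c are invariant under (a₁, a₂, a₃, a₄) ↦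
  -- (-a₄, -a₃, -a₂, -a₁), so the same quadratic serves both.
  · have hr := setIntegral_left_band (p := fun i => (-1) ^ (i : ℕ) * p i) (a₁ := -a₄) (a₂ := -a₃)
      (a₃ := -a₂) (a₄ := -a₁) (m := m) (by linarith) (by linarith) (by linarith) (by linarith)
      (by linarith) (by linear_combination hm)
    have hq : ∀ w, quartic (fun i => (-1) ^ (i : ℕ) * p i) w =
        w ^ 2 - (-a₄ + -a₃ + -a₂ + -a₁) / 2 * w + c := fun w => by
      have := hp (-w)
      simp only [quartic] at this ⊢
      simp
      linear_combination this
    simp only [hq] at hr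
    rw [integral_bandPoint (by linarith) (by linarith) (by linarith) (by linear_combination hm)
      (by rw [hc]; ring), mul_zero] at hr
    rw [← integral_Ioc_eq_integral_Ioo, ← intervalIntegral.integral_of_le (by linarith)] at hr ⊢
    rw [← hr, ← intervalIntegral.integral_comp_neg]
    refine intervalIntegral.integral_congr fun w _ => ?_
    simp only [hp, sqrtAbsProd_neg]
    congr 1
    ring

end DefNLS

namespace DefNLS

/-! ### Averages over a period of the elliptic sine -/

theorem intervalIntegrable_sin_pow_div {m : ℝ} (hm : m < 1) (n : ℕ) :
    IntervalIntegrable (fun φ => Real.sin φ ^ (2 * n) / √(1 - m * Real.sin φ ^ 2))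
      volume 0 (Real.pi / 2) :=
  (continuous_comp_sin_div hm (by fun_prop)).intervalIntegrable _ _

/-- Integrate the derivative of sin^(2k+1) φ · cos φ · √(1 - m sin²φ), which vanishes at both ends
of the quarter period. -/
theorem ellipticMoment_recurrence {m : ℝ} (hm : m < 1) (k : ℕ) :
    (2 * k + 1) * ellipticMoment m k - (2 * k + 2) * (1 + m) * ellipticMoment m (k + 1) +
      (2 * k + 3) * m * ellipticMoment m (k + 2) = 0 := by
  have i0 := intervalIntegrable_sin_pow_div hm
  have hd : ∀ φ ∈ Set.uIcc 0 (Real.pi / 2), HasDerivAt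
      (fun φ => Real.sin φ ^ (2 * k + 1) * Real.cos φ * √(1 - m * Real.sin φ ^ 2))
      (((2 * k + 1 : ℝ) * (Real.sin φ ^ (2 * k) / √(1 - m * Real.sin φ ^ 2)) -
        (2 * k + 2) * (1 + m) * (Real.sin φ ^ (2 * (k + 1)) / √(1 - m * Real.sin φ ^ 2))) +
        (2 * k + 3) * m * (Real.sin φ ^ (2 * (k + 2)) / √(1 - m * Real.sin φ ^ 2))) φ := by
    intro φ _
    have hs : HasDerivAt (fun φ => Real.sin φ ^ 2) (2 * Real.sin φ * Real.cos φ) φ := by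
      refine ((Real.hasDerivAt_sin φ).pow 2).congr_deriv ?_
      norm_num
    have h0 := one_sub_mul_sin_sq_pos hm φ
    refine ((((Real.hasDerivAt_sin φ).pow (2 * k + 1)).mul (Real.hasDerivAt_cos φ)).mul
      (((hs.const_mul m).const_sub 1).sqrt h0.ne')).congr_deriv ?_
    have hp := Real.sqrt_pos.2 h0
    have hq := Real.sq_sqrt h0.le
    have hc := Real.cos_sq' φ
    set S := √(1 - m * Real.sin φ ^ 2)
    simp only [Pi.mul_apply, Pi.pow_apply, Nat.add_sub_cancel]
    push_cast
    field_simp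
    rw [hc, hq]
    ring
  have h := intervalIntegral.integral_eq_sub_of_hasDerivAt hd
    ((((i0 k).const_mul _).sub ((i0 (k + 1)).const_mul _)).add ((i0 (k + 2)).const_mul _))
  rw [intervalIntegral.integral_add (((i0 k).const_mul _).sub ((i0 (k + 1)).const_mul _))
    ((i0 (k + 2)).const_mul _), intervalIntegral.integral_sub ((i0 k).const_mul _)
    ((i0 (k + 1)).const_mul _), intervalIntegral.integral_const_mul,
    intervalIntegral.integral_const_mul, intervalIntegral.integral_const_mul,
    Real.cos_pi_div_two, Real.sin_zero, zero_pow (Nat.succ_ne_zero _)] at h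
  simpa [ellipticMoment] using h

/-! ### Inversion of the elliptic integral and period averages -/

theorem hasDerivAt_ellipticF {m : ℝ} (hm : m < 1) (φ : ℝ) :
    HasDerivAt (ellipticF m) (1 / √(1 - m * Real.sin φ ^ 2)) φ := by
  have hc := continuous_comp_sin_div hm (f := fun _ => 1) continuous_const
  exact intervalIntegral.integral_hasDerivAt_right (hc.intervalIntegrable _ _)
    (hc.stronglyMeasurableAtFilter _ _) hc.continuousAt

theorem ellipticF_strictMono {m : ℝ} (hm : m < 1) : StrictMono (ellipticF m) :=
  strictMono_of_hasDerivAt_pos (hasDerivAt_ellipticF hm)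
    fun φ => one_div_pos.2 (Real.sqrt_pos.2 (one_sub_mul_sin_sq_pos hm φ))

theorem continuous_ellipticF {m : ℝ} (hm : m < 1) : Continuous (ellipticF m) :=
  continuous_iff_continuousAt.2 fun φ => (hasDerivAt_ellipticF hm φ).continuousAt

theorem ellipticF_zero (m : ℝ) : ellipticF m 0 = 0 := by
  simp [ellipticF]

theorem ellipticF_add_pi {m : ℝ} (hm : m < 1) (φ : ℝ) :
    ellipticF m (φ + Real.pi) = ellipticF m φ + ellipticF m Real.pi := by
  have hc := continuous_comp_sin_div hm (f := fun _ => 1) continuous_const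
  have hp : Function.Periodic (fun θ => 1 / √(1 - m * Real.sin θ ^ 2)) Real.pi := fun θ => by
    simp only [Real.sin_add_pi, neg_sq]
  have h := hp.intervalIntegral_add_eq φ 0
  rw [zero_add] at h
  unfold ellipticF
  rw [← h, intervalIntegral.integral_add_adjacent_intervals (hc.intervalIntegrable _ _)
    (hc.intervalIntegrable _ _)]

/-- For m ≥ 0 the integrand is at least 1, so F(φ) - φ is monotone and F is unbounded in both
directions. -/
theorem ellipticF_surjective {m : ℝ} (h0 : 0 ≤ m) (hm : m < 1) :
    Function.Surjective (ellipticF m) := by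
  have hmono : Monotone fun φ => ellipticF m φ - φ := by
    refine monotone_of_hasDerivAt_nonneg
      (fun φ => (hasDerivAt_ellipticF hm φ).sub (hasDerivAt_id φ)) fun φ => ?_
    have h1 := Real.sqrt_pos.2 (one_sub_mul_sin_sq_pos hm φ)
    have h2 : √(1 - m * Real.sin φ ^ 2) ≤ 1 := Real.sqrt_le_one.2 (by
      have := mul_nonneg h0 (sq_nonneg (Real.sin φ)); linarith)
    simpa using (one_le_one_div h1 h2)
  refine (continuous_ellipticF hm).surjective ?_ ?_
  · refine Filter.tendsto_atTop_mono' _ ?_ Filter.tendsto_id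
    filter_upwards [Filter.eventually_ge_atTop 0] with φ hφ
    have := hmono hφ
    simp only [ellipticF_zero, sub_zero] at this
    simpa using this
  · refine Filter.tendsto_atBot_mono' _ ?_ Filter.tendsto_id
    filter_upwards [Filter.eventually_le_atBot 0] with φ hφ
    have := hmono hφ
    simp only [ellipticF_zero, sub_zero] at this
    simpa using this

theorem jacobiAm_ellipticF {m : ℝ} (hm : m < 1) (φ : ℝ) : jacobiAm m (ellipticF m φ) = φ :=
  Function.leftInverse_invFun (ellipticF_strictMono hm).injective φ

theorem continuous_jacobiAm {m : ℝ} (h0 : 0 ≤ m) (hm : m < 1) : Continuous (jacobiAm m) := by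
  have hs := ellipticF_surjective h0 hm
  have : jacobiAm m = ((ellipticF_strictMono hm).orderIsoOfSurjective _ hs).symm := by
    funext y
    obtain ⟨φ, rfl⟩ := hs y
    rw [jacobiAm_ellipticF hm]
    exact (((ellipticF_strictMono hm).orderIsoOfSurjective _ hs).symm_apply_apply φ).symm
  rw [this]
  exact OrderIso.continuous _

theorem jacobiSn_sq_periodic {m : ℝ} (h0 : 0 ≤ m) (hm : m < 1) :
    Function.Periodic (fun y => jacobiSn m y ^ 2) (ellipticF m Real.pi) := fun y => by
  obtain ⟨φ, rfl⟩ := ellipticF_surjective h0 hm y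
  simp only [jacobiSn]
  rw [← ellipticF_add_pi hm, jacobiAm_ellipticF hm, jacobiAm_ellipticF hm, Real.sin_add_pi, neg_sq]

theorem integral_comp_sin_div_pi {m : ℝ} (hm : m < 1) {g : ℝ → ℝ} (hg : Continuous g) :
    ∫ φ in (0 : ℝ)..Real.pi, g (Real.sin φ ^ 2) / √(1 - m * Real.sin φ ^ 2) =
      2 * ∫ φ in (0 : ℝ)..Real.pi / 2, g (Real.sin φ ^ 2) / √(1 - m * Real.sin φ ^ 2) := by
  have hc := continuous_comp_sin_div hm (f := fun φ => g (Real.sin φ ^ 2)) (by fun_prop)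
  have h := intervalIntegral.integral_comp_sub_left
    (fun φ => g (Real.sin φ ^ 2) / √(1 - m * Real.sin φ ^ 2)) Real.pi (a := 0) (b := Real.pi / 2)
  simp only [Real.sin_pi_sub, sub_zero] at h
  rw [show Real.pi - Real.pi / 2 = Real.pi / 2 by ring] at h
  rw [← intervalIntegral.integral_add_adjacent_intervals (hc.intervalIntegrable 0 (Real.pi / 2))
    (hc.intervalIntegrable _ _), ← h]
  ring

theorem ellipticF_pi {m : ℝ} (hm : m < 1) : ellipticF m Real.pi = 2 * ellipticK m :=
  integral_comp_sin_div_pi hm (g := fun _ => 1) continuous_const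

theorem ellipticK_eq (m : ℝ) : ellipticK m = ellipticMoment m 0 := by
  simp [ellipticK, ellipticF, ellipticMoment]

/-- Periodicity removes the shift b, and with it all dependence on time; the change of variable y =
F(φ) then turns sn into sin. -/
theorem integral_comp_jacobiSn_sq {m : ℝ} (h0 : 0 ≤ m) (hm : m < 1) {g : ℝ → ℝ}
    (hg : Continuous g) {r : ℝ} (hr : r ≠ 0) (b : ℝ) :
    ∫ x in (0 : ℝ)..2 * ellipticK m / r, g (jacobiSn m (r * (x - b)) ^ 2) =
      2 / r * ∫ φ in (0 : ℝ)..Real.pi / 2, g (Real.sin φ ^ 2) / √(1 - m * Real.sin φ ^ 2) := by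
  have hp : Function.Periodic (fun y => g (jacobiSn m y ^ 2)) (2 * ellipticK m) := fun y => by
    have := jacobiSn_sq_periodic h0 hm y
    rw [ellipticF_pi hm] at this
    exact congrArg g this
  have hc : Continuous fun y => g (jacobiSn m y ^ 2) := by
    have := continuous_jacobiAm h0 hm
    unfold jacobiSn
    fun_prop
  have h1 := intervalIntegral.integral_comp_mul_sub (fun y => g (jacobiSn m y ^ 2)) hr (r * b)
    (a := 0) (b := 2 * ellipticK m / r)
  have h2 := intervalIntegral.integral_comp_mul_deriv (a := 0) (b := Real.pi)
    (f := ellipticF m) (f' := fun φ => 1 / √(1 - m * Real.sin φ ^ 2))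
    (g := fun y => g (jacobiSn m y ^ 2)) (fun φ _ => hasDerivAt_ellipticF hm φ)
    (continuous_comp_sin_div hm continuous_const).continuousOn hc
  have h3 := hp.intervalIntegral_add_eq (r * 0 - r * b) 0
  simp only [Function.comp_def, jacobiSn, jacobiAm_ellipticF hm, ellipticF_zero,
    ellipticF_pi hm, mul_one_div] at h2
  rw [integral_comp_sin_div_pi hm hg] at h2
  simp only [mul_sub]
  rw [h1, mul_div_cancel₀ _ hr, show 2 * ellipticK m - r * b = r * 0 - r * b + 2 * ellipticK m by
    ring, h3, zero_add]
  simp only [jacobiSn, ← h2, smul_eq_mul]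
  ring

theorem integral_quadratic_sin_sq_div {m : ℝ} (hm : m < 1) (x y z : ℝ) :
    ∫ φ in (0 : ℝ)..Real.pi / 2,
      (x + y * Real.sin φ ^ 2 + z * (Real.sin φ ^ 2) ^ 2) / √(1 - m * Real.sin φ ^ 2) =
      x * ellipticMoment m 0 + y * ellipticMoment m 1 + z * ellipticMoment m 2 := by
  have i0 := intervalIntegrable_sin_pow_div hm
  simp only [ellipticMoment]
  rw [← intervalIntegral.integral_const_mul, ← intervalIntegral.integral_const_mul,
    ← intervalIntegral.integral_const_mul, ← intervalIntegral.integral_add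
    ((i0 0).const_mul _) ((i0 1).const_mul _), ← intervalIntegral.integral_add
    (((i0 0).const_mul _).add ((i0 1).const_mul _)) ((i0 2).const_mul _)]
  refine intervalIntegral.integral_congr fun φ _ => ?_
  ring

theorem ellipticParam_mul {a₁ a₂ a₃ a₄ : ℝ} (h₁₂ : a₁ < a₂) (h₂₃ : a₂ < a₃) (h₃₄ : a₃ < a₄) :
    ellipticParam a₁ a₂ a₃ a₄ * ((a₄ - a₂) * (a₃ - a₁)) = (a₄ - a₃) * (a₂ - a₁) := by
  have h1 : a₂ - a₄ ≠ 0 := by linarith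
  have h2 : -a₃ + a₁ ≠ 0 := by linarith
  unfold ellipticParam
  field_simp
  ring

theorem finiteGapKurtosis_eq {a₁ a₂ a₃ a₄ : ℝ} (h₁₂ : a₁ < a₂) (h₂₃ : a₂ < a₃) (h₃₄ : a₃ < a₄)
    {m ρ δ : ℝ} (hm : m = ellipticParam a₁ a₂ a₃ a₄) (hρ : ρ = (a₁ - a₂ - a₃ + a₄) ^ 2 / 4)
    (hδ : δ = (a₂ - a₁) * (a₄ - a₃)) (t : ℝ) :
    finiteGapKurtosis a₁ a₂ a₃ a₄ t =
      (ρ ^ 2 + 2 * ρ * δ * (ellipticMoment m 1 / ellipticMoment m 0) +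
        δ ^ 2 * (ellipticMoment m 2 / ellipticMoment m 0)) /
      (ρ + δ * (ellipticMoment m 1 / ellipticMoment m 0)) ^ 2 := by
  obtain ⟨hm0, hm1⟩ := ellipticParam_mem h₁₂ h₂₃ h₃₄
    (hm.symm ▸ ellipticParam_mul h₁₂ h₂₃ h₃₄)
  have hI := ellipticMoment_pos hm1 0
  have hr : 0 < √((a₄ - a₂) * (a₃ - a₁)) := Real.sqrt_pos.2 (mul_pos (by linarith) (by linarith))
  have hT : finiteGapPeriod a₁ a₂ a₃ a₄ = 2 * ellipticK m / √((a₄ - a₂) * (a₃ - a₁)) := by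
    rw [finiteGapPeriod, hm]
  have h1 := integral_comp_jacobiSn_sq hm0.le hm1 (g := fun s => ρ + δ * s + 0 * s ^ 2)
    (by fun_prop) hr.ne' (t * (a₁ + a₂ + a₃ + a₄))
  have h2 := integral_comp_jacobiSn_sq hm0.le hm1
    (g := fun s => ρ ^ 2 + 2 * ρ * δ * s + δ ^ 2 * s ^ 2)
    (by fun_prop) hr.ne' (t * (a₁ + a₂ + a₃ + a₄))
  rw [integral_quadratic_sin_sq_div hm1] at h1 h2
  have e1 : ∀ x, finiteGapSqModulus a₁ a₂ a₃ a₄ x t =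
      ρ + δ * jacobiSn m (√((a₄ - a₂) * (a₃ - a₁)) * (x - t * (a₁ + a₂ + a₃ + a₄))) ^ 2 +
        0 * (jacobiSn m (√((a₄ - a₂) * (a₃ - a₁)) * (x - t * (a₁ + a₂ + a₃ + a₄))) ^ 2) ^ 2 := by
    intro x
    rw [finiteGapSqModulus, hm, hρ, hδ]
    ring
  have e2 : ∀ x, finiteGapSqModulus a₁ a₂ a₃ a₄ x t ^ 2 =
      ρ ^ 2 + 2 * ρ * δ *
        jacobiSn m (√((a₄ - a₂) * (a₃ - a₁)) * (x - t * (a₁ + a₂ + a₃ + a₄))) ^ 2 +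
        δ ^ 2 * (jacobiSn m (√((a₄ - a₂) * (a₃ - a₁)) *
          (x - t * (a₁ + a₂ + a₃ + a₄))) ^ 2) ^ 2 := by
    intro x
    rw [e1]
    ring
  rw [finiteGapKurtosis]
  simp only [e2]
  simp only [e1]
  rw [hT, h1, h2, ellipticK_eq]
  congr 1
  · field_simp
  · congr 1
    field_simp
    ring

end DefNLS

namespace DefNLS

/-! ### Bounds for the elliptic moments -/

/-- The variance of sin²φ under the weight 1/√(1 - m sin²φ) is nonnegative. -/
theorem ellipticMoment_one_sq_le {m : ℝ} (hm : m < 1) :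
    (ellipticMoment m 1 / ellipticMoment m 0) ^ 2 ≤ ellipticMoment m 2 / ellipticMoment m 0 := by
  have h0 := ellipticMoment_pos hm 0
  set x := ellipticMoment m 1 / ellipticMoment m 0 with hx
  have h1 : ellipticMoment m 1 = x * ellipticMoment m 0 := by rw [hx]; field_simp
  have h := integral_quadratic_sin_sq_div hm (x ^ 2) (-2 * x) 1
  have hn : 0 ≤ ∫ φ in (0 : ℝ)..Real.pi / 2,
      (x ^ 2 + -2 * x * Real.sin φ ^ 2 + 1 * (Real.sin φ ^ 2) ^ 2) /
        √(1 - m * Real.sin φ ^ 2) := by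
    refine intervalIntegral.integral_nonneg (by linarith [Real.pi_pos]) fun φ _ => ?_
    rw [show x ^ 2 + -2 * x * Real.sin φ ^ 2 + 1 * (Real.sin φ ^ 2) ^ 2 =
      (x - Real.sin φ ^ 2) ^ 2 by ring]
    positivity
  rw [h, h1] at hn
  rw [le_div_iff₀ h0]
  linarith

/-- Pointwise 1/√(1 - q) ≤ 1 + q for 0 ≤ q ≤ 1/2, with q = m sin²φ; the right-hand moments are
Wallis integrals. -/
theorem ellipticMoment_le {m : ℝ} (h0 : 0 ≤ m) (hm : m ≤ 1 / 2) (n : ℕ) :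
    ellipticMoment m n ≤ ellipticMoment 0 n + m * ellipticMoment 0 (n + 1) := by
  have i0 := intervalIntegrable_sin_pow_div (zero_lt_one' ℝ)
  unfold ellipticMoment
  rw [← intervalIntegral.integral_const_mul, ← intervalIntegral.integral_add (i0 n)
    ((i0 (n + 1)).const_mul _)]
  refine intervalIntegral.integral_mono_on (by linarith [Real.pi_pos])
    (intervalIntegrable_sin_pow_div (by linarith) n) ((i0 n).add ((i0 (n + 1)).const_mul _))
    fun φ _ => ?_
  have hs := Real.sin_sq_le_one φ
  have hs0 := sq_nonneg (Real.sin φ)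
  have hp := one_sub_mul_sin_sq_pos (show m < 1 by linarith) φ
  simp only [mul_add, pow_add, pow_mul, mul_one, zero_mul, sub_zero, Real.sqrt_one, div_one]
  set s := Real.sin φ ^ 2
  have hq0 : 0 ≤ m * s := mul_nonneg h0 hs0
  have hq1 : m * s ≤ 1 / 2 := by nlinarith
  have hkey : 1 ≤ (1 + m * s) * √(1 - m * s) := by
    refine (one_le_sq_iff₀ (by positivity)).1 ?_
    rw [mul_pow, Real.sq_sqrt hp.le]
    nlinarith [mul_nonneg hq0 (sub_nonneg.2 hq1), mul_nonneg hq0 hq0,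
      mul_nonneg (mul_nonneg hq0 hq0) (sub_nonneg.2 hq1)]
  rw [div_le_iff₀ (Real.sqrt_pos.2 hp)]
  have := mul_le_mul_of_nonneg_left hkey (pow_nonneg hs0 n)
  nlinarith

theorem le_ellipticMoment {m : ℝ} (h0 : 0 ≤ m) (hm : m < 1) (n : ℕ) :
    ellipticMoment 0 n + m / 2 * ellipticMoment 0 (n + 1) ≤ ellipticMoment m n := by
  have i0 := intervalIntegrable_sin_pow_div (zero_lt_one' ℝ)
  unfold ellipticMoment
  rw [← intervalIntegral.integral_const_mul, ← intervalIntegral.integral_add (i0 n)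
    ((i0 (n + 1)).const_mul _)]
  refine intervalIntegral.integral_mono_on (by linarith [Real.pi_pos])
    ((i0 n).add ((i0 (n + 1)).const_mul _)) (intervalIntegrable_sin_pow_div hm n) fun φ _ => ?_
  have hs0 := sq_nonneg (Real.sin φ)
  have hp := one_sub_mul_sin_sq_pos hm φ
  simp only [mul_add, pow_add, pow_mul, mul_one, zero_mul, sub_zero, Real.sqrt_one, div_one]
  set s := Real.sin φ ^ 2
  have hq0 : 0 ≤ m * s := mul_nonneg h0 hs0
  have hkey : (1 + m / 2 * s) * √(1 - m * s) ≤ 1 := by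
    refine (sq_le_one_iff₀ (by positivity)).1 ?_
    rw [mul_pow, Real.sq_sqrt hp.le]
    nlinarith [mul_nonneg hq0 hq0, mul_nonneg (mul_nonneg hq0 hq0) hq0]
  rw [le_div_iff₀ (Real.sqrt_pos.2 hp)]
  have := mul_le_mul_of_nonneg_left hkey (pow_nonneg hs0 n)
  nlinarith

/-- The comparison gives (5/16 + 35m/128)/(1 + m/4). To first order this is 5/16 + 25m/128, and 1/5
lies just above 25/128. -/
theorem ellipticMoment_three_div_le {m : ℝ} (h0 : 0 ≤ m) (hm : m ≤ 1 / 2) :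
    ellipticMoment m 3 / ellipticMoment m 0 ≤ 5 / 16 + m / 5 := by
  have hm1 : m < 1 := by linarith
  rw [div_le_iff₀ (ellipticMoment_pos hm1 0)]
  have h3 := ellipticMoment_le h0 hm 3
  have hl := le_ellipticMoment h0 hm1 0
  have hJ := ellipticMoment_pos (zero_lt_one' ℝ) 0
  have r := ellipticMoment_recurrence (zero_lt_one' ℝ)
  have r0 := r 0
  have r1 := r 1
  have r2 := r 2
  have r3 := r 3
  norm_num at r0 r1 r2 r3 h3 hl
  set J := ellipticMoment 0 0
  have e1 : ellipticMoment 0 1 = J / 2 := by linarith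
  have e3 : ellipticMoment 0 3 = 5 / 16 * J := by linarith
  have e4 : ellipticMoment 0 4 = 35 / 128 * J := by linarith
  rw [e3, e4] at h3
  rw [e1] at hl
  have := mul_le_mul_of_nonneg_left hl (show 0 ≤ 5 / 16 + m / 5 by linarith)
  nlinarith [mul_nonneg h0 hJ.le, mul_nonneg (mul_nonneg h0 h0) hJ.le]

/-- Equality holds in the limit m → 0, where x = 1/2 and y = 3/8, so crude estimates fail for small
m. The recurrence eliminates y and leaves a quadratic inequality in x alone. -/
theorem ellipticMoment_two_le {m : ℝ} (h0 : 0 < m) (hm : m < 1) :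
    ellipticMoment m 2 / ellipticMoment m 0 ≤
      3 / 2 * (ellipticMoment m 1 / ellipticMoment m 0) ^ 2 := by
  have hI := ellipticMoment_pos hm 0
  have r0 := ellipticMoment_recurrence hm 0
  have r1 := ellipticMoment_recurrence hm 1
  have h3 := fun h => ellipticMoment_three_div_le h0.le (m := m) h
  have e : ∀ n, ellipticMoment m n = ellipticMoment m n / ellipticMoment m 0 *
    ellipticMoment m 0 := fun n => (div_mul_cancel₀ _ hI.ne').symm
  rw [e 1, e 2] at r0
  rw [e 1, e 2, e 3] at r1
  set x := ellipticMoment m 1 / ellipticMoment m 0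
  set y := ellipticMoment m 2 / ellipticMoment m 0
  set z := ellipticMoment m 3 / ellipticMoment m 0
  have s0 : 1 - 2 * (1 + m) * x + 3 * m * y = 0 := by
    refine (mul_eq_zero.1 (?_ : _ * ellipticMoment m 0 = 0)).resolve_right hI.ne'
    norm_num at r0
    linear_combination r0
  have s1 : 3 * x - 4 * (1 + m) * y + 5 * m * z = 0 := by
    refine (mul_eq_zero.1 (?_ : _ * ellipticMoment m 0 = 0)).resolve_right hI.ne'
    norm_num at r1
    linear_combination r1
  -- The first recurrence relation gives 3my = 2(1 + m)x - 1.
  suffices 0 ≤ 9 / 2 * m * x ^ 2 - 2 * (1 + m) * x + 1 by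
    have : 0 ≤ 3 * m * (3 / 2 * x ^ 2 - y) := by linarith
    linarith [nonneg_of_mul_nonneg_right this (by linarith)]
  rcases le_or_gt m (1 / 2) with h | h
  · have hz := h3 h
    set D := 8 + 7 * m + 8 * m ^ 2
    set N := 4 + 4 * m + 75 / 16 * m ^ 2 + 3 * m ^ 3
    have hD : 0 < D := by positivity
    -- Eliminating y between the two relations expresses x through the third moment: D x = 4(1 + m)
    -- + 15m² z. The factor m² is what makes a rough bound on z sharp enough.
    have hx : D * x ≤ N := by
      have : D * x = 4 * (1 + m) + 15 * m ^ 2 * z := by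
        linear_combination -4 * (1 + m) * s0 - 3 * m * s1
      rw [this]
      simp only [N]
      nlinarith [mul_le_mul_of_nonneg_left hz (show 0 ≤ 15 * m ^ 2 by positivity)]
    -- The point N/D lies to the left of the vertex 2(1 + m)/(9m), so the quadratic is decreasing up
    -- to N/D, and it is enough to check its sign there.
    have hQ : 0 ≤ 2 * (1 + m) * D - 9 * m * N := by
      simp only [D, N]
      nlinarith [mul_nonneg h0.le (sub_nonneg.2 h), mul_nonneg (mul_nonneg h0.le h0.le)
        (sub_nonneg.2 h), mul_nonneg (mul_nonneg h0.le (mul_nonneg h0.le h0.le)) (sub_nonneg.2 h)]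
    have hP : 0 ≤ 9 / 2 * m * N ^ 2 - 2 * (1 + m) * N * D + D ^ 2 := by
      have : 9 / 2 * m * N ^ 2 - 2 * (1 + m) * N * D + D ^ 2 = m ^ 2 * (6 * (1 - 53 / 32 * m) ^ 2 +
          15189 / 512 * m ^ 2 + 21441 / 512 * m ^ 3 + 1257 / 16 * m ^ 4 + 81 / 2 * m ^ 5) := by
        simp only [D, N]
        ring
      rw [this]
      positivity
    have hmain : 0 ≤ D ^ 2 * (9 / 2 * m * x ^ 2 - 2 * (1 + m) * x + 1) := by
      have : D ^ 2 * (9 / 2 * m * x ^ 2 - 2 * (1 + m) * x + 1) =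
          (9 / 2 * m * N ^ 2 - 2 * (1 + m) * N * D + D ^ 2) +
          (N - D * x) * (2 * (1 + m) * D - 9 * m * N) + 9 / 2 * m * (N - D * x) ^ 2 := by ring
      rw [this]
      have := mul_nonneg (sub_nonneg.2 hx) hQ
      positivity
    exact nonneg_of_mul_nonneg_right hmain (by positivity)
  -- For m > 1/2 the discriminant is nonpositive: completing the square leaves 2(2m - 1)(2 - m).
  · have : 0 ≤ 18 * m * (9 / 2 * m * x ^ 2 - 2 * (1 + m) * x + 1) := by
      nlinarith [sq_nonneg (9 * m * x - 2 * (1 + m)), mul_nonneg (sub_nonneg.2 h.le)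
        (show 0 ≤ 2 - m by linarith)]
    exact nonneg_of_mul_nonneg_right this (by linarith)

end DefNLS

namespace DefNLS

/-! ### The genus one condensate -/

section Condensate

variable {a₁ a₂ a₃ a₄ e₁ e₂ e₃ e₄ m c : ℝ}

theorem bandNull_first (h₁ : -1 ≤ a₁) (h₁₂ : a₁ < a₂) (h₂₃ : a₂ < a₃) (h₃₄ : a₃ < a₄) (h₄ : a₄ ≤ 1)
    (he : IsElementarySymmetric e₁ e₂ e₃ e₄ a₁ a₂ a₃ a₄)
    (hm : m * ((a₄ - a₂) * (a₃ - a₁)) = (a₄ - a₃) * (a₂ - a₁))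
    (hc : c = ((a₁ - a₂ - a₃ + a₄) ^ 2 / 4 +
      (a₂ - a₁) * (a₄ - a₃) * (ellipticMoment m 1 / ellipticMoment m 0)) / 2 - e₁ ^ 2 / 8 + e₂ / 2) :
    BandNull ![c, -e₁ / 2, 1, 0, 0] a₁ a₂ a₃ a₄ :=
  bandNull_quadratic (c := c) h₁ h₁₂ h₂₃ h₃₄ h₄ hm (by rw [hc, he.one, he.two]) fun w => by
    simp [quartic, he.one]
    ring

/-- The polynomial is R' plus e₁ times the first one, R = ∏(w - aⱼ). The multiple e₁ removes the √(1
- z²) term from its potential, leaving 2z√(1 - z²). -/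
theorem bandNull_second (h₁ : -1 ≤ a₁) (h₁₂ : a₁ < a₂) (h₂₃ : a₂ < a₃) (h₃₄ : a₃ < a₄)
    (h₄ : a₄ ≤ 1) (he : IsElementarySymmetric e₁ e₂ e₃ e₄ a₁ a₂ a₃ a₄)
    (h : BandNull ![c, -e₁ / 2, 1, 0, 0] a₁ a₂ a₃ a₄) :
    BandNull ![-e₃ + e₁ * c, 2 * e₂ - e₁ ^ 2 / 2, -2 * e₁, 4, 0] a₁ a₂ a₃ a₄ := by
  refine BandNull.add_mul (p := ![-e₃, 2 * e₂, -3 * e₁, 4, 0]) h₁ h₁₂ h₂₃ h₃₄ h₄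
    (bandNull_of_deriv h₁ h₁₂ h₂₃ h₃₄ h₄ 1 0 fun w => ?_) h e₁ fun w => ?_
  · simp [quartic, he.one, he.two, he.three]
    ring
  · simp [quartic]
    ring

/-- Here R + (e₁/4 + w/2)R' is exact. The value e₁/4 removes the z√(1 - z²) term of the potential,
and the multiple of the first polynomial adjusts the constant to 1/2. -/
theorem bandNull_third (h₁ : -1 ≤ a₁) (h₁₂ : a₁ < a₂) (h₂₃ : a₂ < a₃) (h₃₄ : a₃ < a₄) (h₄ : a₄ ≤ 1)
    (he : IsElementarySymmetric e₁ e₂ e₃ e₄ a₁ a₂ a₃ a₄)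
    (h : BandNull ![c, -e₁ / 2, 1, 0, 0] a₁ a₂ a₃ a₄) :
    BandNull ![e₄ - e₁ * e₃ / 4 + (3 * e₁ ^ 2 / 8 - e₂ / 2) * c,
      -3 * e₃ / 2 + e₁ * e₂ / 2 - (3 * e₁ ^ 2 / 8 - e₂ / 2) * e₁ / 2,
      2 * e₂ - 3 * e₁ ^ 2 / 4 + (3 * e₁ ^ 2 / 8 - e₂ / 2), -3 * e₁ / 2, 3] a₁ a₂ a₃ a₄ := by
  refine BandNull.add_mul (p := ![e₄ - e₁ * e₃ / 4, -3 * e₃ / 2 + e₁ * e₂ / 2,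
      2 * e₂ - 3 * e₁ ^ 2 / 4, -3 * e₁ / 2, 3]) h₁ h₁₂ h₂₃ h₃₄ h₄
    (bandNull_of_deriv h₁ h₁₂ h₂₃ h₃₄ h₄ (e₁ / 4) (1 / 2) fun w => ?_) h
    (3 * e₁ ^ 2 / 8 - e₂ / 2) fun w => ?_
  · simp [quartic, he.one, he.two, he.three, he.four]
    ring
  · simp [quartic]
    ring

theorem integral_ndrKernel_first (h₁ : -1 ≤ a₁) (h₁₂ : a₁ < a₂) (h₂₃ : a₂ < a₃) (h₃₄ : a₃ < a₄)
    (h₄ : a₄ ≤ 1) (he : IsElementarySymmetric e₁ e₂ e₃ e₄ a₁ a₂ a₃ a₄)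
    (h : BandNull ![c, -e₁ / 2, 1, 0, 0] a₁ a₂ a₃ a₄) :
    ∀ z ∈ genusOneSupport a₁ a₂ a₃ a₄, ∫ w in genusOneSupport a₁ a₂ a₃ a₄,
      ndrKernel z w * spectralDensity ![c, -e₁ / 2, 1, 0, 0] a₁ a₂ a₃ a₄ w = √(1 - z ^ 2) :=
  fun z hz => by
    rw [integral_ndrKernel_mul_spectralDensity h₁ h₁₂ h₂₃ h₃₄ h₄ he h hz]
    simp
    ring

theorem integral_ndrKernel_second (h₁ : -1 ≤ a₁) (h₁₂ : a₁ < a₂) (h₂₃ : a₂ < a₃) (h₃₄ : a₃ < a₄)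
    (h₄ : a₄ ≤ 1) (he : IsElementarySymmetric e₁ e₂ e₃ e₄ a₁ a₂ a₃ a₄)
    (h : BandNull ![-e₃ + e₁ * c, 2 * e₂ - e₁ ^ 2 / 2, -2 * e₁, 4, 0] a₁ a₂ a₃ a₄) :
    ∀ z ∈ genusOneSupport a₁ a₂ a₃ a₄, ∫ w in genusOneSupport a₁ a₂ a₃ a₄, ndrKernel z w *
      spectralDensity ![-e₃ + e₁ * c, 2 * e₂ - e₁ ^ 2 / 2, -2 * e₁, 4, 0] a₁ a₂ a₃ a₄ w =
        2 * z * √(1 - z ^ 2) :=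
  fun z hz => by
    rw [integral_ndrKernel_mul_spectralDensity h₁ h₁₂ h₂₃ h₃₄ h₄ he h hz]
    congr 1
    simp
    ring

theorem integral_ndrKernel_third (h₁ : -1 ≤ a₁) (h₁₂ : a₁ < a₂) (h₂₃ : a₂ < a₃) (h₃₄ : a₃ < a₄)
    (h₄ : a₄ ≤ 1) (he : IsElementarySymmetric e₁ e₂ e₃ e₄ a₁ a₂ a₃ a₄)
    (h : BandNull ![e₄ - e₁ * e₃ / 4 + (3 * e₁ ^ 2 / 8 - e₂ / 2) * c,
      -3 * e₃ / 2 + e₁ * e₂ / 2 - (3 * e₁ ^ 2 / 8 - e₂ / 2) * e₁ / 2,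
      2 * e₂ - 3 * e₁ ^ 2 / 4 + (3 * e₁ ^ 2 / 8 - e₂ / 2), -3 * e₁ / 2, 3] a₁ a₂ a₃ a₄) :
    ∀ z ∈ genusOneSupport a₁ a₂ a₃ a₄, ∫ w in genusOneSupport a₁ a₂ a₃ a₄, ndrKernel z w *
      spectralDensity ![e₄ - e₁ * e₃ / 4 + (3 * e₁ ^ 2 / 8 - e₂ / 2) * c,
      -3 * e₃ / 2 + e₁ * e₂ / 2 - (3 * e₁ ^ 2 / 8 - e₂ / 2) * e₁ / 2,
      2 * e₂ - 3 * e₁ ^ 2 / 4 + (3 * e₁ ^ 2 / 8 - e₂ / 2), -3 * e₁ / 2, 3] a₁ a₂ a₃ a₄ w =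
        (z ^ 2 + 1 / 2) * √(1 - z ^ 2) :=
  fun z hz => by
    rw [integral_ndrKernel_mul_spectralDensity h₁ h₁₂ h₂₃ h₃₄ h₄ he h hz]
    congr 1
    simp
    ring

theorem exists_isCondensate (h₁ : -1 ≤ a₁) (h₁₂ : a₁ < a₂) (h₂₃ : a₂ < a₃) (h₃₄ : a₃ < a₄)
    (h₄ : a₄ ≤ 1) : ∃ u v : ℝ → ℝ, IsCondensate (genusOneSupport a₁ a₂ a₃ a₄) u v := by
  have he : IsElementarySymmetric _ _ _ _ a₁ a₂ a₃ a₄ := ⟨rfl, rfl, rfl, rfl⟩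
  have hu := bandNull_first h₁ h₁₂ h₂₃ h₃₄ h₄ he (ellipticParam_mul h₁₂ h₂₃ h₃₄) rfl
  have hv := bandNull_second h₁ h₁₂ h₂₃ h₃₄ h₄ he hu
  have ku := integral_ndrKernel_first h₁ h₁₂ h₂₃ h₃₄ h₄ he hu
  have kv := integral_ndrKernel_second h₁ h₁₂ h₂₃ h₃₄ h₄ he hv
  exact ⟨spectralDensity _ a₁ a₂ a₃ a₄, spectralDensity _ a₁ a₂ a₃ a₄,
    ⟨3 / 2, one_lt_three_halves, memLp_spectralDensity _ h₁ h₁₂ h₂₃ h₃₄ h₄⟩,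
    ⟨3 / 2, one_lt_three_halves, memLp_spectralDensity _ h₁ h₁₂ h₂₃ h₃₄ h₄⟩,
    fun z hz => by rw [zero_mul, add_zero]; exact ku z hz,
    fun z hz => by rw [zero_mul, add_zero]; exact kv z hz⟩

theorem IsCondensate.means {u v : ℝ → ℝ} (h : IsCondensate (genusOneSupport a₁ a₂ a₃ a₄) u v)
    (h₁ : -1 ≤ a₁) (h₁₂ : a₁ < a₂) (h₂₃ : a₂ < a₃) (h₃₄ : a₃ < a₄) (h₄ : a₄ ≤ 1)
    {ρ δ : ℝ} (hm : m = ellipticParam a₁ a₂ a₃ a₄) (hρ : ρ = (a₁ - a₂ - a₃ + a₄) ^ 2 / 4)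
    (hδ : δ = (a₂ - a₁) * (a₄ - a₃)) :
    meanSq (genusOneSupport a₁ a₂ a₃ a₄) u =
        ρ + δ * (ellipticMoment m 1 / ellipticMoment m 0) ∧
      meanFourth (genusOneSupport a₁ a₂ a₃ a₄) u v =
        ρ ^ 2 + 2 * ρ * δ * (ellipticMoment m 1 / ellipticMoment m 0) +
          δ ^ 2 * (ellipticMoment m 2 / ellipticMoment m 0) := by
  obtain ⟨e₁, e₂, e₃, e₄, he⟩ : ∃ e₁ e₂ e₃ e₄, IsElementarySymmetric e₁ e₂ e₃ e₄ a₁ a₂ a₃ a₄ :=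
    ⟨_, _, _, _, rfl, rfl, rfl, rfl⟩
  have hp : m * ((a₄ - a₂) * (a₃ - a₁)) = (a₄ - a₃) * (a₂ - a₁) :=
    hm ▸ ellipticParam_mul h₁₂ h₂₃ h₃₄
  obtain ⟨hm0, hm1⟩ := ellipticParam_mem h₁₂ h₂₃ h₃₄ hp
  have hδ' : δ = (a₄ - a₃) * (a₂ - a₁) := by rw [hδ, mul_comm]
  have hI := ellipticMoment_pos hm1 0
  have hrec := ellipticMoment_recurrence hm1 0
  have hM1 : ellipticMoment m 1 =
      ellipticMoment m 1 / ellipticMoment m 0 * ellipticMoment m 0 := by field_simp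
  have hM2 : ellipticMoment m 2 =
      ellipticMoment m 2 / ellipticMoment m 0 * ellipticMoment m 0 := by field_simp
  rw [hM1, hM2] at hrec
  obtain ⟨c, hc⟩ : ∃ c, c = ((a₁ - a₂ - a₃ + a₄) ^ 2 / 4 + (a₂ - a₁) * (a₄ - a₃) *
    (ellipticMoment m 1 / ellipticMoment m 0)) / 2 - e₁ ^ 2 / 8 + e₂ / 2 := ⟨_, rfl⟩
  have b1 := bandNull_first h₁ h₁₂ h₂₃ h₃₄ h₄ he hp hc
  have b2 := bandNull_second h₁ h₁₂ h₂₃ h₃₄ h₄ he b1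
  have b3 := bandNull_third h₁ h₁₂ h₂₃ h₃₄ h₄ he b1
  have hΓ := genusOneSupport_subset h₁ h₁₂ h₂₃ h₃₄ h₄
  have hΓm := measurableSet_genusOneSupport a₁ a₂ a₃ a₄
  have hint : ∀ p, IntegrableOn (spectralDensity p a₁ a₂ a₃ a₄) (genusOneSupport a₁ a₂ a₃ a₄) :=
    fun p => by
      have : IsFiniteMeasure (volume.restrict (genusOneSupport a₁ a₂ a₃ a₄)) :=
        ⟨by rw [Measure.restrict_apply_univ]; exact (measure_mono hΓ).trans_lt (by simp)⟩
      exact (memLp_spectralDensity p h₁ h₁₂ h₂₃ h₃₄ h₄).integrable one_lt_three_halves.le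
  have hu : ∀ z ∈ genusOneSupport a₁ a₂ a₃ a₄,
      ∫ w in genusOneSupport a₁ a₂ a₃ a₄, ndrKernel z w * u w = √(1 - z ^ 2) := fun z hz => by
    simpa using h.first_ndr z hz
  have hv : ∀ z ∈ genusOneSupport a₁ a₂ a₃ a₄,
      ∫ w in genusOneSupport a₁ a₂ a₃ a₄, ndrKernel z w * v w = 2 * z * √(1 - z ^ 2) :=
    fun z hz => by simpa using h.second_ndr z hz
  have i1 := setIntegral_mul_comm_of_ndr hΓ hΓm (hint _) h.memLp_u
    (integral_ndrKernel_first h₁ h₁₂ h₂₃ h₃₄ h₄ he b1) hu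
  have i2 := setIntegral_mul_comm_of_ndr hΓ hΓm (hint _) h.memLp_v
    (integral_ndrKernel_second h₁ h₁₂ h₂₃ h₃₄ h₄ he b2) hv
  -- The weight (z² + 1/2)√(1 - z²) is moved onto the third density, so that only ∫ d √(1 - w²) has
  -- to be computed. Integrating it directly against the first density would involve sin 3β and a
  -- Taylor coefficient of order six.
  have i3 := setIntegral_mul_comm_of_ndr hΓ hΓm (hint _) h.memLp_u
    (integral_ndrKernel_third h₁ h₁₂ h₂₃ h₃₄ h₄ he b3) hu
  simp only [mul_comm (spectralDensity _ _ _ _ _ _)] at i1 i2 i3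
  rw [integral_sqrt_mul_spectralDensity h₁ h₁₂ h₂₃ h₃₄ h₄ he b1] at i1
  rw [integral_mul_sqrt_mul_spectralDensity h₁ h₁₂ h₂₃ h₃₄ h₄ he b2 rfl] at i2
  rw [integral_sqrt_mul_spectralDensity h₁ h₁₂ h₂₃ h₃₄ h₄ he b3] at i3
  simp at i1 i2 i3
  set x := ellipticMoment m 1 / ellipticMoment m 0
  set y := ellipticMoment m 2 / ellipticMoment m 0
  have hxy : 1 - 2 * (1 + m) * x + 3 * m * y = 0 := by
    refine (mul_eq_zero.1 (?_ : _ * ellipticMoment m 0 = 0)).resolve_right hI.ne'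
    norm_num at hrec
    linear_combination hrec
  -- The condensate averages contain only x; the recurrence, with δ = m(a₄ - a₂)(a₃ - a₁), rewrites
  -- the fourth moment of the finite-gap solution in the same terms.
  have hy : δ ^ 2 * y = (2 * δ * ((a₄ - a₂) * (a₃ - a₁) + δ) * x -
      δ * ((a₄ - a₂) * (a₃ - a₁))) / 3 := by
    rw [← hδ'] at hp
    linear_combination δ * ((a₄ - a₂) * (a₃ - a₁)) / 3 * hxy + (2 / 3 * δ * x - δ * y) * hp
  have j2 : ∫ ζ in genusOneSupport a₁ a₂ a₃ a₄, ζ * v ζ * √(1 - ζ ^ 2) =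
      (∫ w in genusOneSupport a₁ a₂ a₃ a₄, v w * (2 * w * √(1 - w ^ 2))) / 2 := by
    rw [← integral_div]
    congr 1 with w
    ring
  have j3 : ∫ ζ in genusOneSupport a₁ a₂ a₃ a₄, (ζ ^ 2 + 1 / 2) * u ζ * √(1 - ζ ^ 2) =
      ∫ w in genusOneSupport a₁ a₂ a₃ a₄, u w * ((w ^ 2 + 2⁻¹) * √(1 - w ^ 2)) := by
    congr 1 with w
    ring
  constructor
  · rw [meanSq, coeffI₁, i1, hc, hρ, hδ, he.one, he.two]
    ring
  · rw [hy, meanFourth, coeffI₃, coeffJ₂, j2, j3, i2, i3, hc, hρ, hδ, he.one, he.two, he.three,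
      he.four]
    ring

/-- The background ρ ≥ 0 only helps: for the upper bound it contributes ρ²/2 + ρδx to the slack, and
for the lower bound it cancels. -/
theorem one_le_div_and_div_le {ρ δ x y : ℝ} (hρ : 0 ≤ ρ) (hδ : 0 < δ) (hx : 0 < x)
    (hxy : x ^ 2 ≤ y) (hyx : y ≤ 3 / 2 * x ^ 2) :
    1 ≤ (ρ ^ 2 + 2 * ρ * δ * x + δ ^ 2 * y) / (ρ + δ * x) ^ 2 ∧
      (ρ ^ 2 + 2 * ρ * δ * x + δ ^ 2 * y) / (ρ + δ * x) ^ 2 ≤ 3 / 2 := by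
  have h : 0 < (ρ + δ * x) ^ 2 := by positivity
  rw [one_le_div h, div_le_iff₀ h]
  have h1 := mul_le_mul_of_nonneg_left hxy (sq_nonneg δ)
  have h2 := mul_le_mul_of_nonneg_left hyx (sq_nonneg δ)
  have h3 : 0 ≤ ρ * δ * x := by positivity
  constructor
  · linarith
  · linarith [sq_nonneg ρ]

end Condensate

end DefNLS
theorem mainTheorem1 (a₁ a₂ a₃ a₄ : ℝ) (h₀ : -1 ≤ a₁) (h₁ : a₁ < a₂) (h₂ : a₂ < a₃)
    (h₃ : a₃ < a₄) (h₄ : a₄ ≤ 1) :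
    (∃ u v : ℝ → ℝ, DefNLS.IsCondensate (DefNLS.genusOneSupport a₁ a₂ a₃ a₄) u v) ∧
    ∀ u v : ℝ → ℝ, DefNLS.IsCondensate (DefNLS.genusOneSupport a₁ a₂ a₃ a₄) u v →
      (∀ t : ℝ, DefNLS.kurtosis (DefNLS.genusOneSupport a₁ a₂ a₃ a₄) u v =
        DefNLS.finiteGapKurtosis a₁ a₂ a₃ a₄ t) ∧
      1 ≤ DefNLS.kurtosis (DefNLS.genusOneSupport a₁ a₂ a₃ a₄) u v ∧
      DefNLS.kurtosis (DefNLS.genusOneSupport a₁ a₂ a₃ a₄) u v ≤ 3 / 2 := by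
  refine ⟨DefNLS.exists_isCondensate h₀ h₁ h₂ h₃ h₄, fun u v h => ?_⟩
  obtain ⟨hS, hF⟩ := h.means h₀ h₁ h₂ h₃ h₄ rfl rfl rfl
  obtain ⟨hm0, hm1⟩ := DefNLS.ellipticParam_mem h₁ h₂ h₃ (DefNLS.ellipticParam_mul h₁ h₂ h₃)
  have hb := DefNLS.one_le_div_and_div_le
    (ρ := (a₁ - a₂ - a₃ + a₄) ^ 2 / 4) (δ := (a₂ - a₁) * (a₄ - a₃)) (by positivity)
    (mul_pos (sub_pos.2 h₁) (sub_pos.2 h₃))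
    (div_pos (DefNLS.ellipticMoment_pos hm1 1) (DefNLS.ellipticMoment_pos hm1 0))
    (DefNLS.ellipticMoment_one_sq_le hm1) (DefNLS.ellipticMoment_two_le hm0 hm1)
  refine ⟨fun t => ?_, ?_⟩
  · rw [DefNLS.finiteGapKurtosis_eq h₁ h₂ h₃ rfl rfl rfl t, DefNLS.kurtosis, hS, hF]
  · rw [DefNLS.kurtosis, hS, hF]
    exact hb
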